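/- **Setting.** Consider finitely many basic fields $\varphi_i$ on Minkowski space $\mathbb R^4$ (signature $+,-,-,-$), each bosonic, a fermionic ghost, or a spinor component; ghosts anticommute with ghosts, spinors with spinors, all other pairs commute. Let $\mathcal L^{(0)}$ be a free Lagrangian, quadratic in the fields and their first derivatives, even in ghosts and in spinors, whose Euler–Lagrange operator $D(\partial)$, a matrix with entries in $\mathbb C[\partial_0,\dots,\partial_3]$, is of Klein–Gordon type: there are masses $m_i\ge 0$ and a (unique) matrix $N(\partial)$ with $DN=ND=-\mathrm{diag}(\square+m_i^2)$. Let $s_0$ be an odd graded derivation commuting with partial derivatives, acting linearly on the basic fields, $s_0\varphi_i=\sum_j S_{ij}(\partial)\varphi_j$, where $S_{ij}\neq 0$ only if one of $\varphi_i,\varphi_j$ is bosonic and the other a ghost, and with $s_0\mathcal L^{(0)}=-\partial_\mu I^\mu$ for some $I^\mu$ which is quadratic in the (differentiated) fields, each term containing exactly one boson and one ghost. Let $j^\mu=-\big(\frac{\partial\mathcal L^{(0)}}{\partial\varphi_{i,\mu}}s_0\varphi_i+I^\mu\big)$ (left derivative) be the free BRS current. $\mathcal F$ is the space of polynomial functionals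 $F=\sum_{n\le N}\sum_{i_1\ldots i_n}\int \varphi_{i_1}(x_1)\cdots\varphi_{i_n}(x_n)\,f_n^{i_1\ldots i_n}(x_1,\dots,x_n)\,dx_1\cdots dx_n$ with graded symmetric, $\mathbb C[[\hbar]]$-valued, compactly supported distributions $f_n$ satisfying $WF(f_n)\subset\{(x,k):\sum_r k_r=0\}$. It is $\mathbb Z_2$-graded by the number of ghost fields, $\mathcal F=\mathcal F_{\rm even}\oplus\mathcal F_{\rm odd}$; $\omega_0(F)=f_0$; $F_{S_0}$ is the restriction of $F$ to the smooth solutions of $D\varphi=0$ with compactly supported Cauchy data. The star product is $$F\star G=\sum_{r\ge0}\frac{\hbar^r}{r!}\int dx\,dy\ \frac{\delta^rF}{\delta\varphi_{c_1}(x_1)\cdots\delta\varphi_{c_r}(x_r)}\ \prod_{l=1}^r W_{c_ld_l}(x_l-y_l)\ \frac{\delta^rG}{\delta\varphi_{d_1}(y_1)\cdots\delta\varphi_{d_r}(y_r)}$$ (summed over the field indices, with the usual signs for fermionic fields), where $W_{ij}=N_{ij}(\partial)\Delta_+^{(m_i)}$ and $\Delta_+^{(m)}(x)=(2\pi)^{-3}\int\frac{d^3p}{2\omega_p}e^{-i(\omega_px^0-\vec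 p\cdot\vec x)}$, $\omega_p=\sqrt{\vec p^{\,2}+m^2}$. Write $[F,G]_\star^{\mp}=F\star G\mp G\star F$, with the plus sign if both $F$ and $G$ are odd and the minus sign otherwise, extended bilinearly. The Poisson bracket is $\{F,G\}=\lim_{\hbar\to0}\frac i\hbar[F,G]^{\mp}_\star$ for $\hbar$-independent $F,G$, extended $\mathbb C[[\hbar]]$-bilinearly. Let $k\in\mathcal D(\mathbb R)$, $h\in\mathcal D(\mathbb R^3)$ be real valued with $\int k=1$, $h=1$ on $\{|\vec x|\le R\}$ and $k(t)=0$ for $|t|\ge R$. For $\lambda>0$ put $Q_\lambda=\int d^4x\,\lambda k(\lambda x^0)\,h(\lambda\vec x)\,j^0(x)$, and define, as pointwise limits of functionals on the solution space, $$d_QF_{S_0}=\lim_{\lambda\downarrow0}\big([Q_\lambda,F]^{\mp}_\star\big)_{S_0},\qquad \{Q,F_{S_0}\}=\lim_{\lambda\downarrow0}\{Q_\lambda,F\}_{S_0}.$$ **Lemma 1.** Assume $\omega_0(d_QF_{S_0})=0$ for all $F\in\mathcal F$. Then: (i) For every $F\in\mathcal F$ both limits exist, and $$d_QF_{S_0}=-i\hbar\,\{Q,F_{S_0}\}.$$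 (ii) $d_Q$ is a graded derivation with respect to the classical (pointwise) product: it is $\mathbb C[[\hbar]]$-linear, and for $F,G\in\mathcal F$ $$d_Q(F_{S_0}G_{S_0})=d_Q(F_{S_0})\,G_{S_0}\pm F_{S_0}\,d_Q(G_{S_0}),$$ with $+$ for $F\in\mathcal F_{\rm even}$ and $-$ for $F\in\mathcal F_{\rm odd}$. -/

import Mathlib

open Filter Topology MeasureTheory
open scoped ContDiff

noncomputable section

namespace BRS

/-! ## Minkowski space, smooth functions, constant coefficient differential operators -/

/-- Minkowski space `ℝ⁴`, the coordinate `0` being time; signature `(+,-,-,-)`. -/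
abbrev Spacetime := Fin 4 → ℝ

/-- Complex valued functions on Minkowski space. -/
abbrev Fun := Spacetime → ℂ

/-- The partial derivative `∂_μ f`. -/
def pd (μ : Fin 4) (f : Fun) : Fun := fun x => fderiv ℝ f x (Pi.single μ 1)

/-- The iterated partial derivative `∂^a f`, `a ∈ ℕ⁴`. -/
def pdIter (a : Fin 4 → ℕ) (f : Fun) : Fun :=
  (pd 0)^[a 0] ((pd 1)^[a 1] ((pd 2)^[a 2] ((pd 3)^[a 3] f)))

/-- Polynomials in `∂_0, …, ∂_3`. -/
abbrev DiffPoly := MvPolynomial (Fin 4) ℂ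

/-- `P(∂) f`. -/
def diffOp (P : DiffPoly) (f : Fun) : Fun :=
  fun x => ∑ a ∈ P.support, P.coeff a * pdIter a f x

/-- The Klein-Gordon operator `□ + m²`. -/
def kleinGordon (m : ℝ) : DiffPoly :=
  MvPolynomial.X 0 ^ 2 - MvPolynomial.X 1 ^ 2 - MvPolynomial.X 2 ^ 2 - MvPolynomial.X 3 ^ 2
    + MvPolynomial.C ((m : ℂ) ^ 2)

/-! ## Statistics of the basic fields -/

/-- A basic field is bosonic, a fermionic ghost, or a fermionic spinor component. -/
inductive FieldKind
  | boson
  | ghost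
  | spinor

/-- Contribution of a field to the `ℤ₂`-grading by the number of (fermionic) ghost fields. -/
def FieldKind.ghostParity : FieldKind → ZMod 2
  | .ghost => 1
  | _ => 0

/-- Sign of the exchange of two fields in the classical product: ghosts anticommute with ghosts,
spinors with spinors, and all other pairs commute. -/
def FieldKind.exch : FieldKind → FieldKind → ℂ
  | .ghost, .ghost => -1
  | .spinor, .spinor => -1
  | _, _ => 1

/-- The sign `(-1)^a` for `a ∈ ℤ₂`. -/
def paritySign (a : ZMod 2) : ℂ := if a = 0 then 1 else -1

/-- All decompositions of an ordered list `l` into a sublist `A` and the complementary sublist `B`,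
with the sign `σ` produced by reordering the product of graded commuting factors `l` into `A ++ B`.
The entries are `(A, B, σ)`. -/
def splits {X : Type*} (kind : X → FieldKind) : List X → List (List X × List X × ℂ)
  | [] => [([], [], 1)]
  | x :: xs =>
      (splits kind xs).map (fun s => (x :: s.1, s.2.1, s.2.2)) ++
      (splits kind xs).map (fun s =>
        (s.1, x :: s.2.1, s.2.2 * (s.1.map fun a => (kind x).exch (kind a)).prod))

/-! ## Distributions with compact support and the wave front set -/

/-- Configurations `(x_1, …, x_n)` of `n` points. -/
abbrev Pts (n : ℕ) := Fin n → Spacetime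

/-- `T` is a distribution on `ℝ^{4n}` with compact support, given as a linear functional on smooth
functions which is continuous with respect to finitely many derivatives on the set `K`
(values of `T` off the smooth functions are irrelevant). -/
structure IsDistributionOn {n : ℕ} (K : Set (Pts n)) (T : (Pts n → ℂ) → ℂ) : Prop where
  map_add : ∀ φ ψ, ContDiff ℝ ∞ φ → ContDiff ℝ ∞ ψ → T (φ + ψ) = T φ + T ψ
  map_smul : ∀ (c : ℂ) φ, ContDiff ℝ ∞ φ → T (c • φ) = c * T φ
  bound : ∃ (N : ℕ) (C : ℝ), ∀ φ, ContDiff ℝ ∞ φ → ∀ B : ℝ, 0 ≤ B →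
    (∀ j ≤ N, ∀ x ∈ K, ‖iteratedFDeriv ℝ j φ x‖ ≤ B) → ‖T φ‖ ≤ C * B

/-- `(x, ξ)` is a regular directed point of `T`: after localization near `x`, the Fourier transform
decreases rapidly in an open cone around `ξ`. -/
def IsRegularDirected {n : ℕ} (T : (Pts n → ℂ) → ℂ) (x ξ : Pts n) : Prop :=
  ∃ χ : Pts n → ℂ, ContDiff ℝ ∞ χ ∧ HasCompactSupport χ ∧ χ x ≠ 0 ∧
    ∃ Γ : Set (Pts n), IsOpen Γ ∧ ξ ∈ Γ ∧ (∀ η ∈ Γ, ∀ t : ℝ, 0 < t → t • η ∈ Γ) ∧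
      ∀ N : ℕ, ∃ C : ℝ, ∀ η ∈ Γ,
        ‖T fun y => χ y * Complex.exp (-Complex.I * ((∑ k, ∑ μ, η k μ * y k μ : ℝ) : ℂ))‖
          ≤ C / (1 + ‖η‖) ^ N

/-- The wave front set of `T`. -/
def waveFrontSet {n : ℕ} (T : (Pts n → ℂ) → ℂ) : Set (Pts n × Pts n) :=
  {p | p.2 ≠ 0 ∧ ¬ IsRegularDirected T p.1 p.2}

/-! ## Quadratic field polynomials -/

/-- A family `B` represents the quadratic field polynomial `∑_{i,j} B_{ij}(∂₁, ∂₂) φ_i φ_j`, where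
the variables `Sum.inl μ` stand for derivatives `∂_μ` of the first factor `φ_i` and `Sum.inr μ` for
those of the second factor `φ_j`. -/
abbrev Quad (I : Type*) := I → I → MvPolynomial (Fin 4 ⊕ Fin 4) ℂ

/-- A differential operator acting on the first factor. -/
def onFst (P : DiffPoly) : MvPolynomial (Fin 4 ⊕ Fin 4) ℂ := MvPolynomial.rename Sum.inl P

/-- A differential operator acting on the second factor. -/
def onSnd (P : DiffPoly) : MvPolynomial (Fin 4 ⊕ Fin 4) ℂ := MvPolynomial.rename Sum.inr P

/-- The density `B(∂₁, ∂₂) f g`, with `∂₁` acting on `f` and `∂₂` on `g`. -/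
def biDiffOp (B : MvPolynomial (Fin 4 ⊕ Fin 4) ℂ) (f g : Fun) : Fun :=
  fun x => ∑ a ∈ B.support,
    B.coeff a * pdIter (fun μ => a (Sum.inl μ)) f x * pdIter (fun μ => a (Sum.inr μ)) g x

section Quad

variable {I : Type*}

/-- The graded symmetric coefficients of a quadratic field polynomial. -/
def Quad.symm (kind : I → FieldKind) (B : Quad I) : Quad I := fun i j =>
  B i j + MvPolynomial.C ((kind i).exch (kind j)) * MvPolynomial.rename Sum.swap (B j i)

/-- `B` and `B'` represent the same element of the algebra of field polynomials, i.e. they agree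
modulo `∂^a φ_i ∂^b φ_j = ± ∂^b φ_j ∂^a φ_i`. -/
def Quad.Equal (kind : I → FieldKind) (B B' : Quad I) : Prop :=
  Quad.symm kind B = Quad.symm kind B'

/-- The divergence `∂_μ I^μ`. -/
def Quad.div (J : Fin 4 → Quad I) : Quad I := fun i j =>
  ∑ μ, (MvPolynomial.X (Sum.inl μ) + MvPolynomial.X (Sum.inr μ)) * J μ i j

/-- The odd graded derivation `s₀` which commutes with partial derivatives and acts on basic fields
by `s₀ φ_i = ∑_j S_{ij}(∂) φ_j`, applied to a quadratic field polynomial: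
`s₀(φ_i φ_j) = (s₀ φ_i) φ_j ± φ_i (s₀ φ_j)`. -/
def Quad.brs [Fintype I] (kind : I → FieldKind) (S : Matrix I I DiffPoly) (B : Quad I) : Quad I :=
  fun i j => ∑ c, onFst (S c i) * B c j
    + ∑ c, MvPolynomial.C (paritySign (kind i).ghostParity) * onSnd (S c j) * B i c

end Quad

/-! ## Free theories with a BRS symmetry -/

/-- At most first derivatives: `none` is no derivative and `some μ` is `∂_μ`. -/
abbrev Jet := Option (Fin 4)

/-- The differential operator belonging to a jet index. -/
def jetPoly : Jet → DiffPoly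
  | none => 1
  | some μ => MvPolynomial.X μ

/-- The sign `(-1)^{|a|}`. -/
def jetSign : Jet → ℂ
  | none => 1
  | some _ => -1

variable {I : Type*}

/-- The coefficients of the (left) derivative `∂L/∂(∂^a φ_i) = ∑_{j,b} c_{jb} ∂^b φ_j` of the
quadratic Lagrangian `L = ∑ L_{ia,jb} ∂^a φ_i ∂^b φ_j`. -/
def lagrangianDeriv (kind : I → FieldKind) (L : I → Jet → I → Jet → ℂ)
    (i : I) (a : Jet) (j : I) (b : Jet) : ℂ :=
  L i a j b + (kind i).exch (kind j) * L j b i a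

/-- The matrix of the Euler-Lagrange equations `∂L/∂φ_i - ∂_μ (∂L/∂φ_{i,μ}) = 0`. -/
def eulerLagrange (kind : I → FieldKind) (L : I → Jet → I → Jet → ℂ) : Matrix I I DiffPoly :=
  fun i j => ∑ a, ∑ b,
    MvPolynomial.C (jetSign a * lagrangianDeriv kind L i a j b) * jetPoly a * jetPoly b

/-- A free field theory with basic fields `φ_i`, `i ∈ I`, given by a quadratic Lagrangian
`∑ L_{ia,jb} ∂^a φ_i ∂^b φ_j` in the fields and their first derivatives.  The Euler-Lagrange
operator `D` is of Klein-Gordon type: there is a (necessarily unique) matrix `N` of differential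
operators with `D N = N D = - diag(□ + m_i²)`.  For scalars and for vector and tensor fields in
Feynman gauge `N` is constant, for spinors it is the Dirac operator `iγ∂ + m`. -/
structure FreeTheory (I : Type*) [Fintype I] [DecidableEq I] where
  kind : I → FieldKind
  L : I → Jet → I → Jet → ℂ
  /-- The Lagrangian has an even number of ghosts and of spinors in each term. -/
  even : ∀ i a j b, L i a j b ≠ 0 → kind i = kind j
  mass : I → ℝ
  mass_nonneg : ∀ i, 0 ≤ mass i
  N : Matrix I I DiffPoly
  D_mul_N : eulerLagrange kind L * N = -Matrix.diagonal fun i => kleinGordon (mass i)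
  N_mul_D : N * eulerLagrange kind L = -Matrix.diagonal fun i => kleinGordon (mass i)

/-- The Lagrangian as a quadratic field polynomial. -/
def FreeTheory.quadL [Fintype I] [DecidableEq I] (T : FreeTheory I) : Quad I := fun i j =>
  ∑ a, ∑ b, MvPolynomial.C (T.L i a j b) * onFst (jetPoly a) * onSnd (jetPoly b)

/-- A free BRS transformation `s₀ φ_i = ∑_j S_{ij}(∂) φ_j`, acting linearly on the basic fields and
changing the ghost parity, which leaves the free Lagrangian invariant up to a divergence,
`s₀ L = - ∂_μ J^μ`, with `J` quadratic and of odd ghost number. -/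
structure FreeBRS [Fintype I] [DecidableEq I] (T : FreeTheory I) where
  S : Matrix I I DiffPoly
  S_odd : ∀ i j, S i j ≠ 0 →
    (T.kind i = .boson ∧ T.kind j = .ghost) ∨ (T.kind i = .ghost ∧ T.kind j = .boson)
  J : Fin 4 → Quad I
  J_odd : ∀ μ i j, J μ i j ≠ 0 →
    (T.kind i = .boson ∧ T.kind j = .ghost) ∨ (T.kind i = .ghost ∧ T.kind j = .boson)
  invariance : Quad.Equal T.kind (Quad.brs T.kind S T.quadL) (-Quad.div J)

/-- The free BRS current, i.e. the Noether current
`j^μ = - ((∂L/∂φ_{i,μ}) s₀ φ_i + J^μ)`. -/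
def FreeBRS.current [Fintype I] [DecidableEq I] {T : FreeTheory I} (s : FreeBRS T) (μ : Fin 4) :
    Quad I := fun j k =>
  -(∑ i, ∑ b, MvPolynomial.C (lagrangianDeriv T.kind T.L i (some μ) j b) *
      onFst (jetPoly b) * onSnd (s.S i k) + s.J μ j k)

/-! ## Field functionals -/

/-- An argument of a Taylor coefficient: a field index and a function smearing that field. -/
abbrev Leg (I : Type*) := I × Fun

/-- A functional `F = ∑_n (1/n!) ∑_{i_1 … i_n} ∫ φ_{i_1}(x_1) … φ_{i_n}(x_n) F_n^{i_1 … i_n}(x_1, …, x_n)`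
not depending on `ħ`, given by its Taylor coefficients
`F [(i_1, f_1), …, (i_n, f_n)] = ⟨F_n^{i_1 … i_n}, f_1 ⊗ … ⊗ f_n⟩`. -/
abbrev ClFunctional (I : Type*) := List (Leg I) → ℂ

/-- A functional with values in formal power series in `ħ`: `F l` is the coefficient of `ħ^l`. -/
abbrev Functional (I : Type*) := ℕ → ClFunctional I

/-- An `ħ`-independent functional as a formal power series. -/
def ofClassical (F : ClFunctional I) : Functional I := fun l => if l = 0 then F else 0

/-- All legs of a list are smooth. -/
def SmoothLegs (legs : List (Leg I)) : Prop := ∀ x ∈ legs, ContDiff ℝ ∞ x.2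

/-- The space `𝓕` of field functionals: polynomials in the fields whose coefficients are graded
symmetric `ℂ[[ħ]]`-valued distributions with compact support which are translation invariant up to
smooth functions, `WF ⊂ {(x, ξ) | ξ_1 + … + ξ_n = 0}`. -/
structure IsField (kind : I → FieldKind) (F : Functional I) : Prop where
  polynomial : ∃ N : ℕ, ∀ l legs, SmoothLegs legs → N < legs.length → F l legs = 0
  gradedSymm : ∀ l (u v : List (Leg I)) (x y : Leg I), SmoothLegs (u ++ x :: y :: v) →
    F l (u ++ x :: y :: v) = (kind x.1).exch (kind y.1) * F l (u ++ y :: x :: v)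
  distribution : ∀ n : ℕ, ∃ K : Set (Pts n), IsCompact K ∧ ∀ (l : ℕ) (α : Fin n → I),
    ∃ T : (Pts n → ℂ) → ℂ, IsDistributionOn K T ∧
      (∀ p ∈ waveFrontSet T, ∑ k, p.2 k = 0) ∧
      ∀ f : Fin n → Fun, (∀ k, ContDiff ℝ ∞ (f k)) →
        F l (List.ofFn fun k => (α k, f k)) = T fun x => ∏ k, f k (x k)

/-- The ghost parity of a list of legs. -/
def ghostParity (kind : I → FieldKind) (legs : List (Leg I)) : ZMod 2 :=
  (legs.map fun x => (kind x.1).ghostParity).sum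

/-- `F` has definite ghost parity `a`, i.e. `F ∈ 𝓕_even` for `a = 0` and `F ∈ 𝓕_odd` for `a = 1`. -/
def HasParity (kind : I → FieldKind) (a : ZMod 2) (F : Functional I) : Prop :=
  ∀ l legs, SmoothLegs legs → ghostParity kind legs ≠ a → F l legs = 0

/-- The part of `F` with ghost parity `a`. -/
def parityPart (kind : I → FieldKind) (a : ZMod 2) (F : Functional I) : Functional I :=
  fun l legs => if ghostParity kind legs = a then F l legs else 0

/-- Multiplication with a formal power series in `ħ`, on `ℂ[[ħ]]`-valued functionals of any
argument type `X`. -/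
def hsmul {X : Type*} (c : PowerSeries ℂ) (F : ℕ → X → ℂ) : ℕ → X → ℂ := fun l x =>
  ∑ q ∈ Finset.HasAntidiagonal.antidiagonal l, PowerSeries.coeff q.1 c * F q.2 x

/-- The classical (pointwise) product in terms of Taylor coefficients, for functionals of lists of
graded arguments. -/
def gmul {X : Type*} (kind : X → FieldKind) (F G : ℕ → List X → ℂ) : ℕ → List X → ℂ := fun l xs =>
  ∑ q ∈ Finset.HasAntidiagonal.antidiagonal l,
    ((splits kind xs).map fun s => s.2.2 * F q.1 s.1 * G q.2 s.2.1).sum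

/-- The classical product of field functionals. -/
def mul (kind : I → FieldKind) (F G : Functional I) : Functional I :=
  gmul (fun x : Leg I => kind x.1) F G

/-! ## The star product and the Poisson bracket -/

/-- The energy `ω = √(p² + m²)`. -/
def energy (m : ℝ) (p : Fin 3 → ℝ) : ℝ := Real.sqrt (∑ i, p i ^ 2 + m ^ 2)

/-- The plane wave `x ↦ exp(σ i (ω x⁰ - p·x))` on the mass shell. -/
def planeWave (σ : ℂ) (m : ℝ) (p : Fin 3 → ℝ) : Fun := fun x =>
  Complex.exp (σ * Complex.I * ((energy m p * x 0 - ∑ i, p i * x (Fin.succ i) : ℝ) : ℂ))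

section Star

variable [Fintype I] [DecidableEq I]

/-- The two-point function is `ω₀(φ_i(x) ⋆ φ_j(y)) = ħ N_{ij}(∂) Δ₊(x - y)` with
`Δ₊(x) = (2π)⁻³ ∫ d³p/(2ω) exp(-i(ω x⁰ - p·x))`; this is the coefficient of
`exp(-i(ω (x⁰ - y⁰) - p·(x - y)))` in its integrand. -/
def twoPoint (T : FreeTheory I) (i j : I) (p : Fin 3 → ℝ) : ℂ :=
  MvPolynomial.eval
      (Fin.cons (-Complex.I * (energy (T.mass i) p : ℂ)) fun l : Fin 3 => Complex.I * (p l : ℂ))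
      (T.N i j) /
    (((2 * Real.pi) ^ 3 * (2 * energy (T.mass i) p) : ℝ) : ℂ)

/-- The term of the star product with `r` contractions,
`(1/r!) ∫ dx dy (δ^r F/δφ(x_1)…δφ(x_r)) ∏_i W(x_i - y_i) (δ^r G/δφ(y_1)…δφ(y_r))`,
with the two-point functions inserted as integrals over the mass shells.  The contracted fields are
ordered as `F ∋ … φ(x_1) … φ(x_r)` and `φ(y_r) … φ(y_1) … ∈ G`. -/
def contraction (T : FreeTheory I) (r : ℕ) (F G : ClFunctional I) : ClFunctional I := fun legs =>
  ((splits (fun x : Leg I => T.kind x.1) legs).map fun s =>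
    s.2.2 * ((r.factorial : ℂ)⁻¹ * ∑ c : Fin r → I, ∑ d : Fin r → I, ∫ p : Fin r → Fin 3 → ℝ,
      (∏ k, twoPoint T (c k) (d k) (p k)) *
      F (s.1 ++ List.ofFn fun k => (c k, planeWave (-1) (T.mass (c k)) (p k))) *
      G ((List.ofFn fun k => (d k, planeWave 1 (T.mass (c k)) (p k))).reverse ++ s.2.1))).sum

/-- The star product, the term with `r` contractions being accompanied by `ħ^r`. -/
def star (T : FreeTheory I) (F G : Functional I) : Functional I := fun l =>
  ∑ q ∈ Finset.HasAntidiagonal.antidiagonal l, ∑ q' ∈ Finset.HasAntidiagonal.antidiagonal q.2,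
    contraction T q.1 (F q'.1) (G q'.2)

/-- The graded star commutator: `F ⋆ G - (-1)^{ab} G ⋆ F` for `F`, `G` of ghost parity `a`, `b`. -/
def gradedComm (T : FreeTheory I) (F G : Functional I) : Functional I := fun l legs =>
  ∑ a : ZMod 2, ∑ b : ZMod 2,
    (star T (parityPart T.kind a F) (parityPart T.kind b G) l legs
      - paritySign (a * b) * star T (parityPart T.kind b G) (parityPart T.kind a F) l legs)

/-- The Poisson bracket `{F, G} = lim_{ħ → 0} (i/ħ) [F, G]_⋆` of `ħ`-independent functionals, i.e.
`i` times the coefficient of `ħ` in the graded commutator (which has no term of order `ħ⁰`). -/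
def clPoisson (T : FreeTheory I) (F G : ClFunctional I) : ClFunctional I := fun legs =>
  Complex.I * gradedComm T (ofClassical F) (ofClassical G) 1 legs

/-- The Poisson bracket, extended `ħ`-bilinearly. -/
def poisson (T : FreeTheory I) (F G : Functional I) : Functional I := fun l legs =>
  ∑ q ∈ Finset.HasAntidiagonal.antidiagonal l, clPoisson T (F q.1) (G q.2) legs

/-! ## On-shell functionals -/

/-- Smooth solutions of the free field equations with compactly supported Cauchy data (i.e. with
support in the causal shadow of a ball), supported on the fields of one kind.  Since the Lagrangian
does not mix the kinds, each solution is a sum of such homogeneous solutions. -/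
structure Solution (T : FreeTheory I) where
  kind : FieldKind
  val : I → Fun
  smooth : ∀ i, ContDiff ℝ ∞ (val i)
  homogeneous : ∀ i, T.kind i ≠ kind → val i = 0
  fieldEq : ∀ i x, ∑ j, diffOp (eulerLagrange T.kind T.L i j) (val j) x = 0
  compactData : ∃ R : ℝ, ∀ i x, val i x ≠ 0 → Real.sqrt (∑ l : Fin 3, x l.succ ^ 2) ≤ R + |x 0|

/-- `ℂ[[ħ]]`-valued functionals on the space of solutions, given by Taylor coefficients. -/
abbrev OnShell (T : FreeTheory I) := ℕ → List (Solution T) → ℂ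

/-- Evaluation of the Taylor coefficients of `F` on a list of solutions, all of their components
being summed over. -/
def clRestrict (T : FreeTheory I) (F : ClFunctional I) : List (Solution T) → ℂ
  | [] => F []
  | h :: hs => ∑ i, clRestrict T (fun legs => F ((i, h.val i) :: legs)) hs

/-- The restriction `F_{S₀}` of `F` to the solutions of the free field equations. -/
def restrict (T : FreeTheory I) (F : Functional I) : OnShell T := fun l => clRestrict T (F l)

/-- The classical product of on-shell functionals. -/
def OnShell.mul {T : FreeTheory I} (F G : OnShell T) : OnShell T :=
  gmul (fun h : Solution T => h.kind) F G

/-- The vacuum state `ω₀`: the coefficient of degree zero. -/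
def vacuum {T : FreeTheory I} (F : OnShell T) : PowerSeries ℂ := PowerSeries.mk fun l => F l []

/-! ## The BRS charge -/

/-- Test functions `k(x⁰)`, `h(x⃗)` for the regularization of the charge: `∫ k = 1` and `h` is a
smeared characteristic function of the ball of radius `R`, where `R` is big compared with the
support of `k`. -/
structure Regulator where
  k : ℝ → ℝ
  h : (Fin 3 → ℝ) → ℝ
  R : ℝ
  k_smooth : ContDiff ℝ ∞ k
  k_compact : HasCompactSupport k
  k_integral : ∫ t, k t = 1
  h_smooth : ContDiff ℝ ∞ h
  h_compact : HasCompactSupport h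
  h_eq_one : ∀ x, ∑ i, x i ^ 2 ≤ R ^ 2 → h x = 1
  k_support : ∀ t, k t ≠ 0 → |t| < R

/-- `k_ε(x⁰) h_ε(x⃗)` with `k_ε(x⁰) = ε k(ε x⁰)` and `h_ε(x⃗) = h(ε x⃗)`. -/
def Regulator.scaled (ρ : Regulator) (ε : ℝ) (x : Spacetime) : ℝ :=
  ε * ρ.k (ε * x 0) * ρ.h fun i => ε * x i.succ

/-- The local functional `∫ d⁴x g(x) B(x)` of a quadratic field polynomial `B`. -/
def smeared (kind : I → FieldKind) (g : Spacetime → ℝ) (B : Quad I) : ClFunctional I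
  | [(i, f₁), (j, f₂)] => ∫ x, (g x : ℂ) *
      (biDiffOp (B i j) f₁ f₂ x + (kind i).exch (kind j) * biDiffOp (B j i) f₂ f₁ x)
  | _ => 0

variable {T : FreeTheory I}

/-- The regularized charge `Q_ε = ∫ d⁴x k_ε(x⁰) h_ε(x⃗) j⁰(x)`. -/
def charge (s : FreeBRS T) (ρ : Regulator) (ε : ℝ) : Functional I :=
  ofClassical (smeared T.kind (ρ.scaled ε) (s.current 0))

/-- `[Q_ε, F_{S₀}]_⋆`. -/
def chargeComm (s : FreeBRS T) (ρ : Regulator) (F : Functional I) (ε : ℝ) : OnShell T :=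
  restrict T (gradedComm T (charge s ρ ε) F)

/-- `{Q_ε, F_{S₀}}`. -/
def chargePoisson (s : FreeBRS T) (ρ : Regulator) (F : Functional I) (ε : ℝ) : OnShell T :=
  restrict T (poisson T (charge s ρ ε) F)

/-- `d_Q F_{S₀} = lim_{ε → 0} [Q_ε, F_{S₀}]_⋆`, a pointwise limit of on-shell functionals. -/
def dQ (s : FreeBRS T) (ρ : Regulator) (F : Functional I) : OnShell T := fun l hs =>
  limUnder (𝓝[>] (0 : ℝ)) fun ε => chargeComm s ρ F ε l hs

/-- `{Q, F_{S₀}} = lim_{ε → 0} {Q_ε, F_{S₀}}`. -/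
def poissonQ (s : FreeBRS T) (ρ : Regulator) (F : Functional I) : OnShell T := fun l hs =>
  limUnder (𝓝[>] (0 : ℝ)) fun ε => chargePoisson s ρ F ε l hs

end Star

end BRS

end

open Filter Topology MeasureTheory
open scoped ContDiff

noncomputable section

namespace BRS

/-! ## Graded decompositions of lists -/

/-! The regularized charge is quadratic, so its graded commutator with a field functional contains
only terms with 0, 1 or 2 contractions, and a term with r contractions carries a factor ħ^r. The
three cases behave differently as ε → 0.

Without contraction the commutator vanishes identically (`oddComm_zero_smearedCharge`). Every term
of the current is a boson-ghost pair, and moving such a pair across a list of legs produces exactly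
the sign that the graded commutator subtracts.

With two contractions the whole charge is evaluated on two plane waves whose frequencies have the
same sign. After rescaling, the Fourier transform of the regulator is taken at (k + k')/ε, whose
frequency is at least (|p| + |p'|)/ε. Rapid decay confines both momenta to size ε; the powers ε⁻³
(regulator), ε⁻² (two factors 1/ω) and ε⁶ (two momentum integrals) leave a bound of order ε, also
for massless fields (`tendsto_integral_two_waves`).

With one contraction the charge couples one solution h to a plane wave. Because D N = N D = -diag(□
+ m²) vanishes on the mass shell, the columns of N, and by graded selfadjointness of D also its
rows, are polarizations of plane wave solutions (`sum_eval_D_mul_N`, `sum_eval_neg_D_mul_N`).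
Noether's theorem makes the bilinear current of h and such a wave conserved (`symm_div_current`,
`div_currentForm`), so without a spatial cutoff its charge does not depend on the time smearing. The
cutoff h(ε x) differs from 1 only where |x| > R/ε. There the causal support of h forces |x⁰| to be
at least about R/ε, where k(ε x⁰) is flat. Energy conservation and a Poincaré inequality bound the
growth of h polynomially, so the error is negligible, uniformly with rapid decay in the frequency
(`exists_cutoffError_decay`). Hence the limit exists and equals the contraction with the charge
without spatial cutoff (`tendsto_sum_integral_chargeForm`).

Therefore d_Q is ħ times, and the Poisson bracket i times, one and the same map `classicalBRS`,
which gives d_Q = -iħ{Q, ·}. A single contraction takes one leg out of its argument, so on a product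
it acts on one factor or on the other. The Leibniz rule is then a matter of signs, settled under the
momentum integral (`commIntegrand_mul`) and transported to solutions by `clRestrict_splitSum`.

From the distributional definition of field functionals the analysis needs only the properties
collected in `Tame`. These are stable under linear combinations and products. -/

lemma FieldKind.exch_comm (a b : FieldKind) : a.exch b = b.exch a := by
  cases a <;> cases b <;> rfl

lemma FieldKind.exch_mul_self (a b : FieldKind) : a.exch b * a.exch b = 1 := by
  cases a <;> cases b <;> simp [FieldKind.exch]

lemma zmod_two_cases (a : ZMod 2) : a = 0 ∨ a = 1 := by
  fin_cases a
  · exact Or.inl rfl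
  · exact Or.inr rfl

lemma paritySign_add (a b : ZMod 2) : paritySign (a + b) = paritySign a * paritySign b := by
  rcases zmod_two_cases a with rfl | rfl <;> rcases zmod_two_cases b with rfl | rfl <;>
    simp [paritySign, one_add_one_eq_two, show (2 : ZMod 2) = 0 from rfl]

lemma paritySign_mul_self (a : ZMod 2) : paritySign a * paritySign a = 1 := by
  unfold paritySign; split_ifs <;> simp

section Splits

variable {X : Type*} (kind : X → FieldKind)

/-- The sign of moving `x` across the list `A`. -/
def exchList (x : X) (A : List X) : ℂ := (A.map fun a => (kind x).exch (kind a)).prod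

/-- The sign of moving the list `A` across the list `B`. -/
def exchLists (A B : List X) : ℂ := (A.map fun a => exchList kind a B).prod

/-- The signed sum of `Φ` over all decompositions of a list. -/
def splitSum (Φ : List X → List X → ℂ) (l : List X) : ℂ :=
  ((splits kind l).map fun s => s.2.2 * Φ s.1 s.2.1).sum

@[simp] lemma exchList_nil (x : X) : exchList kind x [] = 1 := rfl

lemma exchList_cons (x a : X) (A : List X) :
    exchList kind x (a :: A) = (kind x).exch (kind a) * exchList kind x A := by
  simp [exchList]

lemma exchList_append (x : X) (A B : List X) :
    exchList kind x (A ++ B) = exchList kind x A * exchList kind x B := by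
  simp [exchList]

lemma exchList_perm (x : X) {A B : List X} (h : A.Perm B) :
    exchList kind x A = exchList kind x B :=
  (h.map _).prod_eq

lemma exchList_mul_self (x : X) (A : List X) : exchList kind x A * exchList kind x A = 1 := by
  induction A with
  | nil => simp
  | cons a A ih =>
    rw [exchList_cons]
    linear_combination (exchList kind x A * exchList kind x A) *
      (kind x).exch_mul_self (kind a) + ih

@[simp] lemma exchLists_nil (B : List X) : exchLists kind [] B = 1 := rfl

lemma exchLists_cons (a : X) (A B : List X) :
    exchLists kind (a :: A) B = exchList kind a B * exchLists kind A B := by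
  simp [exchLists]

lemma exchLists_cons_right (A : List X) (b : X) (B : List X) :
    exchLists kind A (b :: B) = exchList kind b A * exchLists kind A B := by
  induction A with
  | nil => simp
  | cons a A ih =>
    rw [exchLists_cons, exchLists_cons, exchList_cons, exchList_cons, ih, FieldKind.exch_comm]
    ring

@[simp] lemma exchLists_nil_right (A : List X) : exchLists kind A [] = 1 := by
  simp [exchLists]

@[simp] lemma splitSum_nil (Φ : List X → List X → ℂ) : splitSum kind Φ [] = Φ [] [] := by
  simp [splitSum, splits]

lemma splitSum_cons (Φ : List X → List X → ℂ) (x : X) (l : List X) :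
    splitSum kind Φ (x :: l) = splitSum kind (fun A B => Φ (x :: A) B) l
      + splitSum kind (fun A B => exchList kind x A * Φ A (x :: B)) l := by
  simp only [splitSum, splits, List.map_append, List.map_map, List.sum_append]
  congr 2
  refine List.map_congr_left fun s _ => ?_
  simp [exchList, mul_assoc]

lemma splitSum_add (Φ Ψ : List X → List X → ℂ) (l : List X) :
    splitSum kind (fun A B => Φ A B + Ψ A B) l = splitSum kind Φ l + splitSum kind Ψ l := by
  simp only [splitSum, mul_add, List.sum_map_add]

lemma splitSum_mul_left (c : ℂ) (Φ : List X → List X → ℂ) (l : List X) :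
    splitSum kind (fun A B => c * Φ A B) l = c * splitSum kind Φ l := by
  simp only [splitSum, mul_left_comm _ c, List.sum_map_mul_left]

lemma splitSum_mul_right (c : ℂ) (Φ : List X → List X → ℂ) (l : List X) :
    splitSum kind (fun A B => Φ A B * c) l = splitSum kind Φ l * c := by
  simp only [mul_comm _ c, splitSum_mul_left]

lemma splitSum_sub (Φ Ψ : List X → List X → ℂ) (l : List X) :
    splitSum kind (fun A B => Φ A B - Ψ A B) l = splitSum kind Φ l - splitSum kind Ψ l := by
  have := splitSum_add kind Φ (fun A B => (-1) * Ψ A B) l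
  rw [splitSum_mul_left] at this
  simpa [sub_eq_add_neg] using this

@[simp] lemma splitSum_zero (l : List X) : splitSum kind (fun _ _ => 0) l = 0 := by
  simp [splitSum]

lemma splitSum_finset_sum {ι : Type*} (t : Finset ι) (Φ : ι → List X → List X → ℂ) (l : List X) :
    splitSum kind (fun A B => ∑ i ∈ t, Φ i A B) l = ∑ i ∈ t, splitSum kind (Φ i) l := by
  classical
  induction t using Finset.induction_on with
  | empty => simp
  | insert a t ha ih => simp only [Finset.sum_insert ha, splitSum_add, ih]

lemma splits_perm (l : List X) : ∀ s ∈ splits kind l, (s.1 ++ s.2.1).Perm l := by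
  induction l with
  | nil => simp [splits]
  | cons x l ih =>
    intro s hs
    simp only [splits, List.mem_append, List.mem_map] at hs
    rcases hs with ⟨t, ht, rfl⟩ | ⟨t, ht, rfl⟩
    · exact (ih t ht).cons x
    · exact List.perm_middle.trans ((ih t ht).cons x)

/-- Only complementary sublists occur. This is how smoothness, support and parity of the full list
of legs are passed on to its pieces in all later arguments. -/
lemma splitSum_congr {Φ Ψ : List X → List X → ℂ} {l : List X}
    (h : ∀ A B, (A ++ B).Perm l → Φ A B = Ψ A B) : splitSum kind Φ l = splitSum kind Ψ l := by
  unfold splitSum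
  congr 1
  exact List.map_congr_left fun s hs => by rw [h _ _ (splits_perm kind l s hs)]

/-- Graded commutativity. In the induction the two halves cross over: the head lying in `A` on one
side corresponds to the head lying in `B` on the other, and its sign across the other sublist
squares to one. -/
lemma splitSum_comm (Φ : List X → List X → ℂ) (l : List X) :
    splitSum kind Φ l = splitSum kind (fun A B => exchLists kind A B * Φ B A) l := by
  induction l generalizing Φ with
  | nil => simp
  | cons x l ih =>
    rw [splitSum_cons, splitSum_cons, add_comm, ih, ih (fun A B => Φ (x :: A) B)]
    congr 1
    · refine splitSum_congr kind fun A B _ => ?_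
      rw [exchLists_cons]; ring
    · refine splitSum_congr kind fun A B _ => ?_
      rw [exchLists_cons_right]
      linear_combination (-exchLists kind A B * Φ (x :: B) A) * exchList_mul_self kind x A

/-- Both sides run over decompositions into three sublists. The signs match because moving an
element across `A ++ B` is the product of moving it across `A` and across `B`. -/
lemma splitSum_assoc (Φ : List X → List X → List X → ℂ) (l : List X) :
    splitSum kind (fun A R => splitSum kind (fun B C => Φ A B C) R) l =
      splitSum kind (fun R C => splitSum kind (fun A B => Φ A B C) R) l := by
  induction l generalizing Φ with
  | nil => simp
  | cons x l ih =>
    rw [splitSum_cons, splitSum_cons]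
    simp only [splitSum_cons, mul_add, splitSum_add, ← splitSum_mul_left]
    rw [ih, ih, ih, ← add_assoc]
    congr 1
    refine splitSum_congr kind fun A B _ => splitSum_congr kind fun A' B' h => ?_
    rw [← exchList_perm kind x h, exchList_append]
    ring

/-- Counterpart of `splitSum_cons` for the last element: to join the left sublist it has to pass the
right one. It is needed because a functional standing on the left of a contraction receives its
contracted leg at the end. -/
lemma splitSum_append_singleton (Φ : List X → List X → ℂ) (l : List X) (c : X) :
    splitSum kind Φ (l ++ [c]) =
      splitSum kind (fun A B => exchList kind c B * Φ (A ++ [c]) B + Φ A (B ++ [c])) l := by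
  induction l generalizing Φ with
  | nil => simp [splitSum_cons]
  | cons x l ih =>
    rw [List.cons_append, splitSum_cons, splitSum_cons, ih, ih]
    simp only [splitSum_add, List.cons_append, mul_add]
    congr 2
    refine splitSum_congr kind fun A B _ => ?_
    rw [exchList_append, exchList_cons, exchList_cons, FieldKind.exch_comm]
    simp only [exchList_nil]
    ring

lemma gmul_apply (F G : ℕ → List X → ℂ) (l : ℕ) (xs : List X) :
    gmul kind F G l xs = ∑ q ∈ Finset.HasAntidiagonal.antidiagonal l,
      splitSum kind (fun A B => F q.1 A * G q.2 B) xs := by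
  simp only [gmul, splitSum, mul_assoc]

end Splits

/-! ## Legs with support in the causal shadow of a ball -/

/-- `f` is smooth and supported in the causal shadow of a ball. -/
def SpatiallyCompact (f : Fun) : Prop :=
  ContDiff ℝ ∞ f ∧ ∃ R : ℝ, ∀ x, f x ≠ 0 → Real.sqrt (∑ l : Fin 3, x l.succ ^ 2) ≤ R + |x 0|

variable {I : Type*}

/-- All legs are spatially compact. -/
def CompactLegs (legs : List (Leg I)) : Prop := ∀ x ∈ legs, SpatiallyCompact x.2

lemma CompactLegs.smooth {legs : List (Leg I)} (h : CompactLegs legs) : SmoothLegs legs :=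
  fun x hx => (h x hx).1

lemma CompactLegs.perm {l l' : List (Leg I)} (h : CompactLegs l) (p : l'.Perm l) :
    CompactLegs l' := fun x hx => h x (p.mem_iff.1 hx)

lemma CompactLegs.left {A B : List (Leg I)} (h : CompactLegs (A ++ B)) : CompactLegs A :=
  fun x hx => h x (List.mem_append_left _ hx)

lemma CompactLegs.right {A B : List (Leg I)} (h : CompactLegs (A ++ B)) : CompactLegs B :=
  fun x hx => h x (List.mem_append_right _ hx)

lemma CompactLegs.cons {x : Leg I} {A : List (Leg I)} (hx : SpatiallyCompact x.2)
    (h : CompactLegs A) : CompactLegs (x :: A) := by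
  intro y hy
  rcases List.mem_cons.1 hy with rfl | hy
  · exact hx
  · exact h y hy

/-- `F` vanishes if one of its (spatially compact) arguments is zero. -/
def VanishesAtZero (F : ClFunctional I) : Prop :=
  ∀ legs, CompactLegs legs → (∃ x ∈ legs, x.2 = 0) → F legs = 0

/-! ### Restriction of Taylor coefficients to solutions. -/

section Restrict

variable [Fintype I] [DecidableEq I] {T : FreeTheory I}

lemma Solution.spatiallyCompact (h : Solution T) (i : I) : SpatiallyCompact (h.val i) :=
  ⟨h.smooth i, h.compactData.imp fun _ hR => hR i⟩

/-- All components of a solution are spatially compact, so on-shell statements need to be checked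
only on lists of compact legs. -/
lemma clRestrict_congr {F G : ClFunctional I} (hFG : ∀ legs, CompactLegs legs → F legs = G legs)
    (hs : List (Solution T)) : clRestrict T F hs = clRestrict T G hs := by
  induction hs generalizing F G with
  | nil => exact hFG [] (by simp [CompactLegs])
  | cons h hs ih =>
    refine Finset.sum_congr rfl fun i _ => ih fun legs hl => hFG _ (hl.cons ?_)
    exact h.spatiallyCompact i

lemma clRestrict_add (F G : ClFunctional I) (hs : List (Solution T)) :
    clRestrict T (fun legs => F legs + G legs) hs = clRestrict T F hs + clRestrict T G hs := by
  induction hs generalizing F G with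
  | nil => rfl
  | cons h hs ih => simp only [clRestrict, ih, Finset.sum_add_distrib]

lemma clRestrict_mul_left (c : ℂ) (F : ClFunctional I) (hs : List (Solution T)) :
    clRestrict T (fun legs => c * F legs) hs = c * clRestrict T F hs := by
  induction hs generalizing F with
  | nil => rfl
  | cons h hs ih => simp only [clRestrict, ih, Finset.mul_sum]

lemma clRestrict_mul_right (c : ℂ) (F : ClFunctional I) (hs : List (Solution T)) :
    clRestrict T (fun legs => F legs * c) hs = clRestrict T F hs * c := by
  simp only [mul_comm _ c, clRestrict_mul_left]

@[simp] lemma clRestrict_zero (hs : List (Solution T)) :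
    clRestrict T (fun _ => 0) hs = 0 := by
  simpa using clRestrict_mul_left 0 (fun _ => 0) hs

lemma clRestrict_sub (F G : ClFunctional I) (hs : List (Solution T)) :
    clRestrict T (fun legs => F legs - G legs) hs = clRestrict T F hs - clRestrict T G hs := by
  have := clRestrict_add F (fun legs => (-1) * G legs) hs
  rw [clRestrict_mul_left] at this
  simpa [sub_eq_add_neg] using this

lemma clRestrict_finset_sum {ι : Type*} (t : Finset ι) (F : ι → ClFunctional I)
    (hs : List (Solution T)) :
    clRestrict T (fun legs => ∑ q ∈ t, F q legs) hs = ∑ q ∈ t, clRestrict T (F q) hs := by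
  classical
  induction t using Finset.induction_on with
  | empty => simp
  | insert a t ha ih => simp only [Finset.sum_insert ha, clRestrict_add, ih]

/-- Signs of legs are read off the field index, signs of solutions off the kind of the solution.
They can differ only at components of the wrong kind, which vanish by homogeneity; there `F`
vanishes as well. -/
lemma clRestrict_exchList (k : FieldKind) {F : ClFunctional I} (hF : VanishesAtZero F)
    (hs : List (Solution T)) :
    clRestrict T (fun legs => (legs.map fun a => k.exch (T.kind a.1)).prod * F legs) hs =
      (hs.map fun h => k.exch h.kind).prod * clRestrict T F hs := by
  induction hs generalizing F with
  | nil => simp [clRestrict]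
  | cons h hs ih =>
    simp only [clRestrict, List.map_cons, List.prod_cons, Finset.mul_sum]
    refine Finset.sum_congr rfl fun i _ => ?_
    by_cases hi : T.kind i = h.kind
    · simp only [mul_assoc, clRestrict_mul_left]
      rw [ih, hi]
      intro legs hl hz
      exact hF _ (hl.cons (h.spatiallyCompact i)) (by
        obtain ⟨x, hx, hx0⟩ := hz
        exact ⟨x, List.mem_cons_of_mem _ hx, hx0⟩)
    · have h0 : ∀ legs, CompactLegs legs → F ((i, h.val i) :: legs) = 0 := fun legs hl =>
        hF _ (hl.cons (h.spatiallyCompact i))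
          ⟨_, List.mem_cons_self, h.homogeneous i hi⟩
      rw [clRestrict_congr (G := fun _ => 0) (fun legs hl => by rw [h0 legs hl, mul_zero]),
        clRestrict_congr (F := fun legs => F ((i, h.val i) :: legs)) (G := fun _ => 0) h0]
      simp

/-- Restriction to the solutions is compatible with graded decompositions. -/
lemma clRestrict_splitSum (Φ : List (Leg I) → List (Leg I) → ℂ)
    (hΦ : ∀ A B, CompactLegs A → CompactLegs B → (∃ x ∈ A ++ B, x.2 = 0) → Φ A B = 0)
    (hs : List (Solution T)) :
    clRestrict T (splitSum (fun x : Leg I => T.kind x.1) Φ) hs =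
      splitSum (fun h : Solution T => h.kind)
        (fun A B => clRestrict T (fun a => clRestrict T (Φ a) B) A) hs := by
  induction hs generalizing Φ with
  | nil => simp [clRestrict]
  | cons h hs ih =>
    rw [splitSum_cons]
    simp only [clRestrict, splitSum_cons, clRestrict_add, Finset.sum_add_distrib]
    congr 1
    · rw [splitSum_finset_sum]
      refine Finset.sum_congr rfl fun i _ => ?_
      refine ih (fun A B => Φ ((i, h.val i) :: A) B) fun A B hA hB hz => ?_
      refine hΦ _ _ (hA.cons (h.spatiallyCompact i)) hB ?_
      obtain ⟨x, hx, hx0⟩ := hz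
      exact ⟨x, List.mem_cons_of_mem _ hx, hx0⟩
    · simp only [clRestrict_finset_sum, Finset.mul_sum]
      rw [splitSum_finset_sum]
      refine Finset.sum_congr rfl fun i _ => ?_
      have hz' : ∀ A B, CompactLegs A → CompactLegs B → (∃ x ∈ A ++ B, x.2 = 0) →
          Φ A ((i, h.val i) :: B) = 0 := by
        rintro A B hA hB ⟨x, hx, hx0⟩
        refine hΦ _ _ hA (hB.cons (h.spatiallyCompact i)) ⟨x, ?_, hx0⟩
        rcases List.mem_append.1 hx with hx | hx
        · exact List.mem_append_left _ hx
        · exact List.mem_append_right _ (List.mem_cons_of_mem _ hx)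
      rw [ih (fun A B => exchList (fun x : Leg I => T.kind x.1) (i, h.val i) A *
        Φ A ((i, h.val i) :: B)) (fun A B hA hB hz => by rw [hz' A B hA hB hz, mul_zero])]
      refine splitSum_congr _ fun A B _ => ?_
      simp only [clRestrict_mul_left]
      -- Components of the kind of `h` carry the sign of `h`; all others are zero functions, for
      -- which `Φ` gives no contribution.
      by_cases hi : T.kind i = h.kind
      · have := clRestrict_exchList (T := T) (T.kind i)
          (F := fun a => clRestrict T (fun legs => Φ a ((i, h.val i) :: legs)) B) (by
            intro legs hl hz
            beta_reduce
            rw [clRestrict_congr (G := fun _ => 0), clRestrict_zero]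
            intro b hb
            obtain ⟨x, hx, hx0⟩ := hz
            exact hz' _ _ hl hb ⟨x, List.mem_append_left _ hx, hx0⟩) A
        rw [hi] at this
        simpa only [exchList, hi] using this
      · have h0 : ∀ a, CompactLegs a →
            clRestrict T (fun legs => Φ a ((i, h.val i) :: legs)) B = 0 := by
          intro a ha
          rw [clRestrict_congr (G := fun _ => 0), clRestrict_zero]
          intro b hb
          exact hΦ _ _ ha (hb.cons (h.spatiallyCompact i))
            ⟨_, List.mem_append_right _ List.mem_cons_self, h.homogeneous i hi⟩
        rw [clRestrict_congr (G := fun _ => 0) (fun a ha => by rw [h0 a ha, mul_zero]),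
          clRestrict_congr (F := fun a => clRestrict T (fun legs => Φ a ((i, h.val i) :: legs)) B)
            (G := fun _ => 0) h0]
        simp

end Restrict

/-! ## Calculus of constant coefficient differential operators -/

section Calculus

lemma contDiff_pd {f : Fun} (hf : ContDiff ℝ ∞ f) (μ : Fin 4) : ContDiff ℝ ∞ (pd μ f) :=
  (hf.fderiv_right (m := ∞) (by simp)).clm_apply contDiff_const

lemma differentiable_of_smooth {f : Fun} (hf : ContDiff ℝ ∞ f) : Differentiable ℝ f :=
  hf.differentiable (by simp)

lemma pd_add {f g : Fun} (hf : ContDiff ℝ ∞ f) (hg : ContDiff ℝ ∞ g) (μ : Fin 4) :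
    pd μ (f + g) = pd μ f + pd μ g := by
  ext x
  simp [pd, fderiv_add (differentiable_of_smooth hf x) (differentiable_of_smooth hg x)]

lemma pd_smul {f : Fun} (hf : ContDiff ℝ ∞ f) (c : ℂ) (μ : Fin 4) :
    pd μ (c • f) = c • pd μ f := by
  ext x
  simp [pd, fderiv_const_smul (differentiable_of_smooth hf x)]

lemma pd_mul {f g : Fun} (hf : ContDiff ℝ ∞ f) (hg : ContDiff ℝ ∞ g) (μ : Fin 4) :
    pd μ (f * g) = pd μ f * g + f * pd μ g := by
  ext x
  simp [pd, fderiv_mul (differentiable_of_smooth hf x) (differentiable_of_smooth hg x)]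
  ring

lemma pd_comm {f : Fun} (hf : ContDiff ℝ ∞ f) (μ ν : Fin 4) :
    pd μ (pd ν f) = pd ν (pd μ f) := by
  have h : ∀ (x u v : Spacetime), fderiv ℝ (fun y => fderiv ℝ f y v) x u
      = fderiv ℝ (fderiv ℝ f) x u v := fun x u v => by
    rw [fderiv_clm_apply ((hf.fderiv_right (m := ∞) (by simp)).differentiable (by simp) x)
      (differentiableAt_const v)]
    simp
  ext x
  have hs : IsSymmSndFDerivAt ℝ f x :=
    (hf.contDiffAt).isSymmSndFDerivAt (by
      rw [minSmoothness_of_isRCLikeNormedField]; exact WithTop.coe_le_coe.2 le_top)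
  exact (h x _ _).trans ((hs.eq _ _).trans (h x _ _).symm)

lemma contDiff_iterate_pd {f : Fun} (hf : ContDiff ℝ ∞ f) (μ : Fin 4) (n : ℕ) :
    ContDiff ℝ ∞ ((pd μ)^[n] f) := by
  induction n with
  | zero => exact hf
  | succ n ih => rw [Function.iterate_succ_apply']; exact contDiff_pd ih μ

lemma pd_iterate_comm {f : Fun} (hf : ContDiff ℝ ∞ f) (μ ν : Fin 4) (n : ℕ) :
    pd ν ((pd μ)^[n] f) = (pd μ)^[n] (pd ν f) := by
  induction n with
  | zero => rfl
  | succ n ih =>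
    rw [Function.iterate_succ_apply', Function.iterate_succ_apply', ← ih,
      pd_comm (contDiff_iterate_pd hf μ n)]

lemma contDiff_pdIter {f : Fun} (hf : ContDiff ℝ ∞ f) (a : Fin 4 → ℕ) :
    ContDiff ℝ ∞ (pdIter a f) :=
  contDiff_iterate_pd (contDiff_iterate_pd (contDiff_iterate_pd
    (contDiff_iterate_pd hf _ _) _ _) _ _) _ _

lemma pdIter_pd {f : Fun} (hf : ContDiff ℝ ∞ f) (a : Fin 4 → ℕ) (ν : Fin 4) :
    pdIter a (pd ν f) = pd ν (pdIter a f) := by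
  have h3 := contDiff_iterate_pd hf 3 (a 3)
  have h2 := contDiff_iterate_pd h3 2 (a 2)
  have h1 := contDiff_iterate_pd h2 1 (a 1)
  simp only [pdIter]
  rw [pd_iterate_comm h1, pd_iterate_comm h2, pd_iterate_comm h3, pd_iterate_comm hf]

lemma pdIter_add_single {f : Fun} (hf : ContDiff ℝ ∞ f) (a : Fin 4 → ℕ) (ν : Fin 4) :
    pdIter (a + Pi.single ν 1) f = pd ν (pdIter a f) := by
  have h3 := contDiff_iterate_pd hf 3 (a 3)
  have h2 := contDiff_iterate_pd h3 2 (a 2)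
  have h1 := contDiff_iterate_pd h2 1 (a 1)
  fin_cases ν
  · simp [pdIter, Function.iterate_succ_apply']
  · simp only [pdIter]
    change _ = pd 1 _
    rw [pd_iterate_comm h1]
    simp [Function.iterate_succ_apply']
  · simp only [pdIter]
    change _ = pd 2 _
    rw [pd_iterate_comm h1, pd_iterate_comm h2]
    simp [Function.iterate_succ_apply']
  · simp only [pdIter]
    change _ = pd 3 _
    rw [pd_iterate_comm h1, pd_iterate_comm h2, pd_iterate_comm h3]
    simp [Function.iterate_succ_apply']

lemma iterate_pd_add {f g : Fun} (hf : ContDiff ℝ ∞ f) (hg : ContDiff ℝ ∞ g) (μ : Fin 4) (n : ℕ) :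
    (pd μ)^[n] (f + g) = (pd μ)^[n] f + (pd μ)^[n] g := by
  induction n with
  | zero => rfl
  | succ n ih =>
    simp only [Function.iterate_succ_apply', ih]
    exact pd_add (contDiff_iterate_pd hf μ n) (contDiff_iterate_pd hg μ n) μ

lemma iterate_pd_smul {f : Fun} (hf : ContDiff ℝ ∞ f) (c : ℂ) (μ : Fin 4) (n : ℕ) :
    (pd μ)^[n] (c • f) = c • (pd μ)^[n] f := by
  induction n with
  | zero => rfl
  | succ n ih =>
    simp only [Function.iterate_succ_apply', ih]
    exact pd_smul (contDiff_iterate_pd hf μ n) c μ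

lemma pdIter_add {f g : Fun} (hf : ContDiff ℝ ∞ f) (hg : ContDiff ℝ ∞ g) (a : Fin 4 → ℕ) :
    pdIter a (f + g) = pdIter a f + pdIter a g := by
  have hf3 := contDiff_iterate_pd hf 3 (a 3)
  have hf2 := contDiff_iterate_pd hf3 2 (a 2)
  have hf1 := contDiff_iterate_pd hf2 1 (a 1)
  have hg3 := contDiff_iterate_pd hg 3 (a 3)
  have hg2 := contDiff_iterate_pd hg3 2 (a 2)
  have hg1 := contDiff_iterate_pd hg2 1 (a 1)
  simp only [pdIter]
  rw [iterate_pd_add hf hg, iterate_pd_add hf3 hg3, iterate_pd_add hf2 hg2, iterate_pd_add hf1 hg1]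

lemma pdIter_smul {f : Fun} (hf : ContDiff ℝ ∞ f) (c : ℂ) (a : Fin 4 → ℕ) :
    pdIter a (c • f) = c • pdIter a f := by
  have hf3 := contDiff_iterate_pd hf 3 (a 3)
  have hf2 := contDiff_iterate_pd hf3 2 (a 2)
  have hf1 := contDiff_iterate_pd hf2 1 (a 1)
  simp only [pdIter]
  rw [iterate_pd_smul hf, iterate_pd_smul hf3, iterate_pd_smul hf2, iterate_pd_smul hf1]

/-! ### Operators acting on one function -/

/-- Coefficients off the support vanish, so operators with different supports can be compared on a
common index set. -/
lemma diffOp_of_subset (P : DiffPoly) (f : Fun) (x : Spacetime) {t : Finset (Fin 4 →₀ ℕ)}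
    (ht : P.support ⊆ t) : diffOp P f x = ∑ a ∈ t, P.coeff a * pdIter a f x := by
  refine Finset.sum_subset ht fun a _ ha => ?_
  rw [MvPolynomial.notMem_support_iff.1 ha, zero_mul]

lemma diffOp_add_poly (P Q : DiffPoly) (f : Fun) :
    diffOp (P + Q) f = diffOp P f + diffOp Q f := by
  classical
  ext x
  rw [Pi.add_apply, diffOp_of_subset (P + Q) f x MvPolynomial.support_add,
    diffOp_of_subset P f x Finset.subset_union_left,
    diffOp_of_subset Q f x Finset.subset_union_right, ← Finset.sum_add_distrib]
  simp [add_mul]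

lemma diffOp_monomial (a : Fin 4 →₀ ℕ) (c : ℂ) (f : Fun) :
    diffOp (MvPolynomial.monomial a c) f = c • pdIter a f := by
  classical
  ext x
  rw [diffOp_of_subset _ f x MvPolynomial.support_monomial_subset]
  simp

lemma contDiff_diffOp (P : DiffPoly) {f : Fun} (hf : ContDiff ℝ ∞ f) :
    ContDiff ℝ ∞ (diffOp P f) :=
  ContDiff.sum fun a _ => contDiff_const.mul (contDiff_pdIter hf a)

lemma diffOp_add {f g : Fun} (hf : ContDiff ℝ ∞ f) (hg : ContDiff ℝ ∞ g) (P : DiffPoly) :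
    diffOp P (f + g) = diffOp P f + diffOp P g := by
  ext x
  simp [diffOp, pdIter_add hf hg, mul_add, Finset.sum_add_distrib]

lemma diffOp_smul {f : Fun} (hf : ContDiff ℝ ∞ f) (c : ℂ) (P : DiffPoly) :
    diffOp P (c • f) = c • diffOp P f := by
  ext x
  simp [diffOp, pdIter_smul hf, mul_left_comm _ c, Finset.mul_sum]

lemma diffOp_C (c : ℂ) (f : Fun) : diffOp (MvPolynomial.C c) f = c • f := by
  rw [MvPolynomial.C_apply, diffOp_monomial]
  rfl

lemma diffOp_X_mul {f : Fun} (hf : ContDiff ℝ ∞ f) (μ : Fin 4) (P : DiffPoly) :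
    diffOp (MvPolynomial.X μ * P) f = diffOp P (pd μ f) := by
  induction P using MvPolynomial.induction_on' with
  | monomial a c =>
    have : MvPolynomial.X μ * MvPolynomial.monomial a c =
        MvPolynomial.monomial (a + Finsupp.single μ 1) c := by
      rw [MvPolynomial.X, MvPolynomial.monomial_mul, one_mul, add_comm]
    rw [this, diffOp_monomial, diffOp_monomial, pdIter_pd hf, ← pdIter_add_single hf]
    congr 2
    ext ν
    simp [Finsupp.single_eq_pi_single]
  | add P Q hP hQ => rw [mul_add, diffOp_add_poly, diffOp_add_poly, hP, hQ]

/-- Induction on `P` reduces this to a single variable, where it says that ∂_μ commutes with `Q(∂)`.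
Smoothness enters through the symmetry of second derivatives. -/
lemma diffOp_mul {f : Fun} (hf : ContDiff ℝ ∞ f) (P Q : DiffPoly) :
    diffOp (P * Q) f = diffOp P (diffOp Q f) := by
  induction P using MvPolynomial.induction_on generalizing f with
  | C c =>
    rw [diffOp_C, ← MvPolynomial.smul_eq_C_mul]
    ext x
    classical
    rw [diffOp_of_subset (c • Q) f x MvPolynomial.support_smul]
    simp [diffOp, Finset.mul_sum, mul_assoc]
  | add P P' hP hP' => rw [add_mul, diffOp_add_poly, diffOp_add_poly, hP hf, hP' hf]
  | mul_X P μ hP =>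
    have hcomm : diffOp Q (pd μ f) = pd μ (diffOp Q f) := by
      ext x
      have : pd μ (diffOp Q f) x = ∑ a ∈ Q.support, Q.coeff a * pd μ (pdIter a f) x := by
        have h := fderiv_fun_sum (𝕜 := ℝ) (x := x) (u := Q.support)
          (A := fun a y => Q.coeff a * pdIter a f y)
          (fun a _ => differentiable_of_smooth (contDiff_const.mul (contDiff_pdIter hf a)) x)
        change fderiv ℝ (fun y => ∑ a ∈ Q.support, Q.coeff a * pdIter a f y) x _ = _
        rw [h, sum_apply]
        refine Finset.sum_congr rfl fun a _ => ?_
        rw [fderiv_const_mul (differentiable_of_smooth (contDiff_pdIter hf a) x)]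
        rfl
      rw [this]
      simp [diffOp, pdIter_pd hf]
    rw [mul_assoc, mul_comm P, mul_assoc, diffOp_X_mul hf, mul_comm Q, hP (contDiff_pd hf μ),
      mul_comm P, diffOp_X_mul (contDiff_diffOp Q hf), hcomm]

/-! ### Operators acting on a product -/

abbrev BiDiffPoly := MvPolynomial (Fin 4 ⊕ Fin 4) ℂ

lemma biDiffOp_of_subset (B : BiDiffPoly) (f g : Fun) (x : Spacetime)
    {t : Finset (Fin 4 ⊕ Fin 4 →₀ ℕ)} (ht : B.support ⊆ t) :
    biDiffOp B f g x = ∑ a ∈ t, B.coeff a * pdIter (fun μ => a (Sum.inl μ)) f x *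
      pdIter (fun μ => a (Sum.inr μ)) g x := by
  refine Finset.sum_subset ht fun a _ ha => ?_
  rw [MvPolynomial.notMem_support_iff.1 ha, zero_mul, zero_mul]

lemma biDiffOp_add_poly (B B' : BiDiffPoly) (f g : Fun) :
    biDiffOp (B + B') f g = biDiffOp B f g + biDiffOp B' f g := by
  classical
  ext x
  rw [Pi.add_apply, biDiffOp_of_subset (B + B') f g x MvPolynomial.support_add,
    biDiffOp_of_subset B f g x Finset.subset_union_left,
    biDiffOp_of_subset B' f g x Finset.subset_union_right, ← Finset.sum_add_distrib]
  simp [add_mul]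

lemma biDiffOp_C_mul (c : ℂ) (B : BiDiffPoly) (f g : Fun) :
    biDiffOp (MvPolynomial.C c * B) f g = c • biDiffOp B f g := by
  classical
  ext x
  rw [← MvPolynomial.smul_eq_C_mul, biDiffOp_of_subset (c • B) f g x MvPolynomial.support_smul]
  simp [biDiffOp, Finset.mul_sum, mul_assoc]

@[simp] lemma biDiffOp_zero_poly (f g : Fun) : biDiffOp 0 f g = 0 := by
  ext x
  simp [biDiffOp]

lemma biDiffOp_sum_poly {ι : Type*} (t : Finset ι) (B : ι → BiDiffPoly) (f g : Fun) :
    biDiffOp (∑ i ∈ t, B i) f g = ∑ i ∈ t, biDiffOp (B i) f g := by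
  classical
  induction t using Finset.induction_on with
  | empty => simp
  | insert a t ha ih => rw [Finset.sum_insert ha, Finset.sum_insert ha, biDiffOp_add_poly, ih]

lemma biDiffOp_monomial (a : Fin 4 ⊕ Fin 4 →₀ ℕ) (c : ℂ) (f g : Fun) :
    biDiffOp (MvPolynomial.monomial a c) f g =
      c • (pdIter (fun μ => a (Sum.inl μ)) f * pdIter (fun μ => a (Sum.inr μ)) g) := by
  classical
  ext x
  rw [biDiffOp_of_subset _ f g x MvPolynomial.support_monomial_subset]
  simp [mul_assoc]

lemma biDiffOp_one (f g : Fun) : biDiffOp 1 f g = f * g := by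
  have : (1 : BiDiffPoly) = MvPolynomial.monomial 0 1 := rfl
  rw [this, biDiffOp_monomial, one_smul]
  rfl

lemma contDiff_biDiffOp (B : BiDiffPoly) {f g : Fun} (hf : ContDiff ℝ ∞ f)
    (hg : ContDiff ℝ ∞ g) : ContDiff ℝ ∞ (biDiffOp B f g) :=
  ContDiff.sum fun _ _ => (contDiff_const.mul (contDiff_pdIter hf _)).mul (contDiff_pdIter hg _)

/-- Exchanging the two groups of variables exchanges the arguments. Rules for the second factor are
deduced from those for the first in this way. -/
lemma biDiffOp_swap (B : BiDiffPoly) (f g : Fun) :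
    biDiffOp (MvPolynomial.rename Sum.swap B) f g = biDiffOp B g f := by
  induction B using MvPolynomial.induction_on' with
  | monomial a c =>
    have hinj : Function.Injective (Sum.swap : Fin 4 ⊕ Fin 4 → Fin 4 ⊕ Fin 4) :=
      (Equiv.sumComm _ _).injective
    have h1 : ∀ μ, Finsupp.mapDomain Sum.swap a (Sum.inl μ) = a (Sum.inr μ) := fun μ =>
      Finsupp.mapDomain_apply hinj a (Sum.inr μ)
    have h2 : ∀ μ, Finsupp.mapDomain Sum.swap a (Sum.inr μ) = a (Sum.inl μ) := fun μ =>
      Finsupp.mapDomain_apply hinj a (Sum.inl μ)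
    rw [MvPolynomial.rename_monomial, biDiffOp_monomial, biDiffOp_monomial, mul_comm]
    simp only [h1, h2]
  | add P Q hP hQ => rw [map_add, biDiffOp_add_poly, biDiffOp_add_poly, hP, hQ]

lemma biDiffOp_X_inl_mul {f : Fun} (hf : ContDiff ℝ ∞ f) (g : Fun) (μ : Fin 4) (B : BiDiffPoly) :
    biDiffOp (MvPolynomial.X (Sum.inl μ) * B) f g = biDiffOp B (pd μ f) g := by
  induction B using MvPolynomial.induction_on' with
  | monomial a c =>
    have : MvPolynomial.X (Sum.inl μ) * MvPolynomial.monomial a c =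
        MvPolynomial.monomial (a + Finsupp.single (Sum.inl μ) 1) c := by
      rw [MvPolynomial.X, MvPolynomial.monomial_mul, one_mul, add_comm]
    rw [this, biDiffOp_monomial, biDiffOp_monomial, pdIter_pd hf, ← pdIter_add_single hf]
    congr 3
    · ext ν
      simp [Finsupp.single_apply, Pi.single_apply, eq_comm]
    · ext ν
      simp
  | add P Q hP hQ => rw [mul_add, biDiffOp_add_poly, biDiffOp_add_poly, hP, hQ]

lemma biDiffOp_X_inr_mul {g : Fun} (hg : ContDiff ℝ ∞ g) (f : Fun) (μ : Fin 4) (B : BiDiffPoly) :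
    biDiffOp (MvPolynomial.X (Sum.inr μ) * B) f g = biDiffOp B f (pd μ g) := by
  rw [← biDiffOp_swap, map_mul, MvPolynomial.rename_X, Sum.swap_inr, biDiffOp_X_inl_mul hg,
    biDiffOp_swap]

lemma biDiffOp_add_left {f f' : Fun} (hf : ContDiff ℝ ∞ f) (hf' : ContDiff ℝ ∞ f')
    (B : BiDiffPoly) (g : Fun) :
    biDiffOp B (f + f') g = biDiffOp B f g + biDiffOp B f' g := by
  ext x
  simp [biDiffOp, pdIter_add hf hf', mul_add, add_mul, Finset.sum_add_distrib]

lemma biDiffOp_smul_left {f : Fun} (hf : ContDiff ℝ ∞ f) (c : ℂ) (B : BiDiffPoly) (g : Fun) :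
    biDiffOp B (c • f) g = c • biDiffOp B f g := by
  ext x
  simp [biDiffOp, pdIter_smul hf, Finset.mul_sum]
  exact Finset.sum_congr rfl fun _ _ => by ring

lemma biDiffOp_smul_right {g : Fun} (hg : ContDiff ℝ ∞ g) (c : ℂ) (B : BiDiffPoly) (f : Fun) :
    biDiffOp B f (c • g) = c • biDiffOp B f g := by
  rw [← biDiffOp_swap, biDiffOp_smul_left hg, biDiffOp_swap]

lemma biDiffOp_onFst_mul {f : Fun} (hf : ContDiff ℝ ∞ f) (g : Fun) (P : DiffPoly)
    (B : BiDiffPoly) : biDiffOp (onFst P * B) f g = biDiffOp B (diffOp P f) g := by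
  induction P using MvPolynomial.induction_on generalizing f with
  | C c => rw [onFst, MvPolynomial.rename_C, biDiffOp_C_mul, diffOp_C, biDiffOp_smul_left hf]
  | add P P' hP hP' =>
    simp only [onFst] at hP hP' ⊢
    rw [map_add, add_mul, biDiffOp_add_poly, diffOp_add_poly, hP hf, hP' hf,
      biDiffOp_add_left (contDiff_diffOp P hf) (contDiff_diffOp P' hf)]
  | mul_X P μ hP =>
    simp only [onFst] at hP ⊢
    rw [map_mul, MvPolynomial.rename_X, mul_comm (MvPolynomial.rename _ P), mul_assoc,
      biDiffOp_X_inl_mul hf, hP (contDiff_pd hf μ), mul_comm P, diffOp_X_mul hf]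

lemma biDiffOp_onSnd_mul {g : Fun} (hg : ContDiff ℝ ∞ g) (f : Fun) (P : DiffPoly)
    (B : BiDiffPoly) : biDiffOp (onSnd P * B) f g = biDiffOp B f (diffOp P g) := by
  have : onSnd P = MvPolynomial.rename Sum.swap (onFst P) := by
    rw [onFst, onSnd, MvPolynomial.rename_rename]; rfl
  have h2 : MvPolynomial.rename Sum.swap (MvPolynomial.rename Sum.swap B) = B := by
    rw [MvPolynomial.rename_rename]
    simp
  rw [this]
  nth_rewrite 1 [← h2]
  rw [← map_mul, biDiffOp_swap, biDiffOp_onFst_mul hg, biDiffOp_swap]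

lemma biDiffOp_onFst_mul_onSnd {f g : Fun} (hf : ContDiff ℝ ∞ f) (hg : ContDiff ℝ ∞ g)
    (P Q : DiffPoly) : biDiffOp (onFst P * onSnd Q) f g = diffOp P f * diffOp Q g := by
  rw [biDiffOp_onFst_mul hf, ← mul_one (onSnd Q), biDiffOp_onSnd_mul hg, biDiffOp_one]

lemma pd_sum {ι : Type*} (t : Finset ι) {f : ι → Fun} (hf : ∀ i ∈ t, ContDiff ℝ ∞ (f i))
    (μ : Fin 4) : pd μ (∑ i ∈ t, f i) = ∑ i ∈ t, pd μ (f i) := by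
  ext x
  simp only [pd, Finset.sum_apply]
  rw [fderiv_sum (fun i hi => differentiable_of_smooth (hf i hi) x), sum_apply]

/-- The product rule. -/
lemma pd_biDiffOp {f g : Fun} (hf : ContDiff ℝ ∞ f) (hg : ContDiff ℝ ∞ g) (μ : Fin 4)
    (B : BiDiffPoly) :
    pd μ (biDiffOp B f g) =
      biDiffOp ((MvPolynomial.X (Sum.inl μ) + MvPolynomial.X (Sum.inr μ)) * B) f g := by
  rw [add_mul, biDiffOp_add_poly, biDiffOp_X_inl_mul hf, biDiffOp_X_inr_mul hg]
  induction B using MvPolynomial.induction_on' with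
  | monomial a c =>
    rw [biDiffOp_monomial, biDiffOp_monomial, biDiffOp_monomial, pdIter_pd hf, pdIter_pd hg,
      pd_smul (f := pdIter _ f * pdIter _ g) ((contDiff_pdIter hf _).mul (contDiff_pdIter hg _)),
      pd_mul (contDiff_pdIter hf _) (contDiff_pdIter hg _), smul_add]
  | add P Q hP hQ =>
    simp only [biDiffOp_add_poly]
    rw [pd_add (contDiff_biDiffOp P hf hg) (contDiff_biDiffOp Q hf hg), hP, hQ]
    abel

/-! ### Plane waves -/

/-- The plane wave `x ↦ exp(i k·x)`. -/
def expWave (k : Spacetime) : Fun := fun x => Complex.exp (Complex.I * ((∑ μ, k μ * x μ : ℝ) : ℂ))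

lemma contDiff_expWave (k : Spacetime) : ContDiff ℝ ∞ (expWave k) := by
  have h : ContDiff ℝ ∞ fun x : Spacetime => ∑ μ, k μ * x μ :=
    ContDiff.sum fun μ _ => contDiff_const.mul (contDiff_apply ℝ ℝ μ)
  exact (contDiff_const.mul (Complex.ofRealCLM.contDiff.comp h)).cexp

lemma norm_expWave (k x : Spacetime) : ‖expWave k x‖ = 1 := by
  rw [expWave, mul_comm]; exact Complex.norm_exp_ofReal_mul_I _

lemma expWave_add (k k' x : Spacetime) : expWave (k + k') x = expWave k x * expWave k' x := by
  simp only [expWave, ← Complex.exp_add, ← mul_add, ← Complex.ofReal_add,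
    ← Finset.sum_add_distrib, Pi.add_apply, add_mul]

lemma pd_expWave (k : Spacetime) (μ : Fin 4) :
    pd μ (expWave k) = (Complex.I * (k μ : ℂ)) • expWave k := by
  ext x
  have h1 : HasFDerivAt (fun x : Spacetime => ∑ μ, k μ * x μ)
      (∑ μ, k μ • (ContinuousLinearMap.proj μ : Spacetime →L[ℝ] ℝ)) x := by
    refine HasFDerivAt.fun_sum fun ν _ => ?_
    exact (ContinuousLinearMap.proj ν : Spacetime →L[ℝ] ℝ).hasFDerivAt.const_mul (k ν)
  have h2 := ((Complex.ofRealCLM.hasFDerivAt.comp x h1).const_mul Complex.I).cexp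
  have h3 : fderiv ℝ (expWave k) x = _ := h2.fderiv
  simp only [pd, h3]
  simp [expWave, Pi.single_apply]
  ring

lemma iterate_pd_expWave (k : Spacetime) (μ : Fin 4) (n : ℕ) :
    (pd μ)^[n] (expWave k) = (Complex.I * (k μ : ℂ)) ^ n • expWave k := by
  induction n with
  | zero => simp
  | succ n ih =>
    rw [Function.iterate_succ_apply', ih, pd_smul (contDiff_expWave k), pd_expWave, smul_smul,
      pow_succ]

lemma pdIter_expWave (k : Spacetime) (a : Fin 4 → ℕ) :
    pdIter a (expWave k) = (∏ μ, (Complex.I * (k μ : ℂ)) ^ a μ) • expWave k := by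
  have h := contDiff_expWave k
  simp only [pdIter, iterate_pd_expWave, iterate_pd_smul h, smul_smul, Fin.prod_univ_four]
  congr 1
  ring

lemma diffOp_expWave (k : Spacetime) (P : DiffPoly) :
    diffOp P (expWave k) =
      MvPolynomial.eval (fun μ => Complex.I * (k μ : ℂ)) P • expWave k := by
  ext x
  simp only [diffOp, pdIter_expWave, MvPolynomial.eval_eq', Pi.smul_apply, smul_eq_mul,
    Finset.sum_mul, mul_assoc]

/-- On a plane wave the second group of derivatives becomes a polynomial in the momentum, leaving an
integrand of Fourier type in the first argument. -/
lemma biDiffOp_expWave (B : BiDiffPoly) (f : Fun) (k x : Spacetime) :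
    biDiffOp B f (expWave k) x = ∑ a ∈ B.support,
      (B.coeff a * ∏ μ, (Complex.I * (k μ : ℂ)) ^ a (Sum.inr μ)) *
        (pdIter (fun μ => a (Sum.inl μ)) f x * expWave k x) := by
  simp only [biDiffOp, pdIter_expWave, Pi.smul_apply, smul_eq_mul]
  exact Finset.sum_congr rfl fun _ _ => by ring

/-! ### Supports -/

lemma pd_eq_zero_of_eventually {f : Fun} {x : Spacetime} (h : ∀ᶠ y in 𝓝 x, f y = 0) (μ : Fin 4) :
    ∀ᶠ y in 𝓝 x, pd μ f y = 0 := by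
  filter_upwards [h.eventually_nhds] with y hy
  have : f =ᶠ[𝓝 y] fun _ => 0 := hy
  rw [pd, this.fderiv_eq]
  simp

lemma iterate_pd_eq_zero_of_eventually {f : Fun} {x : Spacetime} (h : ∀ᶠ y in 𝓝 x, f y = 0)
    (μ : Fin 4) (n : ℕ) : ∀ᶠ y in 𝓝 x, (pd μ)^[n] f y = 0 := by
  induction n with
  | zero => exact h
  | succ n ih => rw [Function.iterate_succ_apply']; exact pd_eq_zero_of_eventually ih μ

lemma pdIter_eq_zero_of_eventually {f : Fun} {x : Spacetime} (h : ∀ᶠ y in 𝓝 x, f y = 0)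
    (a : Fin 4 → ℕ) : ∀ᶠ y in 𝓝 x, pdIter a f y = 0 :=
  iterate_pd_eq_zero_of_eventually (iterate_pd_eq_zero_of_eventually
    (iterate_pd_eq_zero_of_eventually (iterate_pd_eq_zero_of_eventually h _ _) _ _) _ _) _ _

/-- The radius of the spatial part of `x`. -/
def spatialNorm (x : Spacetime) : ℝ := Real.sqrt (∑ l : Fin 3, x l.succ ^ 2)

lemma continuous_spatialNorm : Continuous spatialNorm := by
  unfold spatialNorm; fun_prop

/-- `f` is supported in the causal shadow of the ball of radius `R`. -/
def ConeSupported (R : ℝ) (f : Fun) : Prop := ∀ x, R + |x 0| < spatialNorm x → f x = 0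

lemma spatiallyCompact_iff {f : Fun} :
    SpatiallyCompact f ↔ ContDiff ℝ ∞ f ∧ ∃ R, ConeSupported R f := by
  refine and_congr_right fun _ => exists_congr fun R => forall_congr' fun x => ?_
  rw [← not_le, not_imp_comm]
  rfl

/-- The exterior of the causal shadow is given by a strict inequality and is therefore open. Hence
all derivatives vanish there too, with the same radius. -/
lemma ConeSupported.eventually {R : ℝ} {f : Fun} (hf : ConeSupported R f) {x : Spacetime}
    (hx : R + |x 0| < spatialNorm x) : ∀ᶠ y in 𝓝 x, f y = 0 := by
  have : IsOpen {y : Spacetime | R + |y 0| < spatialNorm y} :=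
    isOpen_lt (by fun_prop) continuous_spatialNorm
  filter_upwards [this.mem_nhds hx] with y hy using hf y hy

lemma ConeSupported.mono {R R' : ℝ} (h : R ≤ R') {f : Fun} (hf : ConeSupported R f) :
    ConeSupported R' f := fun x hx => hf x (by linarith)

lemma ConeSupported.pd {R : ℝ} {f : Fun} (hf : ConeSupported R f) (μ : Fin 4) :
    ConeSupported R (pd μ f) := fun _ hx =>
  (pd_eq_zero_of_eventually (hf.eventually hx) μ).self_of_nhds

lemma ConeSupported.pdIter {R : ℝ} {f : Fun} (hf : ConeSupported R f) (a : Fin 4 → ℕ) :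
    ConeSupported R (pdIter a f) := fun _ hx =>
  (pdIter_eq_zero_of_eventually (hf.eventually hx) a).self_of_nhds

lemma ConeSupported.biDiffOp {R : ℝ} {f : Fun} (hf : ConeSupported R f) (g : Fun)
    (B : BiDiffPoly) : ConeSupported R (biDiffOp B f g) := fun x hx =>
  Finset.sum_eq_zero fun a _ => by rw [hf.pdIter _ x hx]; simp

lemma pdIter_zero_fun (a : Fin 4 → ℕ) : BRS.pdIter a (0 : Fun) = 0 := by
  ext x
  exact (pdIter_eq_zero_of_eventually (Eventually.of_forall fun _ => rfl) a).self_of_nhds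

lemma biDiffOp_zero_left (B : BiDiffPoly) (g : Fun) : BRS.biDiffOp B 0 g = 0 := by
  ext x
  simp [BRS.biDiffOp, pdIter_zero_fun]

lemma abs_coord_le_spatialNorm (x : Spacetime) (l : Fin 3) : |x l.succ| ≤ spatialNorm x := by
  rw [spatialNorm, ← Real.sqrt_sq_eq_abs]
  exact Real.sqrt_le_sqrt (Finset.single_le_sum (f := fun l : Fin 3 => x l.succ ^ 2)
    (fun _ _ => sq_nonneg _) (Finset.mem_univ l))

end Calculus

/-! ## Integration over Minkowski space -/

section Integration

lemma integral_pd_eq_zero {φ : Fun} (hφ : ContDiff ℝ ∞ φ) (hc : HasCompactSupport φ) (μ : Fin 4) :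
    ∫ x, pd μ φ x = 0 := by
  have hc' : HasCompactSupport (pd μ φ) := hc.fderiv_apply (𝕜 := ℝ) _
  have h := integral_mul_fderiv_eq_neg_fderiv_mul_of_integrable (μ := (volume : Measure Spacetime))
    (f := fun _ => (1 : ℂ)) (g := φ) (v := Pi.single μ 1)
    (by simp) (by
      simp only [one_mul]
      exact (contDiff_pd hφ μ).continuous.integrable_of_hasCompactSupport hc')
    (by simpa using hφ.continuous.integrable_of_hasCompactSupport hc)
    (fun x _ => differentiableAt_const _) (fun x _ => differentiable_of_smooth hφ x)
  simpa [pd] using h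

/-- `g` vanishes outside of a bounded time interval. -/
def TimeCompact (g : Fun) : Prop := ∃ T : ℝ, ∀ x, T < |x 0| → g x = 0

/-- A slab |x⁰| ≤ T meets the causal shadow of a ball of radius R only in |x| ≤ R + T. This is why
no spatial cutoff is needed once one argument of the current is a solution. -/
lemma hasCompactSupport_mul_of_timeCompact {g f : Fun} (hg : TimeCompact g) {R : ℝ}
    (hf : ConeSupported R f) : HasCompactSupport (g * f) := by
  obtain ⟨T, hT⟩ := hg
  refine HasCompactSupport.intro (isCompact_closedBall (0 : Spacetime) (max T (R + T)))
    fun x hx => ?_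
  by_contra hne
  have hgx : g x ≠ 0 := fun h => hne (by simp [h])
  have hfx : f x ≠ 0 := fun h => hne (by simp [h])
  have h0 : |x 0| ≤ T := not_lt.1 fun h => hgx (hT x h)
  have h1 : spatialNorm x ≤ R + |x 0| := not_lt.1 fun h => hfx (hf x h)
  refine hx (mem_closedBall_zero_iff.2 ((pi_norm_le_iff_of_nonneg
    ((abs_nonneg _).trans (h0.trans (le_max_left _ _)))).2 fun μ => ?_))
  rw [Real.norm_eq_abs]
  refine Fin.cases (h0.trans (le_max_left _ _)) (fun l => ?_) μ
  exact (abs_coord_le_spatialNorm x l).trans ((h1.trans (by linarith)).trans (le_max_right _ _))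

/-- The function `κ(x⁰)`. -/
def timeFun (κ : ℝ → ℝ) : Fun := fun x => (κ (x 0) : ℂ)

lemma contDiff_timeFun {κ : ℝ → ℝ} (hκ : ContDiff ℝ ∞ κ) : ContDiff ℝ ∞ (timeFun κ) :=
  Complex.ofRealCLM.contDiff.comp (hκ.comp (contDiff_apply ℝ ℝ (0 : Fin 4)))

lemma timeCompact_timeFun {κ : ℝ → ℝ} (hκ : HasCompactSupport κ) : TimeCompact (timeFun κ) := by
  obtain ⟨T, hT⟩ := hκ.isBounded.subset_closedBall (0 : ℝ)
  refine ⟨T, fun x hx => ?_⟩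
  have : x 0 ∉ tsupport κ := fun h => by
    have := hT h
    rw [mem_closedBall_zero_iff, Real.norm_eq_abs] at this
    linarith
  simp [timeFun, image_eq_zero_of_notMem_tsupport this]

lemma pd_timeFun {κ : ℝ → ℝ} (hκ : ContDiff ℝ ∞ κ) (μ : Fin 4) :
    pd μ (timeFun κ) = if μ = 0 then timeFun (deriv κ) else 0 := by
  ext x
  have h1 : HasFDerivAt (fun x : Spacetime => x 0)
    (ContinuousLinearMap.proj 0 : Spacetime →L[ℝ] ℝ) x :=
    (ContinuousLinearMap.proj 0 : Spacetime →L[ℝ] ℝ).hasFDerivAt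
  have h2 := ((hκ.differentiable (by simp) (x 0)).hasDerivAt.comp_hasFDerivAt x h1)
  have h3 := Complex.ofRealCLM.hasFDerivAt.comp x h2
  have h4 : fderiv ℝ (timeFun κ) x = _ := h3.fderiv
  simp only [pd, h4]
  split_ifs with h
  · subst h; simp [timeFun]
  · simp [Ne.symm h]

/-- The primitive starting to the left of the support is zero there, and to the right it equals the
full integral, which vanishes by hypothesis. -/
lemma exists_primitive {κ : ℝ → ℝ} (hκ : ContDiff ℝ ∞ κ) (hc : HasCompactSupport κ)
    (h0 : ∫ t, κ t = 0) :
    ∃ K : ℝ → ℝ, ContDiff ℝ ∞ K ∧ HasCompactSupport K ∧ deriv K = κ := by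
  obtain ⟨r, hr⟩ := hc.isBounded.subset_closedBall (0 : ℝ)
  have hz : ∀ t, r < |t| → κ t = 0 := fun t ht => image_eq_zero_of_notMem_tsupport fun h => by
    have := hr h
    rw [mem_closedBall_zero_iff, Real.norm_eq_abs] at this
    linarith
  -- Strictly to the left of the support; the absolute value covers a negative `r`, which can occur
  -- for an empty support.
  set a := -(|r| + 1) with ha
  have hd : deriv (fun t => ∫ s in a..t, κ s) = κ := by
    ext t; exact hκ.continuous.deriv_integral _ _ _
  have hdiff : Differentiable ℝ (fun t => ∫ s in a..t, κ s) := fun t =>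
    (hκ.continuous.integral_hasStrictDerivAt a t).hasDerivAt.differentiableAt
  refine ⟨fun t => ∫ s in a..t, κ s, ?_, ?_, hd⟩
  · rw [contDiff_infty_iff_deriv]
    exact ⟨hdiff, by rw [hd]; exact hκ⟩
  · refine HasCompactSupport.intro (isCompact_Icc (a := a) (b := -a)) fun t ht => ?_
    rw [Set.mem_Icc, not_and_or, not_le, not_le] at ht
    have hr' := le_abs_self r
    have habs := abs_nonneg r
    rcases ht with ht | ht
    · refine (intervalIntegral.integral_congr (g := fun _ => 0) fun s hs => ?_).trans (by simp)
      rw [Set.uIcc_of_ge ht.le, Set.mem_Icc] at hs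
      exact hz s (by rw [abs_of_nonpos (by linarith)]; linarith)
    · rw [← h0]
      refine intervalIntegral.integral_eq_integral_of_support_subset fun s hs => ?_
      have : |s| ≤ r := not_lt.1 fun h => hs (hz s h)
      rw [abs_le] at this
      exact ⟨by linarith, by linarith⟩

/-- Charge conservation: the integral of the charge density of a conserved current against a
function of time with vanishing integral is zero. -/
lemma integral_timeFun_mul_current_eq_zero {j : Fin 4 → Fun} (hj : ∀ μ, ContDiff ℝ ∞ (j μ)) {R : ℝ}
    (hR : ∀ μ, ConeSupported R (j μ)) (hdiv : ∑ μ, pd μ (j μ) = 0) {κ : ℝ → ℝ}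
    (hκ : ContDiff ℝ ∞ κ) (hc : HasCompactSupport κ) (h0 : ∫ t, κ t = 0) :
    ∫ x, timeFun κ x * j 0 x = 0 := by
  obtain ⟨K, hK, hKc, rfl⟩ := exists_primitive hκ hc h0
  have hKs := contDiff_timeFun hK
  have hcs : ∀ μ, HasCompactSupport (timeFun K * j μ) := fun μ =>
    hasCompactSupport_mul_of_timeCompact (timeCompact_timeFun hKc) (hR μ)
  have hsm : ∀ μ, ContDiff ℝ ∞ (timeFun K * j μ) := fun μ => hKs.mul (hj μ)
  -- Since `K` depends on time only, the divergence of `K j` is `K' j⁰` plus `K` times the vanishing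
  -- divergence of `j`; the integral of a compactly supported divergence is zero.
  have hpt : ∀ x, timeFun (deriv K) x * j 0 x = ∑ μ, pd μ (timeFun K * j μ) x := fun x => by
    have h1 : ∀ μ, pd μ (timeFun K * j μ) x =
        (if μ = 0 then timeFun (deriv K) x * j 0 x else 0) + timeFun K x * pd μ (j μ) x := by
      intro μ
      rw [pd_mul hKs (hj μ), pd_timeFun hK]
      split_ifs with h <;> simp [h]
    have h2 : ∑ μ, pd μ (j μ) x = 0 := by
      simpa using congrFun hdiv x
    simp only [h1, Finset.sum_add_distrib, ← Finset.mul_sum, h2]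
    simp
  simp only [hpt]
  rw [integral_finsetSum]
  · exact Finset.sum_eq_zero fun μ _ => integral_pd_eq_zero (hsm μ) (hcs μ) μ
  · exact fun μ _ => (contDiff_pd (hsm μ) μ).continuous.integrable_of_hasCompactSupport
      ((hcs μ).fderiv_apply (𝕜 := ℝ) _)

lemma integrable_timeFun_mul {κ : ℝ → ℝ} (hκ : ContDiff ℝ ∞ κ) (hc : HasCompactSupport κ)
    {f : Fun} (hf : ContDiff ℝ ∞ f) {R : ℝ} (hR : ConeSupported R f) :
    Integrable fun x => timeFun κ x * f x :=
  ((contDiff_timeFun hκ).mul hf).continuous.integrable_of_hasCompactSupport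
    (hasCompactSupport_mul_of_timeCompact (timeCompact_timeFun hc) hR)

/-- The charge of a conserved current does not depend on the smearing in time. -/
lemma integral_timeFun_mul_current {j : Fin 4 → Fun} (hj : ∀ μ, ContDiff ℝ ∞ (j μ)) {R : ℝ}
    (hR : ∀ μ, ConeSupported R (j μ)) (hdiv : ∑ μ, pd μ (j μ) = 0) {κ κ' : ℝ → ℝ}
    (hκ : ContDiff ℝ ∞ κ) (hc : HasCompactSupport κ) (hκ' : ContDiff ℝ ∞ κ')
    (hc' : HasCompactSupport κ') (h1 : ∫ t, κ' t = 1) :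
    ∫ x, timeFun κ x * j 0 x = (∫ t, κ t : ℝ) * ∫ x, timeFun κ' x * j 0 x := by
  set c := ∫ t, κ t with hcdef
  have hcc : HasCompactSupport fun t => c * κ' t := hc'.mul_left
  -- Subtracting `c κ'` makes the total integral of the time function vanish, so the previous case
  -- applies to the difference.
  have h := integral_timeFun_mul_current_eq_zero hj hR hdiv (κ := fun t => κ t - c * κ' t)
    (hκ.sub (contDiff_const.mul hκ')) (hc.sub hcc) (by
      rw [integral_sub (hκ.continuous.integrable_of_hasCompactSupport hc)
        ((hκ'.continuous.integrable_of_hasCompactSupport hc').const_mul c), integral_const_mul, h1]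
      simp [hcdef])
  have hpt : ∀ x, timeFun (fun t => κ t - c * κ' t) x * j 0 x =
      timeFun κ x * j 0 x - (c : ℂ) * (timeFun κ' x * j 0 x) := fun x => by
    simp [timeFun]; ring
  simp only [hpt] at h
  rw [integral_sub (integrable_timeFun_mul hκ hc (hj 0) (hR 0))
    ((integrable_timeFun_mul hκ' hc' (hj 0) (hR 0)).const_mul _), integral_const_mul] at h
  exact sub_eq_zero.1 h

/-! ### Growth of solutions of the Klein-Gordon equation -/

lemma kleinGordon_eq_zero {f : Fun} (hf : ContDiff ℝ ∞ f) {m : ℝ}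
    (h : diffOp (kleinGordon m) f = 0) (x : Spacetime) :
    pd 0 (pd 0 f) x - pd 1 (pd 1 f) x - pd 2 (pd 2 f) x - pd 3 (pd 3 f) x + (m : ℂ) ^ 2 * f x
      = 0 := by
  have hsq : ∀ μ, diffOp (MvPolynomial.X μ ^ 2) f = pd μ (pd μ f) := fun μ => by
    rw [sq, ← mul_one (MvPolynomial.X μ * _), mul_assoc, diffOp_X_mul hf,
      diffOp_X_mul (contDiff_pd hf μ), ← MvPolynomial.C_1, diffOp_C, one_smul]
  have hneg : ∀ P : DiffPoly, diffOp (-P) f = -diffOp P f := fun P => by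
    have := diffOp_mul hf (MvPolynomial.C (-1)) P
    rw [diffOp_C] at this
    simpa using this
  have := congrFun h x
  simp only [kleinGordon, sub_eq_add_neg, diffOp_add_poly, hneg, hsq, diffOp_C] at this
  simpa [sub_eq_add_neg] using this

/-- The complex conjugate function. -/
def conjFun (f : Fun) : Fun := fun x => (starRingEnd ℂ) (f x)

lemma contDiff_conjFun {f : Fun} (hf : ContDiff ℝ ∞ f) : ContDiff ℝ ∞ (conjFun f) :=
  Complex.conjCLE.contDiff.comp hf

lemma pd_conjFun {f : Fun} (hf : ContDiff ℝ ∞ f) (μ : Fin 4) :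
    pd μ (conjFun f) = conjFun (pd μ f) := by
  ext x
  have h := Complex.conjCLE.toContinuousLinearMap.hasFDerivAt.comp x
    (differentiable_of_smooth hf x).hasFDerivAt
  have h4 : fderiv ℝ (conjFun f) x = _ := h.fderiv
  simp [pd, h4, conjFun]

/-- The energy density (`μ = 0`) and the momentum density of a Klein-Gordon field. -/
def energyCurrent (m : ℝ) (f : Fun) (μ : Fin 4) : Fun :=
  if μ = 0 then ∑ ν, pd ν f * pd ν (conjFun f) + ((m : ℂ) ^ 2) • (f * conjFun f)
  else (-1 : ℂ) • (pd 0 f * pd μ (conjFun f) + pd 0 (conjFun f) * pd μ f)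

lemma contDiff_energyCurrent (m : ℝ) {f : Fun} (hf : ContDiff ℝ ∞ f) (μ : Fin 4) :
    ContDiff ℝ ∞ (energyCurrent m f μ) := by
  have hp := fun ν => contDiff_pd hf ν
  have hq := fun ν => contDiff_pd (contDiff_conjFun hf) ν
  unfold energyCurrent
  split_ifs
  · refine ContDiff.add ?_ (contDiff_const.smul (hf.mul (contDiff_conjFun hf)))
    have : (∑ ν, pd ν f * pd ν (conjFun f)) = fun x => ∑ ν, pd ν f x * pd ν (conjFun f) x := by
      ext x; simp
    rw [this]
    exact ContDiff.sum fun ν _ => (hp ν).mul (hq ν)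
  · exact contDiff_const.smul (((hp 0).mul (hq μ)).add ((hq 0).mul (hp μ)))

lemma coneSupported_energyCurrent (m : ℝ) {f : Fun} {R : ℝ} (hR : ConeSupported R f) (μ : Fin 4) :
    ConeSupported R (energyCurrent m f μ) := by
  intro x hx
  have h0 := hR x hx
  have h1 := fun ν => hR.pd ν x hx
  unfold energyCurrent
  split_ifs <;> simp [h0, h1]

/-- The divergence is ∂₀f̄ (□ + m²)f + ∂₀f (□ + m²)f̄. The conjugate solves the same equation
because the mass is real. -/
lemma div_energyCurrent {m : ℝ} {f : Fun} (hf : ContDiff ℝ ∞ f)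
    (h : diffOp (kleinGordon m) f = 0) : ∑ μ, pd μ (energyCurrent m f μ) = 0 := by
  have hg := contDiff_conjFun hf
  set g := conjFun f with hgdef
  have hp := fun ν => contDiff_pd hf ν
  have hq := fun ν => contDiff_pd hg ν
  have key : ∀ x, pd 0 (pd 0 g) x - pd 1 (pd 1 g) x - pd 2 (pd 2 g) x - pd 3 (pd 3 g) x
      + (m : ℂ) ^ 2 * g x = 0 := fun x => by
    have := congrArg (starRingEnd ℂ) (kleinGordon_eq_zero hf h x)
    simp only [hgdef, pd_conjFun hf, pd_conjFun (contDiff_pd hf _)]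
    simpa [conjFun] using this
  have e0 : energyCurrent m f 0 =
      pd 0 f * pd 0 g + pd 1 f * pd 1 g + pd 2 f * pd 2 g + pd 3 f * pd 3 g
        + ((m : ℂ) ^ 2) • (f * g) := by
    simp [energyCurrent, Fin.sum_univ_four, hgdef]
  have el : ∀ μ, μ ≠ 0 → energyCurrent m f μ =
      (-1 : ℂ) • (pd 0 f * pd μ g + pd 0 g * pd μ f) := fun μ hμ => by
    simp [energyCurrent, hμ, hgdef]
  have hmul : ∀ ν, ContDiff ℝ ∞ (pd ν f * pd ν g) := fun ν => (hp ν).mul (hq ν)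
  have hfg : ContDiff ℝ ∞ (f * g) := hf.mul hg
  have hd0 : pd 0 (energyCurrent m f 0) =
      (pd 0 (pd 0 f) * pd 0 g + pd 0 f * pd 0 (pd 0 g))
      + (pd 0 (pd 1 f) * pd 1 g + pd 1 f * pd 0 (pd 1 g))
      + (pd 0 (pd 2 f) * pd 2 g + pd 2 f * pd 0 (pd 2 g))
      + (pd 0 (pd 3 f) * pd 3 g + pd 3 f * pd 0 (pd 3 g))
      + ((m : ℂ) ^ 2) • (pd 0 f * g + f * pd 0 g) := by
    have h01 : ContDiff ℝ ∞ (pd 0 f * pd 0 g + pd 1 f * pd 1 g) := (hmul 0).add (hmul 1)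
    have h012 : ContDiff ℝ ∞ (pd 0 f * pd 0 g + pd 1 f * pd 1 g + pd 2 f * pd 2 g) :=
      h01.add (hmul 2)
    have h0123 : ContDiff ℝ ∞ (pd 0 f * pd 0 g + pd 1 f * pd 1 g + pd 2 f * pd 2 g
      + pd 3 f * pd 3 g) := h012.add (hmul 3)
    have hmfg : ContDiff ℝ ∞ (((m : ℂ) ^ 2) • (f * g)) := contDiff_const.smul hfg
    rw [e0, pd_add h0123 hmfg, pd_add h012 (hmul 3), pd_add h01 (hmul 2), pd_add (hmul 0) (hmul 1),
      pd_smul hfg,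
      pd_mul hf hg, pd_mul (hp 0) (hq 0), pd_mul (hp 1) (hq 1), pd_mul (hp 2) (hq 2),
      pd_mul (hp 3) (hq 3)]
  have hdl : ∀ μ, μ ≠ 0 → pd μ (energyCurrent m f μ) =
      (-1 : ℂ) • (pd 0 (pd μ f) * pd μ g + pd 0 f * pd μ (pd μ g)
        + (pd 0 (pd μ g) * pd μ f + pd 0 g * pd μ (pd μ f))) := fun μ hμ => by
    rw [el μ hμ, pd_smul (f := pd 0 f * pd μ g + pd 0 g * pd μ f)
      (((hp 0).mul (hq μ)).add ((hq 0).mul (hp μ))),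
      pd_add (f := pd 0 f * pd μ g) (g := pd 0 g * pd μ f) ((hp 0).mul (hq μ)) ((hq 0).mul (hp μ)),
      pd_mul (hp 0) (hq μ), pd_mul (hq 0) (hp μ), pd_comm hf μ 0, pd_comm hg μ 0]
  rw [Fin.sum_univ_four, hd0, hdl 1 (by simp), hdl 2 (by decide), hdl 3 (by decide)]
  ext x
  simp only [Pi.add_apply, Pi.mul_apply, Pi.smul_apply, smul_eq_mul, Pi.zero_apply]
  linear_combination pd 0 g x * kleinGordon_eq_zero hf h x + pd 0 f x * key x

lemma energyCurrent_zero_re (m : ℝ) {f : Fun} (hf : ContDiff ℝ ∞ f) (x : Spacetime) :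
    (energyCurrent m f 0 x).re = ∑ ν, ‖pd ν f x‖ ^ 2 + m ^ 2 * ‖f x‖ ^ 2 := by
  have : energyCurrent m f 0 x =
      ((∑ ν, ‖pd ν f x‖ ^ 2 + m ^ 2 * ‖f x‖ ^ 2 : ℝ) : ℂ) := by
    simp only [energyCurrent, if_true, pd_conjFun hf]
    simp [conjFun, Complex.mul_conj, Complex.normSq_eq_norm_sq]
  rw [this, Complex.ofReal_re]

variable {f : Fun} {m R : ℝ}

lemma integrable_timeFun_mul_real {κ : ℝ → ℝ} (hκ : ContDiff ℝ ∞ κ) (hc : HasCompactSupport κ)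
    (hR : ConeSupported R f) {φ : Spacetime → ℝ} (hφ : Continuous φ)
    (h0 : ∀ x, f x = 0 → φ x = 0) : Integrable fun x => κ (x 0) * φ x := by
  have h := hasCompactSupport_mul_of_timeCompact (timeCompact_timeFun hc)
    (f := fun x => (φ x : ℂ)) (R := R) (fun x hx => by simp [h0 x (hR x hx)])
  refine Continuous.integrable_of_hasCompactSupport
    ((hκ.continuous.comp (continuous_apply 0)).mul hφ) ?_
  refine h.mono fun x hx hx' => hx ?_
  simpa [timeFun] using hx'

/-- Energy conservation bounds the spacetime integral of the energy density by the time. -/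
lemma integral_norm_sq_pd_le (hf : ContDiff ℝ ∞ f) (hR : ConeSupported R f)
    (hkg : diffOp (kleinGordon m) f = 0) :
    ∃ E : ℝ, ∀ κ : ℝ → ℝ, ContDiff ℝ ∞ κ → HasCompactSupport κ → (∀ t, 0 ≤ κ t) →
      ∀ ν, ∫ x : Spacetime, κ (x 0) * ‖pd ν f x‖ ^ 2 ≤ (∫ t, κ t) * E := by
  -- A fixed normalized time smearing measures the conserved energy `E`; for any other smearing the
  -- result is `E` times its integral.
  set b : ContDiffBump (0 : ℝ) := ⟨1, 2, one_pos, one_lt_two⟩ with hb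
  have hn1 : ContDiff ℝ ∞ (b.normed volume) := b.contDiff_normed
  refine ⟨(∫ x, timeFun (b.normed volume) x * energyCurrent m f 0 x).re, ?_⟩
  intro κ hκ hc hpos ν
  have hcons := integral_timeFun_mul_current (contDiff_energyCurrent m hf)
    (coneSupported_energyCurrent m hR) (div_energyCurrent hf hkg) hκ hc hn1
    b.hasCompactSupport_normed b.integral_normed
  have hint := integrable_timeFun_mul hκ hc (contDiff_energyCurrent m hf 0)
    (coneSupported_energyCurrent m hR 0)
  have hre : (∫ x, timeFun κ x * energyCurrent m f 0 x).re =
      ∫ x, (timeFun κ x * energyCurrent m f 0 x).re := (integral_re hint).symm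
  have h2 := congrArg Complex.re hcons
  rw [Complex.re_ofReal_mul, hre] at h2
  rw [← h2]
  refine integral_mono (integrable_timeFun_mul_real (f := pd ν f) hκ hc (hR.pd ν)
    ((contDiff_pd hf ν).continuous.norm.pow 2) (fun x hx => by simp [hx])) hint.re fun x => ?_
  simp only [timeFun, Complex.re_ofReal_mul, energyCurrent_zero_re m hf]
  refine mul_le_mul_of_nonneg_left ?_ (hpos _)
  have := Finset.single_le_sum (f := fun ν => ‖pd ν f x‖ ^ 2) (fun _ _ => sq_nonneg _)
    (Finset.mem_univ ν)
  nlinarith [mul_nonneg (sq_nonneg m) (sq_nonneg ‖f x‖)]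

lemma contDiff_coord (μ : Fin 4) : ContDiff ℝ ∞ (fun x : Spacetime => ((x μ : ℝ) : ℂ)) :=
  Complex.ofRealCLM.contDiff.comp (contDiff_apply ℝ ℝ μ)

lemma pd_coord_self (μ : Fin 4) (x : Spacetime) :
    pd μ (fun x : Spacetime => ((x μ : ℝ) : ℂ)) x = 1 := by
  have h := Complex.ofRealCLM.hasFDerivAt.comp x
    (ContinuousLinearMap.proj μ : Spacetime →L[ℝ] ℝ).hasFDerivAt
  have h4 : fderiv ℝ (fun x : Spacetime => ((x μ : ℝ) : ℂ)) x = _ := h.fderiv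
  simp [pd, h4]

/-- The Poincaré inequality in a slab. -/
lemma integral_norm_sq_le (hf : ContDiff ℝ ∞ f) (hR : ConeSupported R f) {κ : ℝ → ℝ}
    (hκ : ContDiff ℝ ∞ κ) (hc : HasCompactSupport κ) (hpos : ∀ t, 0 ≤ κ t) {S : ℝ}
    (hS : ∀ t, κ t ≠ 0 → |t| ≤ S) :
    ∫ x : Spacetime, κ (x 0) * ‖f x‖ ^ 2 ≤
      4 * (R + S) ^ 2 * ∫ x : Spacetime, κ (x 0) * ‖pd 1 f x‖ ^ 2 := by
  have hg := contDiff_conjFun hf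
  have hcoord := contDiff_coord 1
  have hκs := contDiff_timeFun hκ
  -- The vector field x¹∂₁ has divergence one. Integrating ∂₁(κ x¹|f|²) to zero expresses ∫κ|f|²
  -- through ∫κ x¹ Re(∂₁f f̄), where |x¹| is at most R + S on the support.
  set φ : Fun := timeFun κ * ((fun x : Spacetime => ((x 1 : ℝ) : ℂ)) * (f * conjFun f)) with hφ
  have hfg : ContDiff ℝ ∞ (f * conjFun f) := hf.mul hg
  have hcfg : ContDiff ℝ ∞ ((fun x : Spacetime => ((x 1 : ℝ) : ℂ)) * (f * conjFun f)) :=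
    hcoord.mul hfg
  have hsm : ContDiff ℝ ∞ φ := hκs.mul hcfg
  have hcs : HasCompactSupport φ :=
    hasCompactSupport_mul_of_timeCompact (timeCompact_timeFun hc) (R := R)
      (fun x hx => by simp [hR x hx])
  have hint : Integrable (pd 1 φ) := (contDiff_pd hsm 1).continuous.integrable_of_hasCompactSupport
    (hcs.fderiv_apply (𝕜 := ℝ) _)
  have hzero : ∫ x, (pd 1 φ x).re = 0 := by
    rw [show (∫ x, (pd 1 φ x).re) = (∫ x, pd 1 φ x).re from integral_re hint,
      integral_pd_eq_zero hsm hcs]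
    rfl
  have hpd : ∀ x, pd 1 φ x = (κ (x 0) : ℂ) * (f x * (starRingEnd ℂ) (f x) + x 1 *
      (pd 1 f x * (starRingEnd ℂ) (f x) + f x * (starRingEnd ℂ) (pd 1 f x))) := fun x => by
    rw [hφ, pd_mul hκs hcfg, pd_timeFun hκ, pd_mul hcoord hfg, pd_mul hf hg, pd_conjFun hf]
    simp [timeFun, conjFun, pd_coord_self]
  have hre : ∀ x, (pd 1 φ x).re = κ (x 0) * ‖f x‖ ^ 2
      + κ (x 0) * (2 * x 1 * (pd 1 f x * (starRingEnd ℂ) (f x)).re) := fun x => by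
    rw [hpd, Complex.re_ofReal_mul, Complex.add_re, Complex.re_ofReal_mul, Complex.add_re,
      Complex.mul_conj, Complex.ofReal_re, Complex.normSq_eq_norm_sq]
    have : (f x * (starRingEnd ℂ) (pd 1 f x)).re = (pd 1 f x * (starRingEnd ℂ) (f x)).re := by
      simp; ring
    rw [this]; ring
  have hA : Integrable fun x : Spacetime => κ (x 0) * ‖f x‖ ^ 2 :=
    integrable_timeFun_mul_real hκ hc hR (hf.continuous.norm.pow 2) (fun x hx => by simp [hx])
  have hB : Integrable fun x : Spacetime => κ (x 0) * ‖pd 1 f x‖ ^ 2 :=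
    integrable_timeFun_mul_real hκ hc (hR.pd 1) ((contDiff_pd hf 1).continuous.norm.pow 2)
      (fun x hx => by simp [hx])
  -- Young's inequality with weights 1/2 and 2(R + S)²; absorbing half of the left side yields the
  -- constant 4(R + S)².
  have hpt : ∀ x, κ (x 0) * ‖f x‖ ^ 2 ≤ (pd 1 φ x).re + (1 / 2 * (κ (x 0) * ‖f x‖ ^ 2)
      + 2 * (R + S) ^ 2 * (κ (x 0) * ‖pd 1 f x‖ ^ 2)) := fun x => by
    rw [hre x]
    by_cases h0 : κ (x 0) = 0
    · simp [h0]
    by_cases hf0 : f x = 0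
    · simp only [hf0]
      have := hpos (x 0)
      simp
      positivity
    have hx1 : |x 1| ≤ R + S := (abs_coord_le_spatialNorm x 0).trans
      ((not_lt.1 fun h => hf0 (hR x h)).trans (by linarith [hS _ h0]))
    have h3 : |(pd 1 f x * (starRingEnd ℂ) (f x)).re| ≤ ‖pd 1 f x‖ * ‖f x‖ := by
      refine (Complex.abs_re_le_norm _).trans ?_
      simp
    have h4 : |x 1 * (pd 1 f x * (starRingEnd ℂ) (f x)).re| ≤ (R + S) * (‖pd 1 f x‖ * ‖f x‖) := by
      rw [abs_mul]
      exact mul_le_mul hx1 h3 (abs_nonneg _) ((abs_nonneg _).trans hx1)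
    have h5 := (abs_le.1 h4).1
    have : 0 ≤ ‖f x‖ ^ 2 + (2 * x 1 * (pd 1 f x * (starRingEnd ℂ) (f x)).re) +
        (1 / 2 * ‖f x‖ ^ 2 + 2 * (R + S) ^ 2 * ‖pd 1 f x‖ ^ 2) - ‖f x‖ ^ 2 := by
      nlinarith [sq_nonneg (‖f x‖ - 2 * (R + S) * ‖pd 1 f x‖)]
    nlinarith [mul_nonneg (hpos (x 0)) this]
  have hmono := integral_mono hA (hint.re.add ((hA.const_mul (1 / 2)).add
    (hB.const_mul (2 * (R + S) ^ 2)))) hpt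
  rw [integral_add' hint.re ((hA.const_mul (1 / 2)).add (hB.const_mul (2 * (R + S) ^ 2))),
    integral_add' (hA.const_mul (1 / 2)) (hB.const_mul (2 * (R + S) ^ 2)),
    integral_const_mul, integral_const_mul,
    show (∫ x, RCLike.re (pd 1 φ x)) = 0 from hzero] at hmono
  linarith

end Integration

/-! ### Slab bounds and rapid removal of the spatial cutoff. -/

section Decay

variable {f : Fun} {m R : ℝ}

/-- The spacetime integral over a slab of a Klein-Gordon field with compactly supported Cauchy data
grows at most polynomially with the thickness of the slab. -/
lemma exists_slab_bound (hf : ContDiff ℝ ∞ f) (hR : ConeSupported R f)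
    (hkg : diffOp (kleinGordon m) f = 0) :
    ∃ C : ℝ, 0 ≤ C ∧ ∀ T : ℝ, 1 ≤ T → ∀ δ : ℝ, 0 ≤ δ → ∀ ψ : Fun, (∀ x, ‖ψ x‖ ≤ δ * ‖f x‖) →
      (∀ x, T < |x 0| → ψ x = 0) → ‖∫ x, ψ x‖ ≤ δ * (C * T ^ 4) := by
  obtain ⟨E, hE⟩ := integral_norm_sq_pd_le hf hR hkg
  set b : ContDiffBump (0 : ℝ) := ⟨1, 2, one_pos, one_lt_two⟩ with hb
  -- Only the upper bound on the radius matters, so it may be enlarged to a nonnegative one; this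
  -- makes the powers of `R₀ + 2 * T` monotone.
  set R₀ := max R 0 with hR₀
  have hR₀0 : 0 ≤ R₀ := le_max_right _ _
  have hcone : ConeSupported R₀ f := hR.mono (le_max_left _ _)
  set β := ∫ t, b t with hβ
  have hβ0 : 0 ≤ β := integral_nonneg fun t => b.nonneg
  refine ⟨4 * (R₀ + 2) ^ 2 * (β * |E|) + 16 * (R₀ + 2) ^ 4, by positivity, ?_⟩
  intro T hT δ hδ ψ hψ hψ0
  have hT0 : 0 < T := by linarith
  -- A stretched bump: equal to one for |t| ≤ T, zero for |t| ≥ 2T, with integral proportional to T.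
  set κ : ℝ → ℝ := fun t => b (t / T) with hκdef
  have hbs : ∀ t : ℝ, 2 ≤ |t| → b t = 0 := fun t ht =>
    b.zero_of_le_dist (by simpa [Real.dist_eq, hb] using ht)
  have hκs : ContDiff ℝ ∞ κ := b.contDiff.comp (contDiff_id.div_const T)
  have hκ0 : ∀ t, 0 ≤ κ t := fun t => b.nonneg
  have hκ1 : ∀ t, κ t ≤ 1 := fun t => b.le_one
  have hκS : ∀ t, κ t ≠ 0 → |t| ≤ 2 * T := fun t ht => by
    by_contra h
    refine ht (hbs _ ?_)
    rw [abs_div, abs_of_pos hT0, le_div_iff₀ hT0]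
    exact (not_le.1 h).le
  have hκc : HasCompactSupport κ := HasCompactSupport.intro
    (isCompact_Icc (a := -(2 * T)) (b := 2 * T)) fun t ht => by
      by_contra h
      exact ht (abs_le.1 (hκS t h))
  have hκint : ∫ t, κ t = T * β := by
    rw [hκdef, Measure.integral_comp_div (fun t => b t) T, abs_of_pos hT0, smul_eq_mul]
  have hA := integral_norm_sq_le hf hcone hκs hκc hκ0 hκS
  have hB := hE κ hκs hκc hκ0 1
  rw [hκint] at hB
  have hW : R₀ + 2 * T ≤ (R₀ + 2) * T := by nlinarith
  have hW0 : 0 ≤ R₀ + 2 * T := by positivity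
  -- The energy bound contributes T and the Poincaré constant T². The resulting T³ is weakened to T⁴
  -- to match the volume term below.
  have hA' : ∫ x : Spacetime, κ (x 0) * ‖f x‖ ^ 2 ≤ 4 * (R₀ + 2) ^ 2 * (β * |E|) * T ^ 4 := by
    have hB' : ∫ x : Spacetime, κ (x 0) * ‖pd 1 f x‖ ^ 2 ≤ T * (β * |E|) := by
      refine hB.trans ?_
      rw [mul_assoc]
      exact mul_le_mul_of_nonneg_left (mul_le_mul_of_nonneg_left (le_abs_self E) hβ0) hT0.le
    calc _ ≤ 4 * (R₀ + 2 * T) ^ 2 * (T * (β * |E|)) :=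
          hA.trans (mul_le_mul_of_nonneg_left hB' (by positivity))
      _ ≤ 4 * ((R₀ + 2) * T) ^ 2 * (T * (β * |E|)) := by gcongr
      _ = 4 * (R₀ + 2) ^ 2 * (β * |E|) * T ^ 3 := by ring
      _ ≤ _ := by
        refine mul_le_mul_of_nonneg_left ?_ (by positivity)
        exact pow_le_pow_right₀ hT (by norm_num)
  -- The L¹ norm is reduced to the L² norm by |f| ≤ |f|² + 1 on this ball, which contains the
  -- relevant support and has volume of order T⁴.
  set S := Metric.closedBall (0 : Spacetime) (R₀ + 2 * T) with hS
  have hvol : volume S = ENNReal.ofReal ((2 * (R₀ + 2 * T)) ^ 4) := by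
    simpa using Real.volume_pi_closedBall (0 : Spacetime) hW0
  have hind : Integrable (S.indicator fun _ => (1 : ℝ)) :=
    (integrable_indicator_iff Metric.isClosed_closedBall.measurableSet).2
      (integrableOn_const (by rw [hvol]; exact ENNReal.ofReal_ne_top))
  have hindv : ∫ x, S.indicator (fun _ => (1 : ℝ)) x ≤ 16 * (R₀ + 2) ^ 4 * T ^ 4 := by
    rw [integral_indicator Metric.isClosed_closedBall.measurableSet, setIntegral_const,
      Measure.real, hvol, ENNReal.toReal_ofReal (by positivity), smul_eq_mul, mul_one]
    calc (2 * (R₀ + 2 * T)) ^ 4 ≤ (2 * ((R₀ + 2) * T)) ^ 4 := by gcongr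
      _ = _ := by ring
  have hi2 : Integrable fun x : Spacetime => κ (x 0) * ‖f x‖ ^ 2 :=
    integrable_timeFun_mul_real hκs hκc hR (hf.continuous.norm.pow 2) (fun x hx => by simp [hx])
  have hi1 : Integrable fun x : Spacetime => κ (x 0) * ‖f x‖ :=
    integrable_timeFun_mul_real hκs hκc hR hf.continuous.norm (fun x hx => by simp [hx])
  have hL1 : ∫ x : Spacetime, κ (x 0) * ‖f x‖ ≤
      (4 * (R₀ + 2) ^ 2 * (β * |E|) + 16 * (R₀ + 2) ^ 4) * T ^ 4 := by
    have := integral_mono hi1 (hi2.add hind) fun x => by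
      simp only [Pi.add_apply]
      by_cases h0 : κ (x 0) = 0
      · simp only [h0, zero_mul, zero_add]
        exact Set.indicator_nonneg (fun _ _ => zero_le_one) x
      by_cases hf0 : f x = 0
      · simp only [hf0, norm_zero, mul_zero]
        exact add_nonneg (by simp) (Set.indicator_nonneg (fun _ _ => zero_le_one) x)
      have hx : x ∈ S := by
        have h1 := hκS _ h0
        have h2 : spatialNorm x ≤ R₀ + |x 0| := not_lt.1 fun h => hf0 (hcone x h)
        rw [hS, mem_closedBall_zero_iff, pi_norm_le_iff_of_nonneg hW0]
        intro μ
        rw [Real.norm_eq_abs]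
        refine Fin.cases (by linarith) (fun l => ?_) μ
        exact (abs_coord_le_spatialNorm x l).trans (by linarith)
      rw [Set.indicator_of_mem hx]
      nlinarith [hκ0 (x 0), hκ1 (x 0), sq_nonneg (‖f x‖ - 1), norm_nonneg (f x),
        mul_nonneg (hκ0 (x 0)) (add_nonneg (sq_nonneg (‖f x‖ - 1)) (norm_nonneg (f x)))]
    rw [integral_add' hi2 hind] at this
    linarith
  calc ‖∫ x, ψ x‖ ≤ ∫ x : Spacetime, δ * (κ (x 0) * ‖f x‖) := by
        refine norm_integral_le_of_norm_le (hi1.const_mul δ) (Eventually.of_forall fun x => ?_)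
        by_cases hx : T < |x 0|
        · rw [hψ0 x hx, norm_zero]
          exact mul_nonneg hδ (mul_nonneg (hκ0 _) (norm_nonneg _))
        · have : κ (x 0) = 1 := b.one_of_mem_closedBall (by
            rw [mem_closedBall_zero_iff, Real.norm_eq_abs, abs_div, abs_of_pos hT0,
              div_le_iff₀ hT0]
            simpa [hb] using hx)
          rw [this, one_mul]
          exact hψ x
    _ = δ * ∫ x : Spacetime, κ (x 0) * ‖f x‖ := integral_const_mul _ _
    _ ≤ _ := mul_le_mul_of_nonneg_left hL1 hδ

/-- At |t| = R the function vanishes only on one side, so the derivative is computed as a one-sided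
derivative. This lets the induction for flatness include the endpoints. -/
lemma deriv_eq_zero_of_vanishing {κ : ℝ → ℝ} (hκ : ContDiff ℝ ∞ κ)
    (h0 : ∀ t, R ≤ |t| → κ t = 0) (t : ℝ) (ht : R ≤ |t|) : deriv κ t = 0 := by
  have hd : DifferentiableAt ℝ κ t := hκ.differentiable (by simp) t
  rcases le_total 0 t with hpos | hneg
  · rw [abs_of_nonneg hpos] at ht
    have hz : ∀ u ∈ Set.Ici t, κ u = 0 := fun u hu => h0 u (by
      rw [abs_of_nonneg (hpos.trans hu)]; exact ht.trans hu)
    rw [← hd.derivWithin (uniqueDiffOn_Ici t t Set.self_mem_Ici),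
      derivWithin_congr (f := fun _ => 0) hz (hz t Set.self_mem_Ici)]
    simp
  · rw [abs_of_nonpos hneg] at ht
    have hz : ∀ u ∈ Set.Iic t, κ u = 0 := fun u hu => h0 u (by
      have : u ≤ t := hu
      rw [abs_of_nonpos (this.trans hneg)]; linarith)
    rw [← hd.derivWithin (uniqueDiffOn_Iic t t Set.self_mem_Iic),
      derivWithin_congr (f := fun _ => 0) hz (hz t Set.self_mem_Iic)]
    simp

/-- A smooth function supported in `[-R, R]` is flat at `±R`. -/
lemma exists_flat_bound (hR : 0 < R) (N : ℕ) {κ : ℝ → ℝ} (hκ : ContDiff ℝ ∞ κ)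
    (h0 : ∀ t, R ≤ |t| → κ t = 0) :
    ∃ C : ℝ, 0 ≤ C ∧ ∀ t s, 0 ≤ s → R ≤ |t| + s → |κ t| ≤ C * s ^ N := by
  induction N generalizing κ with
  | zero =>
    have hc : HasCompactSupport κ := HasCompactSupport.intro (isCompact_Icc (a := -R) (b := R))
      fun t ht => h0 t (not_lt.1 fun h => ht (abs_le.1 h.le))
    obtain ⟨C, hC⟩ := hc.exists_bound_of_continuous hκ.continuous
    exact ⟨C, (norm_nonneg _).trans (hC 0), fun t s _ _ => by simpa using hC t⟩
  | succ N ih =>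
    have hd : ContDiff ℝ ∞ (deriv κ) := (contDiff_infty_iff_deriv.1 hκ).2
    obtain ⟨C, hC0, hC⟩ := ih hd (deriv_eq_zero_of_vanishing hκ h0)
    refine ⟨C, hC0, fun t s hs hts => ?_⟩
    by_cases ht : R ≤ |t|
    · rw [h0 t ht, abs_zero]; positivity
    have hdiff : ∀ u, DifferentiableAt ℝ κ u := fun u => hκ.differentiable (by simp) u
    -- Mean value inequality from the nearest endpoint `e`. Between `t` and `e` the modulus is at
    -- least |t|, so the inductive bound on the derivative applies with the same `s`, and the length
    -- |e - t| ≤ s supplies one more power.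
    have main : ∀ e, |e| = R → |e - t| ≤ s → (∀ u ∈ Set.uIcc t e, |t| ≤ |u|) →
        |κ t| ≤ C * s ^ (N + 1) := by
      intro e he hes hu
      have := Convex.norm_image_sub_le_of_norm_deriv_le (f := κ) (C := C * s ^ N)
        (s := Set.uIcc t e) (x := e) (y := t) (fun u _ => hdiff u)
        (fun u hu' => hC u s hs (by linarith [hu u hu'])) (convex_uIcc t e)
        Set.right_mem_uIcc Set.left_mem_uIcc
      rw [h0 e he.ge, sub_zero, Real.norm_eq_abs, Real.norm_eq_abs, abs_sub_comm] at this
      refine this.trans ?_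
      rw [pow_succ, ← mul_assoc]
      gcongr
    rw [not_le] at ht
    rcases le_total 0 t with hpos | hneg
    · rw [abs_of_nonneg hpos] at ht hts
      refine main R (abs_of_pos hR) (by rw [abs_of_nonneg (by linarith)]; linarith) fun u hu => ?_
      rw [Set.uIcc_of_le ht.le] at hu
      rw [abs_of_nonneg hpos, abs_of_nonneg (hpos.trans hu.1)]
      exact hu.1
    · rw [abs_of_nonpos hneg] at ht hts
      refine main (-R) (by rw [abs_neg, abs_of_pos hR])
        (by rw [abs_of_nonpos (by linarith)]; linarith) fun u hu => ?_
      rw [Set.uIcc_of_ge (by linarith)] at hu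
      rw [abs_of_nonpos hneg, abs_of_nonpos (hu.2.trans hneg)]
      linarith [hu.2]

lemma integral_mul_pd {ψ e : Fun} (hψ : ContDiff ℝ ∞ ψ) (hc : HasCompactSupport ψ)
    (he : ContDiff ℝ ∞ e) (μ : Fin 4) :
    ∫ x, ψ x * pd μ e x = -∫ x, pd μ ψ x * e x := by
  have h := integral_pd_eq_zero (φ := ψ * e) (hψ.mul he) hc.mul_right μ
  have hc' : HasCompactSupport (pd μ ψ) := hc.fderiv_apply (𝕜 := ℝ) _
  rw [pd_mul hψ he] at h
  simp only [Pi.add_apply, Pi.mul_apply] at h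
  rw [integral_add
    (((contDiff_pd hψ μ).mul he).continuous.integrable_of_hasCompactSupport hc'.mul_right)
    ((hψ.mul (contDiff_pd he μ)).continuous.integrable_of_hasCompactSupport hc.mul_right)] at h
  exact eq_neg_of_add_eq_zero_right h

/-- Integration by parts in time alone. On the mass shell the frequency dominates the spatial
momentum, so spatial integrations by parts are never needed. -/
lemma frequency_mul_norm_integral {ψ : Fun} (hψ : ContDiff ℝ ∞ ψ) (hc : HasCompactSupport ψ)
    (k : Spacetime) :
    |k 0| * ‖∫ x, ψ x * expWave k x‖ = ‖∫ x, pd 0 ψ x * expWave k x‖ := by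
  have h := integral_mul_pd hψ hc (contDiff_expWave k) 0
  have h2 : ∀ x, ψ x * pd 0 (expWave k) x = (Complex.I * (k 0 : ℂ)) * (ψ x * expWave k x) :=
    fun x => by rw [pd_expWave]; simp; ring
  simp only [h2] at h
  rw [integral_const_mul] at h
  have h3 := congrArg norm h
  simpa using h3

/-- Each time derivative moved onto `ψ` gains one power of the frequency. The constant is uniform in
the spatial momentum. -/
lemma exists_fourier_decay {ψ : Fun} (hψ : ContDiff ℝ ∞ ψ) (hc : HasCompactSupport ψ) (M : ℕ) :
    ∃ C : ℝ, 0 ≤ C ∧ ∀ k : Spacetime, |k 0| ^ M * ‖∫ x, ψ x * expWave k x‖ ≤ C := by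
  induction M generalizing ψ with
  | zero =>
    refine ⟨∫ x, ‖ψ x‖, integral_nonneg fun _ => norm_nonneg _, fun k => ?_⟩
    rw [pow_zero, one_mul]
    refine (norm_integral_le_integral_norm _).trans_eq ?_
    simp [norm_expWave]
  | succ M ih =>
    obtain ⟨C, hC0, hC⟩ := ih (contDiff_pd hψ 0) (hc.fderiv_apply (𝕜 := ℝ) _)
    refine ⟨C, hC0, fun k => ?_⟩
    rw [pow_succ, mul_assoc, frequency_mul_norm_integral hψ hc]
    exact hC k

lemma continuous_expWave_left (x : Spacetime) : Continuous fun k => expWave k x := by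
  unfold expWave; fun_prop

lemma continuous_fourier {ψ : Fun} (hψ : ContDiff ℝ ∞ ψ) (hc : HasCompactSupport ψ) :
    Continuous fun k : Spacetime => ∫ x, ψ x * expWave k x := by
  refine continuous_of_dominated (bound := fun x => ‖ψ x‖) (fun k => ?_) (fun k => ?_)
    (hψ.continuous.integrable_of_hasCompactSupport hc).norm ?_
  · exact (hψ.mul (contDiff_expWave k)).continuous.aestronglyMeasurable
  · exact Eventually.of_forall fun x => by simp [norm_expWave]
  · exact Eventually.of_forall fun x => continuous_const.mul (continuous_expWave_left x)

/-- The spatial function `χ(ε x⃗) - 1`. -/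
def spaceCutoff (χ : (Fin 3 → ℝ) → ℝ) (ε : ℝ) : Fun := fun x =>
  ((χ (fun i => ε * x i.succ) - 1 : ℝ) : ℂ)

lemma contDiff_spaceCutoff {χ : (Fin 3 → ℝ) → ℝ} (hχ : ContDiff ℝ ∞ χ) (ε : ℝ) :
    ContDiff ℝ ∞ (spaceCutoff χ ε) := by
  refine Complex.ofRealCLM.contDiff.comp ((hχ.comp ?_).sub contDiff_const)
  exact contDiff_pi.2 fun i => contDiff_const.mul (contDiff_apply ℝ ℝ i.succ)

/-- The spatial cutoff does not depend on time, so integrating by parts in time never differentiates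
it. -/
lemma pd_zero_spaceCutoff {χ : (Fin 3 → ℝ) → ℝ} (hχ : ContDiff ℝ ∞ χ) (ε : ℝ) :
    pd 0 (spaceCutoff χ ε) = 0 := by
  ext x
  set L : Spacetime →L[ℝ] (Fin 3 → ℝ) :=
    ContinuousLinearMap.pi fun i => ε • (ContinuousLinearMap.proj i.succ : Spacetime →L[ℝ] ℝ)
  have h1 : HasFDerivAt χ (fderiv ℝ χ (L x)) (L x) :=
    (hχ.differentiable (by simp) _).hasFDerivAt
  have h2 := Complex.ofRealCLM.hasFDerivAt.comp x ((h1.comp x L.hasFDerivAt).sub_const 1)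
  have h4 : fderiv ℝ (spaceCutoff χ ε) x = _ := h2.fderiv
  have hL : L (Pi.single 0 1) = 0 := by ext i; simp [L]
  rw [pd, h4]
  simp [hL]

/-- `κ(ε x⁰) (χ(ε x⃗) - 1) f(x)`. -/
def cutoffError (κ : ℝ → ℝ) (χ : (Fin 3 → ℝ) → ℝ) (ε : ℝ) (f : Fun) : Fun :=
  timeFun (fun t => κ (ε * t)) * (spaceCutoff χ ε * f)

lemma deriv_comp_mul (κ : ℝ → ℝ) (hκ : ContDiff ℝ ∞ κ) (ε : ℝ) :
    deriv (fun t => κ (ε * t)) = fun t => ε * deriv κ (ε * t) := by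
  ext t
  have h := (hκ.differentiable (by simp) (ε * t)).hasDerivAt.comp t ((hasDerivAt_id t).const_mul ε)
  have h4 : deriv (fun t => κ (ε * t)) t = _ := h.deriv
  rw [h4]; simp; ring

section CutoffError

variable {κ : ℝ → ℝ} {χ : (Fin 3 → ℝ) → ℝ} {ε : ℝ}

lemma contDiff_cutoffError (hκ : ContDiff ℝ ∞ κ) (hχ : ContDiff ℝ ∞ χ) (hf : ContDiff ℝ ∞ f)
    (ε : ℝ) : ContDiff ℝ ∞ (cutoffError κ χ ε f) :=
  (contDiff_timeFun (hκ.comp (contDiff_const.mul contDiff_id))).mul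
    ((contDiff_spaceCutoff hχ ε).mul hf)

lemma hasCompactSupport_cutoffError (h0 : ∀ t, R ≤ |t| → κ t = 0) (hε : 0 < ε) {R' : ℝ}
    (hf : ConeSupported R' f) : HasCompactSupport (cutoffError κ χ ε f) := by
  refine hasCompactSupport_mul_of_timeCompact ⟨R / ε, fun x hx => ?_⟩ (R := R')
    (fun x hx => by simp [hf x hx])
  rw [div_lt_iff₀ hε] at hx
  simp only [timeFun]
  rw [h0, Complex.ofReal_zero]
  rw [abs_mul, abs_of_pos hε]
  linarith

/-- Cutoff errors are stable under ∂₀: either `κ` is replaced by its derivative with a harmless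
factor ε, or `f` by ∂₀f. Flatness and the Klein-Gordon equation are preserved, which drives the
induction on the power of the frequency. -/
lemma pd_zero_cutoffError (hκ : ContDiff ℝ ∞ κ) (hχ : ContDiff ℝ ∞ χ) (hf : ContDiff ℝ ∞ f)
    (ε : ℝ) (x : Spacetime) : pd 0 (cutoffError κ χ ε f) x =
      (ε : ℂ) * cutoffError (deriv κ) χ ε f x + cutoffError κ χ ε (pd 0 f) x := by
  have h1 : ContDiff ℝ ∞ (fun t => κ (ε * t)) := hκ.comp (contDiff_const.mul contDiff_id)
  have h2 := contDiff_spaceCutoff hχ ε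
  have h3 : ContDiff ℝ ∞ (spaceCutoff χ ε * f) := h2.mul hf
  rw [cutoffError, pd_mul (contDiff_timeFun h1) h3, pd_mul h2 hf, pd_zero_spaceCutoff hχ,
    pd_timeFun h1, deriv_comp_mul κ hκ]
  simp [cutoffError, timeFun]
  ring

lemma pd_kleinGordon (hf : ContDiff ℝ ∞ f) (hkg : diffOp (kleinGordon m) f = 0) (μ : Fin 4) :
    diffOp (kleinGordon m) (pd μ f) = 0 := by
  have h1 : diffOp (MvPolynomial.X μ) f = pd μ f := by
    rw [← mul_one (MvPolynomial.X μ), diffOp_X_mul hf, ← MvPolynomial.C_1, diffOp_C, one_smul]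
  rw [← h1, ← diffOp_mul hf, mul_comm, diffOp_mul hf, hkg]
  ext x
  simp [diffOp, pdIter_zero_fun]

/-- On Klein-Gordon fields with compactly supported Cauchy data, the spatial cutoff `χ(ε x⃗)` may
be removed up to an error which vanishes rapidly for `ε → 0` and for large frequencies. -/
lemma exists_cutoffError_decay (hR : 0 < R) (hχ : ContDiff ℝ ∞ χ) {A : ℝ} (hA : ∀ y, |χ y - 1| ≤ A)
    (hχ1 : ∀ y, ∑ i, y i ^ 2 ≤ R ^ 2 → χ y = 1) (M N : ℕ) {κ : ℝ → ℝ} (hκ : ContDiff ℝ ∞ κ)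
    (h0 : ∀ t, R ≤ |t| → κ t = 0) {f : Fun} (hf : ContDiff ℝ ∞ f) {R' : ℝ}
    (hcone : ConeSupported R' f) (hkg : diffOp (kleinGordon m) f = 0) :
    ∃ C : ℝ, 0 ≤ C ∧ ∀ ε : ℝ, 0 < ε → ε ≤ 1 → ∀ k : Spacetime,
      |k 0| ^ M * ‖∫ x, cutoffError κ χ ε f x * expWave k x‖ ≤ C * ε ^ N := by
  induction M generalizing κ f with
  | zero =>
    obtain ⟨C₁, hC₁0, hC₁⟩ := exists_slab_bound hf hcone hkg
    -- Four extra orders of flatness compensate the growth T⁴ of the slab bound for T of order 1/ε.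
    obtain ⟨C₂, hC₂0, hC₂⟩ := exists_flat_bound hR (N + 4) hκ h0
    have hA0 : 0 ≤ A := (abs_nonneg _).trans (hA 0)
    set S := max R' 0 with hS
    have hS0 : 0 ≤ S := le_max_right _ _
    refine ⟨C₂ * S ^ (N + 4) * A * (C₁ * (R + 1) ^ 4), by positivity, fun ε hε hε1 k => ?_⟩
    rw [pow_zero, one_mul]
    -- Using R + 1 in place of R guarantees T ≥ 1 while the slab still contains the support of κ(ε
    -- x⁰).
    have hT : 1 ≤ (R + 1) / ε := by rw [le_div_iff₀ hε]; linarith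
    have := hC₁ ((R + 1) / ε) hT (C₂ * (S * ε) ^ (N + 4) * A) (by positivity)
      (fun x => cutoffError κ χ ε f x * expWave k x) (fun x => ?_) (fun x hx => ?_)
    · refine this.trans_eq ?_
      rw [mul_pow, div_pow, pow_add ε]
      field_simp
    · rw [norm_mul, norm_expWave, mul_one]
      simp only [cutoffError, timeFun, spaceCutoff, Pi.mul_apply, norm_mul, Complex.norm_real,
        Real.norm_eq_abs]
      by_cases hfx : f x = 0
      · simp [hfx]
      by_cases hin : ∑ i : Fin 3, (ε * x i.succ) ^ 2 ≤ R ^ 2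
      · rw [hχ1 _ hin]
        simp only [sub_self, abs_zero, zero_mul, mul_zero]
        positivity
      have hx1 : spatialNorm x ≤ S + |x 0| := (not_lt.1 fun h => hfx (hcone x h)).trans
        (by linarith [le_max_left R' 0])
      have hx2 : R ≤ ε * spatialNorm x := by
        rw [not_le] at hin
        have : ∑ i : Fin 3, (ε * x i.succ) ^ 2 = (ε * spatialNorm x) ^ 2 := by
          rw [mul_pow, spatialNorm, Real.sq_sqrt (Finset.sum_nonneg fun _ _ => sq_nonneg _),
            Finset.mul_sum]
          simp [mul_pow]
        rw [this] at hin
        exact (pow_le_pow_iff_left₀ hR.le (mul_nonneg hε.le (Real.sqrt_nonneg _)) two_ne_zero).1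
          hin.le
      -- Where the cutoff is active, R ≤ ε|x|, and the support of `f` gives |x| ≤ S + |x⁰|. So ε x⁰
      -- is within Sε of the region where `κ` vanishes.
      have hflat := hC₂ (ε * x 0) (S * ε) (by positivity) (by
        rw [abs_mul, abs_of_pos hε]; nlinarith)
      rw [← mul_assoc]
      exact mul_le_mul_of_nonneg_right (mul_le_mul hflat (hA _) (abs_nonneg _) (by positivity))
        (norm_nonneg _)
    · have : κ (ε * x 0) = 0 := h0 _ (by
        rw [div_lt_iff₀ hε] at hx
        rw [abs_mul, abs_of_pos hε]; linarith)
      simp [cutoffError, timeFun, this]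
  | succ M ih =>
    have hd : ContDiff ℝ ∞ (deriv κ) := (contDiff_infty_iff_deriv.1 hκ).2
    have hd0 := deriv_eq_zero_of_vanishing hκ h0
    obtain ⟨C₁, hC₁0, hC₁⟩ := ih hd hd0 hf hcone hkg
    obtain ⟨C₂, hC₂0, hC₂⟩ := ih hκ h0 (contDiff_pd hf 0) (hcone.pd 0) (pd_kleinGordon hf hkg 0)
    refine ⟨C₁ + C₂, by positivity, fun ε hε hε1 k => ?_⟩
    rw [pow_succ, mul_assoc, frequency_mul_norm_integral (contDiff_cutoffError hκ hχ hf ε)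
      (hasCompactSupport_cutoffError h0 hε hcone)]
    have hi1 : Integrable fun x => cutoffError (deriv κ) χ ε f x * expWave k x :=
      ((contDiff_cutoffError hd hχ hf ε).mul
        (contDiff_expWave k)).continuous.integrable_of_hasCompactSupport
        (hasCompactSupport_cutoffError hd0 hε hcone).mul_right
    have hi2 : Integrable fun x => cutoffError κ χ ε (pd 0 f) x * expWave k x :=
      ((contDiff_cutoffError hκ hχ (contDiff_pd hf 0) ε).mul
        (contDiff_expWave k)).continuous.integrable_of_hasCompactSupport
        (hasCompactSupport_cutoffError h0 hε (hcone.pd 0)).mul_right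
    simp only [pd_zero_cutoffError hκ hχ hf, add_mul, mul_assoc]
    rw [integral_add (hi1.const_mul _) hi2, integral_const_mul]
    have hε' : ‖(ε : ℂ)‖ ≤ 1 := by simpa [abs_of_pos hε] using hε1
    calc |k 0| ^ M * ‖(ε : ℂ) * (∫ x, cutoffError (deriv κ) χ ε f x * expWave k x)
          + ∫ x, cutoffError κ χ ε (pd 0 f) x * expWave k x‖
        ≤ |k 0| ^ M * (1 * ‖∫ x, cutoffError (deriv κ) χ ε f x * expWave k x‖
          + ‖∫ x, cutoffError κ χ ε (pd 0 f) x * expWave k x‖) := by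
          refine mul_le_mul_of_nonneg_left ((norm_add_le _ _).trans ?_) (by positivity)
          rw [norm_mul]
          gcongr
      _ = |k 0| ^ M * ‖∫ x, cutoffError (deriv κ) χ ε f x * expWave k x‖
          + |k 0| ^ M * ‖∫ x, cutoffError κ χ ε (pd 0 f) x * expWave k x‖ := by ring
      _ ≤ C₁ * ε ^ N + C₂ * ε ^ N := add_le_add (hC₁ ε hε hε1 k) (hC₂ ε hε hε1 k)
      _ = _ := by ring

end CutoffError

end Decay

/-! ## Structure of the free theory -/

section Theory

/-- One of the fields is bosonic, and the other one is a ghost. -/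
def FieldKind.Opposite (a b : FieldKind) : Prop :=
  (a = .boson ∧ b = .ghost) ∨ (a = .ghost ∧ b = .boson)

lemma FieldKind.Opposite.symm {a b : FieldKind} (h : a.Opposite b) : b.Opposite a := by
  rcases h with ⟨rfl, rfl⟩ | ⟨rfl, rfl⟩
  · exact Or.inr ⟨rfl, rfl⟩
  · exact Or.inl ⟨rfl, rfl⟩

lemma FieldKind.Opposite.exch_eq_one {a b : FieldKind} (h : a.Opposite b) : a.exch b = 1 := by
  rcases h with ⟨rfl, rfl⟩ | ⟨rfl, rfl⟩ <;> rfl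

/-- A boson commutes with everything and a ghost anticommutes only with ghosts, so a boson-ghost
pair as a whole feels only the ghost parity of what it passes. -/
lemma FieldKind.Opposite.exch_mul_exch {a b : FieldKind} (h : a.Opposite b) (c : FieldKind) :
    a.exch c * b.exch c = paritySign c.ghostParity := by
  rcases h with ⟨rfl, rfl⟩ | ⟨rfl, rfl⟩ <;> cases c <;>
    simp [FieldKind.exch, FieldKind.ghostParity, paritySign]

lemma FieldKind.Opposite.ghostParity_add {a b : FieldKind} (h : a.Opposite b) :
    a.ghostParity + b.ghostParity = 1 := by
  rcases h with ⟨rfl, rfl⟩ | ⟨rfl, rfl⟩ <;> simp [FieldKind.ghostParity]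

lemma FieldKind.Opposite.exch_self {a b : FieldKind} (h : a.Opposite b) :
    a.exch a = paritySign a.ghostParity := by
  rcases h with ⟨rfl, rfl⟩ | ⟨rfl, rfl⟩ <;>
    simp [FieldKind.exch, FieldKind.ghostParity, paritySign]

variable {I : Type*} [Fintype I] [DecidableEq I] (T : FreeTheory I)

lemma lagrangianDeriv_eq_zero {i j : I} (h : T.kind i ≠ T.kind j) (a b : Jet) :
    lagrangianDeriv T.kind T.L i a j b = 0 := by
  have h1 : T.L i a j b = 0 := by
    by_contra h0; exact h (T.even _ _ _ _ h0)
  have h2 : T.L j b i a = 0 := by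
    by_contra h0; exact h (T.even _ _ _ _ h0).symm
  simp [lagrangianDeriv, h1, h2]

lemma eulerLagrange_eq_zero {i j : I} (h : T.kind i ≠ T.kind j) :
    eulerLagrange T.kind T.L i j = 0 := by
  simp [eulerLagrange, lagrangianDeriv_eq_zero T h]

lemma kleinGordon_ne_zero (m : ℝ) : kleinGordon m ≠ 0 := by
  intro h
  have := congrArg (MvPolynomial.eval (Pi.single 0 1 : Fin 4 → ℂ)) h
  simp [kleinGordon] at this
  have h2 : (1 + m ^ 2 : ℝ) = 0 := by exact_mod_cast this
  nlinarith [sq_nonneg m]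

/-- Computing N D N in two ways gives N_{cd}(□ + m_d²) = (□ + m_c²)N_{cd}. Cancel N_{cd} in the
polynomial ring and compare constant terms; nonnegativity of the masses removes the sign ambiguity.
-/
lemma mass_eq_of_N_ne_zero {c d : I} (h : T.N c d ≠ 0) : T.mass c = T.mass d := by
  have h1 : T.N * (eulerLagrange T.kind T.L * T.N) = T.N * eulerLagrange T.kind T.L * T.N :=
    (Matrix.mul_assoc _ _ _).symm
  rw [T.D_mul_N, T.N_mul_D] at h1
  have h2 := congrFun (congrFun h1 c) d
  simp only [Matrix.mul_neg, Matrix.neg_mul, Matrix.neg_apply, Matrix.mul_diagonal,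
    Matrix.diagonal_mul, neg_inj] at h2
  rw [mul_comm] at h2
  have h3 := mul_right_cancel₀ h h2
  have h4 := congrArg (MvPolynomial.eval (0 : Fin 4 → ℂ)) h3
  simp [kleinGordon] at h4
  have h5 : T.mass d ^ 2 = T.mass c ^ 2 := by exact_mod_cast h4
  exact ((pow_left_inj₀ (T.mass_nonneg d) (T.mass_nonneg c) two_ne_zero).1 h5).symm

/-- Since D does not mix kinds, the part `M` of N that does mix them satisfies D M = 0. Multiplying
by N gives (□ + m²)M = 0 in an integral domain. -/
lemma kind_eq_of_N_ne_zero {c d : I} (h : T.N c d ≠ 0) : T.kind c = T.kind d := by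
  classical
  by_contra hk
  set M : Matrix I I DiffPoly := fun i j => if T.kind i = T.kind j then 0 else T.N i j with hM
  have hDM : eulerLagrange T.kind T.L * M = 0 := by
    ext1 i j
    rw [Matrix.mul_apply, Matrix.zero_apply]
    by_cases hij : T.kind i = T.kind j
    · refine Finset.sum_eq_zero fun e _ => ?_
      by_cases hie : T.kind i = T.kind e
      · simp [hM, ← hie, hij]
      · simp [eulerLagrange_eq_zero T hie]
    · have h1 := congrFun (congrFun T.D_mul_N i) j
      rw [Matrix.mul_apply, Matrix.neg_apply, Matrix.diagonal_apply_ne _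
        (fun h => hij (congrArg _ h)), neg_zero] at h1
      rw [← h1]
      refine Finset.sum_congr rfl fun e _ => ?_
      by_cases hie : T.kind i = T.kind e
      · simp [hM, ← hie, hij]
      · simp [eulerLagrange_eq_zero T hie]
  have h2 : T.N * (eulerLagrange T.kind T.L * M) = 0 := by rw [hDM, Matrix.mul_zero]
  rw [← Matrix.mul_assoc, T.N_mul_D] at h2
  have h3 := congrFun (congrFun h2 c) d
  have hMcd : M c d = T.N c d := by simp [hM, hk]
  rw [Matrix.neg_mul, Matrix.neg_apply, Matrix.diagonal_mul, hMcd, Matrix.zero_apply,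
    neg_eq_zero, mul_eq_zero] at h3
  exact h3.elim (kleinGordon_ne_zero _) h

lemma eval_jetPoly_neg (z : Fin 4 → ℂ) (a : Jet) :
    MvPolynomial.eval (-z) (jetPoly a) = jetSign a * MvPolynomial.eval z (jetPoly a) := by
  cases a <;> simp [jetPoly, jetSign]

lemma jetSign_mul_self (a : Jet) : jetSign a * jetSign a = 1 := by
  cases a <;> simp [jetSign]

/-- The Euler-Lagrange operator is formally graded selfadjoint. -/
lemma eval_neg_eulerLagrange (z : Fin 4 → ℂ) (i j : I) :
    MvPolynomial.eval (-z) (eulerLagrange T.kind T.L i j) =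
      (T.kind i).exch (T.kind j) * MvPolynomial.eval z (eulerLagrange T.kind T.L j i) := by
  simp only [eulerLagrange, map_sum, map_mul, MvPolynomial.eval_C, eval_jetPoly_neg,
    Finset.mul_sum]
  rw [Finset.sum_comm]
  refine Finset.sum_congr rfl fun b _ => Finset.sum_congr rfl fun a _ => ?_
  simp only [lagrangianDeriv, FieldKind.exch_comm (T.kind j) (T.kind i)]
  have h1 := jetSign_mul_self a
  have h2 := (T.kind i).exch_mul_self (T.kind j)
  linear_combination (jetSign b * (T.L i a j b + (T.kind i).exch (T.kind j) * T.L j b i a) *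
    MvPolynomial.eval z (jetPoly a) * MvPolynomial.eval z (jetPoly b)) * h1
    - (jetSign b * T.L i a j b * MvPolynomial.eval z (jetPoly a) *
      MvPolynomial.eval z (jetPoly b)) * h2

/-- The momentum `k` of the plane wave `exp(-i(ω x⁰ - p·x)) = exp(i k·x)` on the mass shell. -/
def shellMomentum (m : ℝ) (p : Fin 3 → ℝ) : Spacetime := Fin.cons (-energy m p) p

lemma planeWave_neg_one (m : ℝ) (p : Fin 3 → ℝ) :
    planeWave (-1) m p = expWave (shellMomentum m p) := by
  ext x
  simp only [planeWave, expWave, shellMomentum, Fin.sum_univ_succ (n := 3), Fin.cons_zero,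
    Fin.cons_succ]
  congr 1
  push_cast
  ring

lemma planeWave_one (m : ℝ) (p : Fin 3 → ℝ) :
    planeWave 1 m p = expWave (-shellMomentum m p) := by
  ext x
  simp only [planeWave, expWave, shellMomentum, Fin.sum_univ_succ (n := 3), Fin.cons_zero,
    Fin.cons_succ, Pi.neg_apply]
  congr 1
  push_cast
  simp only [neg_mul, Finset.sum_neg_distrib]
  ring

/-- The symbol of `∂` on the plane wave with momentum `k`. -/
def symbolAt (k : Spacetime) : Fin 4 → ℂ := fun μ => Complex.I * (k μ : ℂ)

lemma symbolAt_neg (k : Spacetime) : symbolAt (-k) = -symbolAt k := by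
  ext μ; simp [symbolAt]

lemma twoPoint_eq (i j : I) (p : Fin 3 → ℝ) :
    twoPoint T i j p = MvPolynomial.eval (symbolAt (shellMomentum (T.mass i) p)) (T.N i j) /
      (((2 * Real.pi) ^ 3 * (2 * energy (T.mass i) p) : ℝ) : ℂ) := by
  unfold twoPoint
  congr 3
  ext μ
  refine Fin.cases ?_ (fun l => ?_) μ
  · simp [symbolAt, shellMomentum]
  · simp [symbolAt, shellMomentum]

lemma eval_kleinGordon (m : ℝ) (p : Fin 3 → ℝ) :
    MvPolynomial.eval (symbolAt (shellMomentum m p)) (kleinGordon m) = 0 := by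
  have h : (energy m p) ^ 2 = p 0 ^ 2 + p 1 ^ 2 + p 2 ^ 2 + m ^ 2 := by
    rw [energy, Real.sq_sqrt (add_nonneg (Finset.sum_nonneg fun _ _ => sq_nonneg _)
      (sq_nonneg m)), Fin.sum_univ_three]
  have h' : (energy m p : ℂ) ^ 2 = (p 0 : ℂ) ^ 2 + (p 1 : ℂ) ^ 2 + (p 2 : ℂ) ^ 2 + (m : ℂ) ^ 2 := by
    exact_mod_cast congrArg (fun r : ℝ => (r : ℂ)) h
  have h1 : shellMomentum m p 1 = p 0 := rfl
  have h2 : shellMomentum m p 2 = p 1 := rfl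
  have h3 : shellMomentum m p 3 = p 2 := rfl
  have h0 : shellMomentum m p 0 = -energy m p := rfl
  simp only [kleinGordon, map_add, map_sub, map_pow, MvPolynomial.eval_X, MvPolynomial.eval_C,
    symbolAt, h0, h1, h2, h3]
  push_cast
  linear_combination (norm := ring_nf) (-1 : ℂ) * h' + 0 * Complex.I_sq
  simp only [Complex.I_sq]
  ring

/-- On the mass shell of `d`, column `d` of N is the polarization of a plane wave solution, because
the right side of D N = -diag(□ + m²) vanishes there. -/
lemma sum_eval_D_mul_N (d e : I) (p : Fin 3 → ℝ) :
    ∑ c, MvPolynomial.eval (symbolAt (shellMomentum (T.mass d) p)) (eulerLagrange T.kind T.L e c) *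
      MvPolynomial.eval (symbolAt (shellMomentum (T.mass d) p)) (T.N c d) = 0 := by
  have h1 := congrFun (congrFun T.D_mul_N e) d
  rw [Matrix.mul_apply, Matrix.neg_apply] at h1
  have h2 := congrArg (MvPolynomial.eval (symbolAt (shellMomentum (T.mass d) p))) h1
  simp only [map_sum, map_mul] at h2
  rw [h2]
  by_cases h : e = d
  · subst h; simp [eval_kleinGordon]
  · simp [Matrix.diagonal_apply_ne _ h]

/-- The same for rows of N and waves of opposite momentum: graded selfadjointness turns D(-z) into
the transpose of D(z), so N D takes the role of D N. -/
lemma sum_eval_neg_D_mul_N (c e : I) (p : Fin 3 → ℝ) :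
    ∑ d, MvPolynomial.eval (symbolAt (-shellMomentum (T.mass c) p))
        (eulerLagrange T.kind T.L e d) *
      MvPolynomial.eval (symbolAt (shellMomentum (T.mass c) p)) (T.N c d) = 0 := by
  have h1 := congrFun (congrFun T.N_mul_D c) e
  rw [Matrix.mul_apply, Matrix.neg_apply] at h1
  have h2 := congrArg (MvPolynomial.eval (symbolAt (shellMomentum (T.mass c) p))) h1
  simp only [map_sum, map_mul] at h2
  -- The sign of the transposition is the same for all `d`, since entries of D between different
  -- kinds vanish; it can be pulled out of the sum.
  have h3 : ∀ d, MvPolynomial.eval (symbolAt (-shellMomentum (T.mass c) p))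
        (eulerLagrange T.kind T.L e d) *
      MvPolynomial.eval (symbolAt (shellMomentum (T.mass c) p)) (T.N c d) =
      (T.kind e).exch (T.kind e) *
        (MvPolynomial.eval (symbolAt (shellMomentum (T.mass c) p)) (T.N c d) *
        MvPolynomial.eval (symbolAt (shellMomentum (T.mass c) p))
          (eulerLagrange T.kind T.L d e)) := by
    intro d
    rw [symbolAt_neg, eval_neg_eulerLagrange]
    by_cases hk : T.kind d = T.kind e
    · rw [hk]; ring
    · simp [eulerLagrange_eq_zero T hk]
  simp only [h3]
  rw [← Finset.mul_sum, h2]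
  by_cases h : c = e
  · subst h; simp [eval_kleinGordon]
  · simp [Matrix.diagonal_apply_ne _ h]

/-! ### Conservation of the BRS current -/

variable {T} (s : FreeBRS T)

lemma S_eq_zero {i j : I} (h : ¬ (T.kind i).Opposite (T.kind j)) : s.S i j = 0 := by
  by_contra h0; exact h (s.S_odd i j h0)

lemma J_eq_zero {i j : I} (h : ¬ (T.kind i).Opposite (T.kind j)) (μ : Fin 4) : s.J μ i j = 0 := by
  by_contra h0; exact h (s.J_odd μ i j h0)

lemma quadL_eq_zero {i j : I} (h : T.kind i ≠ T.kind j) : T.quadL i j = 0 := by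
  have h1 : ∀ a b, T.L i a j b = 0 := fun a b => by
    by_contra h0; exact h (T.even _ _ _ _ h0)
  simp [FreeTheory.quadL, h1]

lemma current_eq_zero {j k : I} (h : ¬ (T.kind j).Opposite (T.kind k)) (μ : Fin 4) :
    s.current μ j k = 0 := by
  have h1 : ∀ i b, MvPolynomial.C (lagrangianDeriv T.kind T.L i (some μ) j b) *
      onFst (jetPoly b) * onSnd (s.S i k) = 0 := fun i b => by
    by_cases hk : T.kind i = T.kind j
    · rw [S_eq_zero s (by rwa [hk])]; simp [onSnd]
    · simp [lagrangianDeriv_eq_zero T hk]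
  simp [FreeBRS.current, h1, J_eq_zero s h]

lemma symm_current_eq_zero {j k : I} (h : ¬ (T.kind j).Opposite (T.kind k)) (μ : Fin 4) :
    Quad.symm T.kind (s.current μ) j k = 0 := by
  simp [Quad.symm, current_eq_zero s h, current_eq_zero s (fun h' => h h'.symm)]

/-- The terms of the divergence of the BRS current which vanish by the field equations. -/
def onShellDivergence : Quad I := fun j k =>
  ∑ i, onFst (eulerLagrange T.kind T.L i j) * onSnd (s.S i k)

lemma rename_swap_onFst (P : DiffPoly) : MvPolynomial.rename Sum.swap (onFst P) = onSnd P := by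
  rw [onFst, onSnd, MvPolynomial.rename_rename]; rfl

lemma rename_swap_onSnd (P : DiffPoly) : MvPolynomial.rename Sum.swap (onSnd P) = onFst P := by
  rw [onFst, onSnd, MvPolynomial.rename_rename]; rfl

/-- The first variation of a quadratic Lagrangian, s₀L = (∂L/∂(∂^a φ_i)) ∂^a s₀φ_i, valid modulo
graded commutativity of the two factors. -/
lemma symm_brs : Quad.symm T.kind (Quad.brs T.kind s.S T.quadL) =
    Quad.symm T.kind (fun j k => ∑ i, ∑ a, ∑ b,
      MvPolynomial.C (lagrangianDeriv T.kind T.L i a j b) *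
      onFst (jetPoly b) * onSnd (jetPoly a) * onSnd (s.S i k)) := by
  set P : Quad I := fun j k => ∑ c, onFst (s.S c j) * T.quadL c k with hP
  set Q : Quad I := fun j k => ∑ c, MvPolynomial.C (paritySign (T.kind j).ghostParity) *
    onSnd (s.S c k) * T.quadL j c with hQ
  -- When the entry is nonzero, the two factors are a boson and a ghost, which commute. So the term
  -- with s₀ acting on the first factor may be transposed without a sign.
  have hP0 : ∀ j k, MvPolynomial.C ((T.kind j).exch (T.kind k)) * P j k = P j k := by
    intro j k
    by_cases h : (T.kind k).Opposite (T.kind j)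
    · rw [h.symm.exch_eq_one]; simp
    · have : P j k = 0 := Finset.sum_eq_zero fun c _ => by
        by_cases hc : T.kind c = T.kind k
        · rw [S_eq_zero s (by rwa [hc])]; simp [onFst]
        · rw [quadL_eq_zero hc, mul_zero]
      rw [this, mul_zero]
  have hsplit : ∀ j k, (∑ i, ∑ a, ∑ b, MvPolynomial.C (lagrangianDeriv T.kind T.L i a j b) *
      onFst (jetPoly b) * onSnd (jetPoly a) * onSnd (s.S i k)) =
      MvPolynomial.rename Sum.swap (P k j) + Q j k := by
    intro j k
    simp only [hP, hQ, map_sum, map_mul, rename_swap_onFst, ← Finset.sum_add_distrib]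
    refine Finset.sum_congr rfl fun i _ => ?_
    by_cases hij : T.kind i = T.kind j
    · by_cases hik : (T.kind i).Opposite (T.kind k)
      · simp only [lagrangianDeriv, ← hij, hik.exch_self, FreeTheory.quadL, map_sum, map_mul,
          rename_swap_onFst, rename_swap_onSnd, MvPolynomial.rename_C, Finset.mul_sum]
        rw [Finset.sum_comm (f := fun b a => MvPolynomial.C (paritySign (T.kind i).ghostParity) *
          onSnd (s.S i k) * (MvPolynomial.C (T.L j b i a) * onFst (jetPoly b) *
            onSnd (jetPoly a)))]
        rw [← Finset.sum_add_distrib]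
        refine Finset.sum_congr rfl fun a _ => ?_
        rw [← Finset.sum_add_distrib]
        refine Finset.sum_congr rfl fun b _ => ?_
        rw [map_add, map_mul]
        ring
      · simp [S_eq_zero s hik, onSnd]
    · simp [lagrangianDeriv_eq_zero T hij, quadL_eq_zero hij, quadL_eq_zero (Ne.symm hij)]
  have hbrs : Quad.brs T.kind s.S T.quadL = fun j k => P j k + Q j k := rfl
  have hsw : ∀ B : BiDiffPoly, MvPolynomial.rename Sum.swap (MvPolynomial.rename Sum.swap B) = B :=
    fun B => by rw [MvPolynomial.rename_rename]; simp
  rw [hbrs]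
  ext1 j
  ext1 k
  simp only [Quad.symm, hsplit, map_add, hsw, mul_add]
  rw [hP0 j k]
  have h2 := congrArg (MvPolynomial.rename Sum.swap) (hP0 k j)
  rw [map_mul, MvPolynomial.rename_C, FieldKind.exch_comm] at h2
  rw [h2]
  ring

/-- Noether's identity: the divergence of (∂L/∂φ_{i,μ}) s₀φ_i is s₀L minus the Euler-Lagrange
expression times s₀φ_i. The invariance hypothesis cancels s₀L against the divergence of `J`, and the
overall sign of the current leaves the field equation term. -/
lemma symm_div_current : Quad.symm T.kind (Quad.div s.current) =
    Quad.symm T.kind (onShellDivergence s) := by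
  set B : Quad I := fun j k => ∑ i, ∑ a, ∑ b,
    MvPolynomial.C (lagrangianDeriv T.kind T.L i a j b) *
      onFst (jetPoly b) * onSnd (jetPoly a) * onSnd (s.S i k) with hB
  have hdiv : ∀ j k, Quad.div s.current j k =
      -(B j k - onShellDivergence s j k + Quad.div s.J j k) := by
    intro j k
    -- The product rule in symbols: contributions of undifferentiated fields cancel, and those of
    -- ∂_μφ_i combine to the total derivative `X (inl μ) + X (inr μ)`.
    have hBW : B j k - onShellDivergence s j k = ∑ μ, (MvPolynomial.X (Sum.inl μ)
        + MvPolynomial.X (Sum.inr μ)) * ∑ i, ∑ b,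
        MvPolynomial.C (lagrangianDeriv T.kind T.L i (some μ) j b) *
          onFst (jetPoly b) * onSnd (s.S i k) := by
      simp only [hB, onShellDivergence, Finset.mul_sum]
      conv_rhs => rw [Finset.sum_comm]
      rw [← Finset.sum_sub_distrib]
      refine Finset.sum_congr rfl fun i _ => ?_
      simp only [eulerLagrange, Fintype.sum_option (α := Fin 4)]
      have hX : ∀ μ, (onFst (MvPolynomial.X μ)) = MvPolynomial.X (Sum.inl μ) := fun μ => by
        simp [onFst]
      have hX' : ∀ μ, (onSnd (MvPolynomial.X μ)) = MvPolynomial.X (Sum.inr μ) := fun μ => by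
        simp [onSnd]
      have hmul : ∀ P Q : DiffPoly, onFst (P * Q) = onFst P * onFst Q := fun P Q => map_mul _ _ _
      have hadd : ∀ P Q : DiffPoly, onFst (P + Q) = onFst P + onFst Q := fun P Q => map_add _ _ _
      have hsum : ∀ F : Fin 4 → DiffPoly, onFst (∑ μ, F μ) = ∑ μ, onFst (F μ) :=
        fun F => map_sum _ _ _
      have hneg : ∀ P : DiffPoly, onFst (-P) = -onFst P := fun P => map_neg _ _
      have hC : ∀ c : ℂ, onFst (MvPolynomial.C c) = MvPolynomial.C c := fun c => by simp [onFst]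
      have h1 : onFst (1 : DiffPoly) = 1 := map_one _
      have h1' : onSnd (1 : DiffPoly) = 1 := map_one _
      simp only [hadd, hneg, hsum, hmul, hC, jetPoly, jetSign, hX, hX', h1, h1', add_mul,
        Finset.sum_mul, Finset.sum_add_distrib, map_neg,
        neg_mul, one_mul, mul_one, Finset.sum_neg_distrib]
      simp only [mul_comm, mul_left_comm]
      ring
    rw [hBW]
    simp only [Quad.div, FreeBRS.current, mul_neg, mul_add, Finset.sum_neg_distrib,
      Finset.sum_add_distrib]
  have hinv : Quad.symm T.kind B = Quad.symm T.kind (-Quad.div s.J) :=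
    (symm_brs s).symm.trans s.invariance
  ext1 j
  ext1 k
  have h1 := congrFun (congrFun hinv j) k
  simp only [Quad.symm, Pi.neg_apply, map_neg] at h1
  simp only [Quad.symm, hdiv, map_neg, map_add, map_sub]
  linear_combination -h1

/-- The bilinear form belonging to the component `μ` of the BRS current. -/
def currentForm (μ : Fin 4) (h u : I → Fun) : Fun :=
  ∑ i, ∑ c, biDiffOp (Quad.symm T.kind (s.current μ) i c) (h i) (u c)

lemma contDiff_finset_sum {ι : Type*} (t : Finset ι) {f : ι → Fun}
    (hf : ∀ i ∈ t, ContDiff ℝ ∞ (f i)) : ContDiff ℝ ∞ (∑ i ∈ t, f i) := by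
  have : (∑ i ∈ t, f i) = fun x => ∑ i ∈ t, f i x := by ext x; simp
  rw [this]
  exact ContDiff.sum hf

lemma contDiff_currentForm (μ : Fin 4) {h u : I → Fun} (hh : ∀ i, ContDiff ℝ ∞ (h i))
    (hu : ∀ i, ContDiff ℝ ∞ (u i)) : ContDiff ℝ ∞ (currentForm s μ h u) :=
  contDiff_finset_sum _ fun i _ => contDiff_finset_sum _ fun c _ =>
    contDiff_biDiffOp _ (hh i) (hu c)

lemma coneSupported_currentForm (μ : Fin 4) {R : ℝ} {h : I → Fun} (hh : ∀ i, ConeSupported R (h i))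
    (u : I → Fun) : ConeSupported R (currentForm s μ h u) := by
  intro x hx
  simp only [currentForm, Finset.sum_apply]
  exact Finset.sum_eq_zero fun i _ => Finset.sum_eq_zero fun c _ => (hh i).biDiffOp _ _ x hx

/-- Noether's theorem: the BRS current of two solutions is conserved. -/
lemma div_currentForm {h u : I → Fun} (hh : ∀ i, ContDiff ℝ ∞ (h i))
    (hu : ∀ i, ContDiff ℝ ∞ (u i))
    (hDh : ∀ i, ∑ j, diffOp (eulerLagrange T.kind T.L i j) (h j) = 0)
    (hDu : ∀ i, ∑ j, diffOp (eulerLagrange T.kind T.L i j) (u j) = 0) :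
    ∑ μ, pd μ (currentForm s μ h u) = 0 := by
  have h1 : ∑ μ, pd μ (currentForm s μ h u) =
      ∑ i, ∑ c, biDiffOp (Quad.symm T.kind (Quad.div s.current) i c) (h i) (u c) := by
    have : ∀ μ, pd μ (currentForm s μ h u) = ∑ i, ∑ c, biDiffOp ((MvPolynomial.X (Sum.inl μ) +
        MvPolynomial.X (Sum.inr μ)) * Quad.symm T.kind (s.current μ) i c) (h i) (u c) := fun μ => by
      rw [currentForm, pd_sum _ fun i _ => contDiff_finset_sum _ fun c _ =>
        contDiff_biDiffOp _ (hh i) (hu c)]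
      refine Finset.sum_congr rfl fun i _ => ?_
      rw [pd_sum _ fun c _ => contDiff_biDiffOp _ (hh i) (hu c)]
      exact Finset.sum_congr rfl fun c _ => pd_biDiffOp (hh i) (hu c) μ _
    simp only [this]
    rw [Finset.sum_comm]
    refine Finset.sum_congr rfl fun i _ => ?_
    rw [Finset.sum_comm]
    refine Finset.sum_congr rfl fun c _ => ?_
    rw [← biDiffOp_sum_poly]
    congr 1
    simp only [Quad.symm, Quad.div, map_sum, map_mul, map_add, MvPolynomial.rename_X,
      Sum.swap_inl, Sum.swap_inr, Finset.mul_sum, ← Finset.sum_add_distrib]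
    exact Finset.sum_congr rfl fun μ _ => by ring
  rw [h1, symm_div_current]
  -- After symmetrization every term contains the field operator applied either to `h` or to `u`;
  -- the exchange sign is one wherever `S` does not vanish.
  have h2 : ∀ i c, biDiffOp (Quad.symm T.kind (onShellDivergence s) i c) (h i) (u c) =
      ∑ e, diffOp (eulerLagrange T.kind T.L e i) (h i) * diffOp (s.S e c) (u c)
      + ∑ e, diffOp (eulerLagrange T.kind T.L e c) (u c) * diffOp (s.S e i) (h i) := by
    intro i c
    rw [Quad.symm, biDiffOp_add_poly, biDiffOp_C_mul, biDiffOp_swap, onShellDivergence,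
      onShellDivergence, biDiffOp_sum_poly, biDiffOp_sum_poly, Finset.smul_sum]
    congr 1
    · exact Finset.sum_congr rfl fun e _ => biDiffOp_onFst_mul_onSnd (hh i) (hu c) _ _
    · refine Finset.sum_congr rfl fun e _ => ?_
      rw [biDiffOp_onFst_mul_onSnd (hu c) (hh i)]
      by_cases hec : T.kind e = T.kind c
      · by_cases hei : (T.kind e).Opposite (T.kind i)
        · rw [← hec, hei.symm.exch_eq_one, one_smul]
        · rw [S_eq_zero s hei]
          ext x; simp [diffOp]
      · rw [eulerLagrange_eq_zero T hec]
        ext x; simp [diffOp]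
  simp only [h2, Finset.sum_add_distrib]
  have h3 : ∑ i, ∑ c, ∑ e, diffOp (eulerLagrange T.kind T.L e i) (h i) * diffOp (s.S e c) (u c)
      = ∑ c, ∑ e, (∑ i, diffOp (eulerLagrange T.kind T.L e i) (h i)) * diffOp (s.S e c) (u c) := by
    rw [Finset.sum_comm]
    refine Finset.sum_congr rfl fun c _ => ?_
    rw [Finset.sum_comm]
    exact Finset.sum_congr rfl fun e _ => (Finset.sum_mul _ _ _).symm
  have h4 : ∑ i, ∑ c, ∑ e, diffOp (eulerLagrange T.kind T.L e c) (u c) * diffOp (s.S e i) (h i)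
      = ∑ i, ∑ e, (∑ c, diffOp (eulerLagrange T.kind T.L e c) (u c)) * diffOp (s.S e i) (h i) := by
    refine Finset.sum_congr rfl fun c _ => ?_
    rw [Finset.sum_comm]
    exact Finset.sum_congr rfl fun e _ => (Finset.sum_mul _ _ _).symm
  rw [h3, h4]
  simp [hDh, hDu]

/-- The components of a solution satisfy the Klein-Gordon equation. -/
lemma Solution.kleinGordon (h : Solution T) (i : I) :
    diffOp (kleinGordon (T.mass i)) (h.val i) = 0 := by
  have hD : ∀ j, ∑ k, diffOp (eulerLagrange T.kind T.L j k) (h.val k) = 0 := fun j => by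
    ext x; simpa using h.fieldEq j x
  have h1 : ∀ k, diffOp ((T.N * eulerLagrange T.kind T.L) i k) (h.val k) =
      ∑ j, diffOp (T.N i j) (diffOp (eulerLagrange T.kind T.L j k) (h.val k)) := fun k => by
    rw [Matrix.mul_apply]
    have : ∀ (t : Finset I) (P : I → DiffPoly), diffOp (∑ j ∈ t, P j) (h.val k) =
        ∑ j ∈ t, diffOp (P j) (h.val k) := fun t P => by
      induction t using Finset.induction_on with
      | empty => ext x; simp [diffOp]
      | insert a t ha ih => rw [Finset.sum_insert ha, Finset.sum_insert ha, diffOp_add_poly, ih]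
    rw [this]
    exact Finset.sum_congr rfl fun j _ => diffOp_mul (h.smooth k) _ _
  have h2 : ∀ (P : DiffPoly) (t : Finset I) (g : I → Fun), (∀ k, ContDiff ℝ ∞ (g k)) →
      diffOp P (∑ k ∈ t, g k) = ∑ k ∈ t, diffOp P (g k) := fun P t g hg => by
    induction t using Finset.induction_on with
    | empty => ext x; simp [diffOp, pdIter_zero_fun]
    | insert a t ha ih =>
      rw [Finset.sum_insert ha, Finset.sum_insert ha,
        diffOp_add (hg a) (contDiff_finset_sum t fun k _ => hg k), ih]
  have h3 : ∑ k, diffOp ((T.N * eulerLagrange T.kind T.L) i k) (h.val k) = 0 := by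
    simp only [h1]
    rw [Finset.sum_comm]
    refine Finset.sum_eq_zero fun j _ => ?_
    rw [← h2 _ _ _ fun k => contDiff_diffOp _ (h.smooth k), hD j]
    ext x; simp [diffOp, pdIter_zero_fun]
  rw [T.N_mul_D, Finset.sum_eq_single i] at h3
  · rw [Matrix.neg_apply, Matrix.diagonal_apply_eq] at h3
    have hneg := diffOp_mul (h.smooth i) (MvPolynomial.C (-1)) (BRS.kleinGordon (T.mass i))
    rw [diffOp_C] at hneg
    have : diffOp (-BRS.kleinGordon (T.mass i)) (h.val i) =
        -diffOp (BRS.kleinGordon (T.mass i)) (h.val i) := by simpa using hneg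
    rw [this] at h3
    exact neg_eq_zero.1 h3
  · intro k _ hk
    rw [Matrix.neg_apply, Matrix.diagonal_apply_ne _ (Ne.symm hk), neg_zero]
    ext x; simp [diffOp]
  · simp

end Theory

/-! ## Polynomial growth -/

/-- `φ` is bounded by a polynomial in the weight `w`. -/
def PolyBound {α E : Type*} [NormedAddCommGroup E] (w : α → ℝ) (φ : α → E) : Prop :=
  ∃ (C : ℝ) (M : ℕ), 0 ≤ C ∧ ∀ a, ‖φ a‖ ≤ C * w a ^ M

namespace PolyBound

variable {α E : Type*} [NormedAddCommGroup E] {w : α → ℝ}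

lemma const (c : E) : PolyBound w fun _ => c := ⟨‖c‖, 0, norm_nonneg _, fun _ => by simp⟩

lemma mono {E' : Type*} [NormedAddCommGroup E'] {φ : α → E} {ψ : α → E'} (hφ : PolyBound w φ)
    (h : ∀ a, ‖ψ a‖ ≤ ‖φ a‖) : PolyBound w ψ := by
  obtain ⟨C, M, hC, hb⟩ := hφ
  exact ⟨C, M, hC, fun a => (h a).trans (hb a)⟩

lemma norm {φ : α → E} (hφ : PolyBound w φ) : PolyBound w fun a => ‖φ a‖ :=
  hφ.mono fun a => by simp

lemma add (hw : ∀ a, 1 ≤ w a) {φ ψ : α → E} (hφ : PolyBound w φ) (hψ : PolyBound w ψ) :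
    PolyBound w fun a => φ a + ψ a := by
  obtain ⟨C, M, hC, hb⟩ := hφ
  obtain ⟨C', M', hC', hb'⟩ := hψ
  refine ⟨C + C', M + M', by positivity, fun a => (norm_add_le _ _).trans ?_⟩
  rw [add_mul]
  exact add_le_add
    ((hb a).trans (mul_le_mul_of_nonneg_left (pow_le_pow_right₀ (hw a) (by omega)) hC))
    ((hb' a).trans (mul_le_mul_of_nonneg_left (pow_le_pow_right₀ (hw a) (by omega)) hC'))

lemma sum (hw : ∀ a, 1 ≤ w a) {ι : Type*} (t : Finset ι) {φ : ι → α → E}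
    (h : ∀ i ∈ t, PolyBound w (φ i)) : PolyBound w fun a => ∑ i ∈ t, φ i a := by
  classical
  induction t using Finset.induction_on with
  | empty => simpa using const (w := w) (0 : E)
  | insert i t hi ih =>
    simp only [Finset.sum_insert hi]
    exact (h i (Finset.mem_insert_self _ _)).add hw
      (ih fun j hj => h j (Finset.mem_insert_of_mem hj))

lemma mul {A : Type*} [NormedRing A] {φ ψ : α → A} (hφ : PolyBound w φ) (hψ : PolyBound w ψ) :
    PolyBound w fun a => φ a * ψ a := by
  obtain ⟨C, M, hC, hb⟩ := hφ
  obtain ⟨C', M', hC', hb'⟩ := hψ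
  refine ⟨C * C', M + M', by positivity, fun a => (norm_mul_le _ _).trans ?_⟩
  calc ‖φ a‖ * ‖ψ a‖ ≤ (C * w a ^ M) * (C' * w a ^ M') :=
        mul_le_mul (hb a) (hb' a) (norm_nonneg _) ((norm_nonneg _).trans (hb a))
    _ = _ := by ring

lemma pow {φ : α → ℂ} (hφ : PolyBound w φ) (n : ℕ) : PolyBound w fun a => φ a ^ n := by
  induction n with
  | zero => simpa using const (w := w) (1 : ℂ)
  | succ n ih => simpa only [pow_succ] using ih.mul hφ

lemma prod {ι : Type*} (t : Finset ι) {φ : ι → α → ℂ}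
    (h : ∀ i ∈ t, PolyBound w (φ i)) : PolyBound w fun a => ∏ i ∈ t, φ i a := by
  classical
  induction t using Finset.induction_on with
  | empty => simpa using const (w := w) (1 : ℂ)
  | insert i t hi ih =>
    simp only [Finset.prod_insert hi]
    exact (h i (Finset.mem_insert_self _ _)).mul
      (ih fun j hj => h j (Finset.mem_insert_of_mem hj))

lemma eval (hw : ∀ a, 1 ≤ w a) {σ : Type*} [Fintype σ] {z : α → σ → ℂ}
    (h : ∀ i, PolyBound w fun a => z a i) (P : MvPolynomial σ ℂ) :
    PolyBound w fun a => MvPolynomial.eval (z a) P := by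
  simp only [MvPolynomial.eval_eq']
  exact sum hw _ fun d _ => (const _).mul (prod _ fun i _ => (h i).pow _)

lemma comp {β : Type*} {w' : β → ℝ} (hw' : ∀ b, 0 ≤ w' b) {φ : β → E}
    (hφ : PolyBound w' φ) {g : α → β} {K : ℝ} (hK : 0 ≤ K) (hg : ∀ a, w' (g a) ≤ K * w a) :
    PolyBound w fun a => φ (g a) := by
  obtain ⟨C, M, hC, hb⟩ := hφ
  refine ⟨C * K ^ M, M, by positivity, fun a => (hb _).trans ?_⟩
  rw [mul_assoc, ← mul_pow]
  exact mul_le_mul_of_nonneg_left (pow_le_pow_left₀ (hw' _) (hg a) M) hC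

end PolyBound

/-! ## Distributions applied to plane waves -/

section Distribution

variable {n : ℕ} {P : Type*} [NormedAddCommGroup P]

/-- Derivatives in the points alone are joint derivatives restricted to directions (0, y). Their
joint continuity in parameter and point follows. -/
lemma iteratedFDeriv_slice [NormedSpace ℝ P] {Φ : P → Pts n → ℂ}
    (hΦ : ContDiff ℝ ∞ (Function.uncurry Φ)) (j : ℕ)
    (k : P) (x : Pts n) : iteratedFDeriv ℝ j (Φ k) x =
      (iteratedFDeriv ℝ j (Function.uncurry Φ) (k, x)).compContinuousLinearMap
        fun _ => ContinuousLinearMap.inr ℝ P (Pts n) := by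
  have h1 : Φ k = (fun z => Function.uncurry Φ ((k, 0) + z)) ∘
      ContinuousLinearMap.inr ℝ P (Pts n) := by
    ext y; simp [Function.uncurry]
  have h2 : ContDiff ℝ ∞ fun z => Function.uncurry Φ ((k, 0) + z) :=
    hΦ.comp (contDiff_const.add contDiff_id)
  rw [h1, ContinuousLinearMap.iteratedFDeriv_comp_right _ h2 x (i := j)
    (WithTop.coe_le_coe.2 le_top), iteratedFDeriv_comp_add_left]
  simp

lemma continuous_iteratedFDeriv_slice [NormedSpace ℝ P] {Φ : P → Pts n → ℂ}
    (hΦ : ContDiff ℝ ∞ (Function.uncurry Φ)) (j : ℕ) :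
    Continuous (Function.uncurry fun (k : P) (x : Pts n) => iteratedFDeriv ℝ j (Φ k) x) := by
  have h1 : Continuous (iteratedFDeriv ℝ j (Function.uncurry Φ)) :=
    hΦ.continuous_iteratedFDeriv (WithTop.coe_le_coe.2 le_top)
  have h2 := (ContinuousMultilinearMap.compContinuousLinearMapL (𝕜 := ℝ) (F := ℂ)
    (fun _ : Fin j => ContinuousLinearMap.inr ℝ P (Pts n))).continuous.comp h1
  refine h2.congr fun a => ?_
  exact (iteratedFDeriv_slice hΦ j a.1 a.2).symm

lemma contDiff_slice [NormedSpace ℝ P] {Φ : P → Pts n → ℂ}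
    (hΦ : ContDiff ℝ ∞ (Function.uncurry Φ)) (k : P) :
    ContDiff ℝ ∞ (Φ k) :=
  hΦ.comp (contDiff_const.prodMk contDiff_id)

lemma IsDistributionOn.map_sub {K : Set (Pts n)} {T : (Pts n → ℂ) → ℂ} (hT : IsDistributionOn K T)
    {φ ψ : Pts n → ℂ} (hφ : ContDiff ℝ ∞ φ) (hψ : ContDiff ℝ ∞ ψ) : T (φ - ψ) = T φ - T ψ := by
  have h := hT.map_add φ ((-1 : ℂ) • ψ) hφ (contDiff_const.smul hψ)
  rw [hT.map_smul _ _ hψ] at h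
  rw [sub_eq_add_neg, sub_eq_add_neg, ← neg_one_mul (T ψ), ← h]
  congr 2
  simp

/-- A compactly supported distribution applied to a smooth family is continuous in the parameter. -/
lemma IsDistributionOn.continuous_apply [NormedSpace ℝ P] {K : Set (Pts n)} (hK : IsCompact K)
    {T : (Pts n → ℂ) → ℂ} (hT : IsDistributionOn K T) {Φ : P → Pts n → ℂ}
    (hΦ : ContDiff ℝ ∞ (Function.uncurry Φ)) : Continuous fun k => T (Φ k) := by
  obtain ⟨N, C, hb⟩ := hT.bound
  rw [continuous_iff_continuousAt]
  intro k₀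
  rw [ContinuousAt, Metric.tendsto_nhds]
  intro ε hε
  -- The constant `C` of the seminorm bound may be zero or negative, hence |C| + 1.
  set δ := ε / (2 * (|C| + 1)) with hδ
  have hδ0 : 0 < δ := by positivity
  -- Joint continuity together with compactness of `K` gives closeness of the derivatives uniformly
  -- over `K`.
  have hev : ∀ j : ℕ, ∀ᶠ k in 𝓝 k₀, ∀ x ∈ K,
      dist (iteratedFDeriv ℝ j (Φ k) x) (iteratedFDeriv ℝ j (Φ k₀) x) < δ := by
    intro j
    obtain ⟨v, hv, h⟩ := hK.mem_uniformity_of_prod (s := Set.univ)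
      (f := fun k x => iteratedFDeriv ℝ j (Φ k) x)
      (continuous_iteratedFDeriv_slice hΦ j).continuousOn (Set.mem_univ k₀)
      (Metric.dist_mem_uniformity hδ0)
    rw [nhdsWithin_univ] at hv
    filter_upwards [hv] with k hk x hx using h k hk x hx
  have hall : ∀ᶠ k in 𝓝 k₀, ∀ j ∈ Finset.range (N + 1), ∀ x ∈ K,
      dist (iteratedFDeriv ℝ j (Φ k) x) (iteratedFDeriv ℝ j (Φ k₀) x) < δ :=
    (Filter.eventually_all_finset _).2 fun j _ => hev j
  filter_upwards [hall] with k hk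
  have hs := contDiff_slice hΦ
  rw [dist_eq_norm, ← hT.map_sub (hs k) (hs k₀)]
  have h1 := hb (Φ k - Φ k₀) ((hs k).sub (hs k₀)) δ hδ0.le fun j hj x hx => by
    rw [iteratedFDeriv_sub_apply ((hs k).of_le (WithTop.coe_le_coe.2 le_top)).contDiffAt
      ((hs k₀).of_le (WithTop.coe_le_coe.2 le_top)).contDiffAt, ← dist_eq_norm]
    exact (hk j (Finset.mem_range.2 (by omega)) x hx).le
  have h2 : C * δ ≤ |C| * δ := mul_le_mul_of_nonneg_right (le_abs_self C) hδ0.le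
  have h3 : |C| * δ < ε := by
    rw [hδ, mul_div_assoc', div_lt_iff₀ (by positivity)]
    nlinarith [abs_nonneg C]
  linarith

/-- All derivatives of the family `Φ` grow at most polynomially in the parameter, uniformly
on `K`. -/
def DerivPolyBound (K : Set (Pts n)) (Φ : P → Pts n → ℂ) : Prop :=
  ∀ j : ℕ, PolyBound (fun a : P × K => 1 + ‖a.1‖) fun a => iteratedFDeriv ℝ j (Φ a.1) a.2.1

lemma one_le_one_add_norm {E : Type*} [SeminormedAddCommGroup E] (x : E) : 1 ≤ 1 + ‖x‖ := by
  linarith [norm_nonneg x]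

/-- A distribution bounded by finitely many seminorms sees only finitely many derivatives; summing
their bounds gives a common exponent. -/
lemma IsDistributionOn.polyBound {K : Set (Pts n)} {T : (Pts n → ℂ) → ℂ}
    (hT : IsDistributionOn K T) {Φ : P → Pts n → ℂ} (hΦ : ∀ k, ContDiff ℝ ∞ (Φ k))
    (hb : DerivPolyBound K Φ) : PolyBound (fun k : P => 1 + ‖k‖) fun k => T (Φ k) := by
  obtain ⟨N, C, hC⟩ := hT.bound
  obtain ⟨D, M, hD, hM⟩ := PolyBound.sum (fun a : P × K => one_le_one_add_norm a.1)
    (Finset.range (N + 1)) fun j _ => (hb j).norm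
  refine ⟨|C| * D, M, by positivity, fun k => ?_⟩
  have h0 : 0 ≤ D * (1 + ‖k‖) ^ M := by positivity
  refine (hC (Φ k) (hΦ k) (D * (1 + ‖k‖) ^ M) h0 fun j hj x hx => ?_).trans ?_
  · refine le_trans ?_ (hM (k, ⟨x, hx⟩))
    rw [Real.norm_of_nonneg (Finset.sum_nonneg fun _ _ => norm_nonneg _)]
    exact Finset.single_le_sum (f := fun j => ‖iteratedFDeriv ℝ j (Φ k) x‖)
      (fun _ _ => norm_nonneg _) (Finset.mem_range.2 (by omega))
  · rw [mul_assoc]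
    exact mul_le_mul_of_nonneg_right (le_abs_self C) h0

lemma DerivPolyBound.mul {K : Set (Pts n)} {Φ Ψ : P → Pts n → ℂ} (hΦs : ∀ k, ContDiff ℝ ∞ (Φ k))
    (hΨs : ∀ k, ContDiff ℝ ∞ (Ψ k)) (hΦ : DerivPolyBound K Φ) (hΨ : DerivPolyBound K Ψ) :
    DerivPolyBound K fun k x => Φ k x * Ψ k x := by
  intro j
  have h := PolyBound.sum (fun a : P × K => one_le_one_add_norm a.1) (Finset.range (j + 1))
    fun i _ => ((PolyBound.const (j.choose i : ℝ)).mul (hΦ i).norm).mul (hΨ (j - i)).norm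
  refine h.mono fun a => ?_
  rw [Real.norm_of_nonneg (Finset.sum_nonneg fun _ _ => by positivity)]
  exact norm_iteratedFDeriv_mul_le (hΦs a.1) (hΨs a.1) a.2.1 (WithTop.coe_le_coe.2 le_top)

lemma derivPolyBound_const {K : Set (Pts n)} (hK : IsCompact K) {f : Pts n → ℂ}
    (hf : ContDiff ℝ ∞ f) : DerivPolyBound K fun _ : P => f := by
  intro j
  obtain ⟨C, hC⟩ := hK.exists_bound_of_continuousOn
    (hf.continuous_iteratedFDeriv (m := j) (WithTop.coe_le_coe.2 le_top)).continuousOn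
  refine ⟨|C|, 0, abs_nonneg _, fun a => ?_⟩
  simpa using (hC a.2.1 a.2.2).trans (le_abs_self C)

lemma norm_iteratedFDeriv_cexp (j : ℕ) (t : ℝ) :
    ‖iteratedFDeriv ℝ j (fun t : ℝ => Complex.exp (Complex.I * (t : ℂ))) t‖ = 1 := by
  have h : ∀ j : ℕ, iteratedDeriv j (fun t : ℝ => Complex.exp (Complex.I * (t : ℂ))) =
      fun t : ℝ => Complex.I ^ j * Complex.exp (Complex.I * (t : ℂ)) := by
    intro j
    induction j with
    | zero => simp
    | succ j ih =>
      rw [iteratedDeriv_succ, ih]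
      ext t
      have h1 := ((Complex.ofRealCLM.hasDerivAt (x := t)).const_mul Complex.I).cexp.const_mul
        (Complex.I ^ j)
      have h2 : deriv (fun t : ℝ => Complex.I ^ j * Complex.exp (Complex.I * (t : ℂ))) t = _ :=
        h1.deriv
      rw [h2]
      simp
      ring
  rw [norm_iteratedFDeriv_eq_norm_iteratedDeriv, h]
  simp [mul_comm Complex.I, Complex.norm_exp_ofReal_mul_I]

/-- Each derivative of the exponential brings one factor of the linear form x ↦ k_i·x_l, whose norm
is at most 4‖k‖ because there are four coordinates. -/
lemma derivPolyBound_expWave (K : Set (Pts n)) {r : ℕ} (i : Fin r) (l : Fin n) :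
    DerivPolyBound K fun (k : Fin r → Spacetime) (x : Pts n) => expWave (k i) (x l) := by
  intro j
  refine ⟨4 ^ j, j, by positivity, fun a => ?_⟩
  obtain ⟨k, x, hx⟩ := a
  set L : Pts n →L[ℝ] ℝ := ∑ μ, k i μ • ((ContinuousLinearMap.proj μ : Spacetime →L[ℝ] ℝ).comp
    (ContinuousLinearMap.proj l : Pts n →L[ℝ] Spacetime)) with hL
  have hLx : ∀ y, L y = ∑ μ, k i μ * y l μ := fun y => by simp [hL, sum_apply]
  have hLn : ‖L‖ ≤ 4 * ‖k‖ := by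
    refine L.opNorm_le_bound (by positivity) fun y => ?_
    rw [hLx]
    refine (norm_sum_le _ _).trans ?_
    have : ∀ μ ∈ Finset.univ, ‖k i μ * y l μ‖ ≤ ‖k‖ * ‖y‖ := fun μ _ => by
      rw [norm_mul]
      exact mul_le_mul ((norm_le_pi_norm (k i) μ).trans (norm_le_pi_norm k i))
        ((norm_le_pi_norm (y l) μ).trans (norm_le_pi_norm y l)) (norm_nonneg _) (norm_nonneg _)
    refine (Finset.sum_le_sum this).trans ?_
    simp [mul_assoc]
  have hcomp : (fun y : Pts n => expWave (k i) (y l)) =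
      (fun t : ℝ => Complex.exp (Complex.I * (t : ℂ))) ∘ L := by
    ext y; simp [expWave, hLx]
  have hs : ContDiff ℝ ∞ fun t : ℝ => Complex.exp (Complex.I * (t : ℂ)) :=
    (contDiff_const.mul Complex.ofRealCLM.contDiff).cexp
  simp only [hcomp]
  rw [L.iteratedFDeriv_comp_right hs x (i := j) (WithTop.coe_le_coe.2 le_top)]
  refine (ContinuousMultilinearMap.norm_compContinuousLinearMap_le _ _).trans ?_
  rw [norm_iteratedFDeriv_cexp, one_mul, Finset.prod_const, Finset.card_univ, Fintype.card_fin,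
    ← mul_pow]
  refine pow_le_pow_left₀ (norm_nonneg _) (hLn.trans ?_) j
  linarith

/-- A family of functions which is constant and smooth, or a plane wave with variable momentum. -/
def IsWaveFamily {r : ℕ} (u : (Fin r → Spacetime) → Fun) : Prop :=
  (∃ f : Fun, ContDiff ℝ ∞ f ∧ u = fun _ => f) ∨ ∃ i : Fin r, u = fun k => expWave (k i)

lemma contDiff_uncurry_waveFamily {r : ℕ} {u : (Fin r → Spacetime) → Fun} (hu : IsWaveFamily u)
    (l : Fin n) :
    ContDiff ℝ ∞ (Function.uncurry fun (k : Fin r → Spacetime) (x : Pts n) => u k (x l)) := by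
  rcases hu with ⟨f, hf, rfl⟩ | ⟨i, rfl⟩
  · exact hf.comp ((contDiff_apply ℝ Spacetime l).comp contDiff_snd)
  · have h : ContDiff ℝ ∞ fun a : (Fin r → Spacetime) × Pts n => ∑ μ, a.1 i μ * a.2 l μ := by
      refine ContDiff.sum fun μ _ => ContDiff.mul ?_ ?_
      · exact (contDiff_apply ℝ ℝ μ).comp ((contDiff_apply ℝ Spacetime i).comp contDiff_fst)
      · exact (contDiff_apply ℝ ℝ μ).comp ((contDiff_apply ℝ Spacetime l).comp contDiff_snd)
    exact (contDiff_const.mul (Complex.ofRealCLM.contDiff.comp h)).cexp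

lemma derivPolyBound_waveFamily {K : Set (Pts n)} (hK : IsCompact K) {r : ℕ}
    {u : (Fin r → Spacetime) → Fun} (hu : IsWaveFamily u) (l : Fin n) :
    DerivPolyBound K fun (k : Fin r → Spacetime) (x : Pts n) => u k (x l) := by
  rcases hu with ⟨f, hf, rfl⟩ | ⟨i, rfl⟩
  · exact derivPolyBound_const hK (hf.comp (contDiff_apply ℝ Spacetime l))
  · exact derivPolyBound_expWave K i l

lemma derivPolyBound_prod {K : Set (Pts n)} (hK : IsCompact K) {r : ℕ}
    {u : Fin n → (Fin r → Spacetime) → Fun} (hu : ∀ l, IsWaveFamily (u l)) (t : Finset (Fin n)) :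
    ContDiff ℝ ∞ (Function.uncurry fun (k : Fin r → Spacetime) (x : Pts n) =>
      ∏ l ∈ t, u l k (x l)) ∧
    DerivPolyBound K fun (k : Fin r → Spacetime) (x : Pts n) => ∏ l ∈ t, u l k (x l) := by
  classical
  induction t using Finset.induction_on with
  | empty =>
    simp only [Finset.prod_empty]
    exact ⟨contDiff_const, derivPolyBound_const hK contDiff_const⟩
  | insert i t hi ih =>
    simp only [Finset.prod_insert hi]
    have h1 := contDiff_uncurry_waveFamily (n := n) (hu i) i
    exact ⟨h1.mul ih.1, DerivPolyBound.mul (contDiff_slice h1) (contDiff_slice ih.1)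
      (derivPolyBound_waveFamily hK (hu i) i) ih.2⟩

end Distribution

/-! ## Tame functionals -/

section Tame

variable {I : Type*}

/-- The regularity properties of field functionals which are used in the sequel: applied to smooth
functions and plane waves, they are continuous and polynomially bounded in the momenta. -/
structure Tame (F : ClFunctional I) : Prop where
  continuous : ∀ (r : ℕ) (legs : List (I × ((Fin r → Spacetime) → Fun))),
    (∀ x ∈ legs, IsWaveFamily x.2) → Continuous fun k => F (legs.map fun x => (x.1, x.2 k))
  polyBound : ∀ (r : ℕ) (legs : List (I × ((Fin r → Spacetime) → Fun))),
    (∀ x ∈ legs, IsWaveFamily x.2) →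
      PolyBound (fun k => 1 + ‖k‖) fun k => F (legs.map fun x => (x.1, x.2 k))
  zero : ∀ legs, SmoothLegs legs → (∃ x ∈ legs, x.2 = 0) → F legs = 0

/-- The tensor product of fixed smooth functions and plane waves is a smooth family whose
derivatives grow polynomially in the momenta, and compactly supported distributions preserve both
properties. -/
lemma IsField.tame {kind : I → FieldKind} {F : Functional I} (hF : IsField kind F) (l : ℕ) :
    Tame (F l) := by
  have key : ∀ (r : ℕ) (legs : List (I × ((Fin r → Spacetime) → Fun))),
      (∀ x ∈ legs, IsWaveFamily x.2) →
      (Continuous fun k => F l (legs.map fun x => (x.1, x.2 k))) ∧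
      PolyBound (fun k => 1 + ‖k‖) fun k => F l (legs.map fun x => (x.1, x.2 k)) := by
    intro r legs hlegs
    obtain ⟨K, hK, h⟩ := hF.distribution legs.length
    obtain ⟨D, hD, -, hDF⟩ := h l fun j => (legs.get j).1
    have hu : ∀ j, IsWaveFamily (legs.get j).2 := fun j => hlegs _ (List.get_mem legs j)
    have heq : ∀ k, F l (legs.map fun x => (x.1, x.2 k)) =
        D fun x => ∏ j, (legs.get j).2 k (x j) := by
      intro k
      rw [← hDF (fun j => (legs.get j).2 k) (fun j => ?_)]
      · congr 1
        conv_lhs => rw [← List.ofFn_get legs]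
        rw [List.map_ofFn]
        rfl
      · rcases hu j with ⟨f, hf, hfu⟩ | ⟨i, hi⟩
        · rw [hfu]; exact hf
        · rw [hi]; exact contDiff_expWave _
    simp only [heq]
    obtain ⟨h1, h2⟩ := derivPolyBound_prod hK hu Finset.univ
    exact ⟨hD.continuous_apply hK h1, hD.polyBound (contDiff_slice h1) h2⟩
  refine ⟨fun r legs h => (key r legs h).1, fun r legs h => (key r legs h).2, ?_⟩
  rintro legs hs ⟨x, hx, hx0⟩
  obtain ⟨K, hK, h⟩ := hF.distribution legs.length
  obtain ⟨D, hD, -, hDF⟩ := h l fun j => (legs.get j).1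
  have h1 := hDF (fun j => (legs.get j).2) fun j => hs _ (List.get_mem legs j)
  have h2 : (List.ofFn fun j => ((legs.get j).1, (legs.get j).2)) = legs := List.ofFn_get legs
  rw [h2] at h1
  obtain ⟨j, hj⟩ := List.get_of_mem hx
  -- A zero leg annihilates the tensor product; writing it as 0 • 1 lets homogeneity of the
  -- distribution conclude.
  have h3 : (fun x : Pts legs.length => ∏ j, (legs.get j).2 (x j)) =
      (0 : ℂ) • fun _ => (1 : ℂ) := by
    ext y
    rw [Finset.prod_eq_zero (Finset.mem_univ j) (by rw [hj, hx0]; rfl)]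
    simp
  rw [h1, h3, hD.map_smul _ _ contDiff_const, zero_mul]

lemma Tame.vanishesAtZero {F : ClFunctional I} (hF : Tame F) : VanishesAtZero F :=
  fun legs hl hz => hF.zero legs hl.smooth hz

lemma Tame.const_mul {F : ClFunctional I} (hF : Tame F) (c : ℂ) : Tame fun legs => c * F legs :=
  ⟨fun r legs h => continuous_const.mul (hF.continuous r legs h),
    fun r legs h => (PolyBound.const c).mul (hF.polyBound r legs h),
    fun legs hs hz => by rw [hF.zero legs hs hz, mul_zero]⟩

lemma Tame.add {F G : ClFunctional I} (hF : Tame F) (hG : Tame G) :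
    Tame fun legs => F legs + G legs :=
  ⟨fun r legs h => (hF.continuous r legs h).add (hG.continuous r legs h),
    fun r legs h => (hF.polyBound r legs h).add (fun k => one_le_one_add_norm k)
      (hG.polyBound r legs h),
    fun legs hs hz => by rw [hF.zero legs hs hz, hG.zero legs hs hz, add_zero]⟩

lemma tame_zero : Tame fun _ : List (Leg I) => (0 : ℂ) :=
  ⟨fun _ _ _ => continuous_const, fun _ _ _ => PolyBound.const 0, fun _ _ _ => rfl⟩

lemma Tame.sum {ι : Type*} (t : Finset ι) {F : ι → ClFunctional I} (hF : ∀ i ∈ t, Tame (F i)) :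
    Tame fun legs => ∑ i ∈ t, F i legs := by
  classical
  induction t using Finset.induction_on with
  | empty => simpa using tame_zero
  | insert i t hi ih =>
    simp only [Finset.sum_insert hi]
    exact (hF i (Finset.mem_insert_self _ _)).add
      (ih fun j hj => hF j (Finset.mem_insert_of_mem hj))

variable (kind : I → FieldKind)

lemma splitSum_map {X Y : Type*} (kX : X → FieldKind) (kY : Y → FieldKind) (g : X → Y)
    (hg : ∀ x, kY (g x) = kX x) (Φ : List Y → List Y → ℂ) (l : List X) :
    splitSum kY Φ (l.map g) = splitSum kX (fun A B => Φ (A.map g) (B.map g)) l := by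
  induction l generalizing Φ with
  | nil => simp
  | cons x l ih =>
    have hex : ∀ A : List X, exchList kY (g x) (A.map g) = exchList kX x A := fun A => by
      simp [exchList, hg, Function.comp_def]
    rw [List.map_cons, splitSum_cons, splitSum_cons, ih, ih]
    simp only [List.map_cons, hex]

lemma continuous_splitSum {X P : Type*} [TopologicalSpace P] (kX : X → FieldKind)
    (Φ : P → List X → List X → ℂ) (l : List X)
    (h : ∀ A B, (A ++ B).Perm l → Continuous fun k => Φ k A B) :
    Continuous fun k => splitSum kX (Φ k) l := by
  induction l generalizing Φ with
  | nil => simpa using h [] [] (List.Perm.refl _)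
  | cons x l ih =>
    simp only [splitSum_cons]
    refine (ih _ fun A B hAB => h _ _ (hAB.cons x)).add (ih _ fun A B hAB => ?_)
    exact continuous_const.mul (h _ _ (List.perm_middle.trans (hAB.cons x)))

lemma polyBound_splitSum {X P : Type*} {w : P → ℝ} (hw : ∀ k, 1 ≤ w k) (kX : X → FieldKind)
    (Φ : P → List X → List X → ℂ) (l : List X)
    (h : ∀ A B, (A ++ B).Perm l → PolyBound w fun k => Φ k A B) :
    PolyBound w fun k => splitSum kX (Φ k) l := by
  induction l generalizing Φ with
  | nil => simpa using h [] [] (List.Perm.refl _)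
  | cons x l ih =>
    simp only [splitSum_cons]
    refine (ih _ fun A B hAB => h _ _ (hAB.cons x)).add hw (ih _ fun A B hAB => ?_)
    exact (PolyBound.const _).mul (h _ _ (List.perm_middle.trans (hAB.cons x)))

/-- For the Leibniz rule the limit has to be computed on a product as well; tameness of the product
is all that this requires. -/
lemma Tame.splitSum {F G : ClFunctional I} (hF : Tame F) (hG : Tame G) :
    Tame (BRS.splitSum (fun x : Leg I => kind x.1) fun A B => F A * G B) := by
  have hsub : ∀ {r : ℕ} {legs A B : List (I × ((Fin r → Spacetime) → Fun))},
      (∀ x ∈ legs, IsWaveFamily x.2) → (A ++ B).Perm legs →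
      (∀ x ∈ A, IsWaveFamily x.2) ∧ (∀ x ∈ B, IsWaveFamily x.2) := fun h hp =>
    ⟨fun x hx => h x (hp.mem_iff.1 (List.mem_append_left _ hx)),
      fun x hx => h x (hp.mem_iff.1 (List.mem_append_right _ hx))⟩
  have hmap : ∀ {r : ℕ} (legs : List (I × ((Fin r → Spacetime) → Fun))) (k : Fin r → Spacetime),
      BRS.splitSum (fun x : Leg I => kind x.1) (fun A B => F A * G B)
        (legs.map fun x => (x.1, x.2 k)) =
      BRS.splitSum (fun x => kind x.1) (fun A B => F (A.map fun x => (x.1, x.2 k)) *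
        G (B.map fun x => (x.1, x.2 k))) legs := fun legs k =>
    splitSum_map _ _ _ (fun _ => rfl) _ legs
  refine ⟨fun r legs h => ?_, fun r legs h => ?_, fun legs hs hz => ?_⟩
  · simp only [hmap]
    exact continuous_splitSum _ _ legs fun A B hp =>
      (hF.continuous r A (hsub h hp).1).mul (hG.continuous r B (hsub h hp).2)
  · simp only [hmap]
    exact polyBound_splitSum (fun k => one_le_one_add_norm k) _ _ legs fun A B hp =>
      (hF.polyBound r A (hsub h hp).1).mul (hG.polyBound r B (hsub h hp).2)
  · rw [splitSum_congr _ (Ψ := fun _ _ => 0), splitSum_zero]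
    intro A B hp
    obtain ⟨x, hx, hx0⟩ := hz
    have hsm : SmoothLegs (A ++ B) := fun y hy => hs y (hp.mem_iff.1 hy)
    rcases List.mem_append.1 (hp.mem_iff.2 hx) with hx | hx
    · rw [hF.zero A (fun y hy => hsm y (List.mem_append_left _ hy)) ⟨x, hx, hx0⟩, zero_mul]
    · rw [hG.zero B (fun y hy => hsm y (List.mem_append_right _ hy)) ⟨x, hx, hx0⟩, mul_zero]

end Tame

/-! ## Rapid decay -/

/-- `φ` decays faster than any power of the weight `w`, up to the factor `δ`. -/
def RapidDecay {α : Type*} (w δ : α → ℝ) (φ : α → ℂ) : Prop :=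
  ∀ M : ℕ, ∃ C : ℝ, 0 ≤ C ∧ ∀ a, w a ^ M * ‖φ a‖ ≤ C * δ a

namespace RapidDecay

variable {α : Type*} {w δ : α → ℝ}

lemma polyBound_mul (hw : ∀ a, 1 ≤ w a) {φ ψ : α → ℂ} (hψ : PolyBound w ψ)
    (hφ : RapidDecay w δ φ) : RapidDecay w δ fun a => ψ a * φ a := by
  obtain ⟨C', M', hC', hb⟩ := hψ
  intro M
  obtain ⟨C, hC, h⟩ := hφ (M + M')
  refine ⟨C' * C, by positivity, fun a => ?_⟩
  have hw0 : 0 ≤ w a := zero_le_one.trans (hw a)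
  calc w a ^ M * ‖ψ a * φ a‖ = ‖ψ a‖ * (w a ^ M * ‖φ a‖) := by rw [norm_mul]; ring
    _ ≤ (C' * w a ^ M') * (w a ^ M * ‖φ a‖) := mul_le_mul_of_nonneg_right (hb a) (by positivity)
    _ = C' * (w a ^ (M + M') * ‖φ a‖) := by ring
    _ ≤ C' * (C * δ a) := mul_le_mul_of_nonneg_left (h a) hC'
    _ = _ := by ring

lemma add {φ ψ : α → ℂ} (hw : ∀ a, 1 ≤ w a) (hφ : RapidDecay w δ φ) (hψ : RapidDecay w δ ψ) :
    RapidDecay w δ fun a => φ a + ψ a := by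
  intro M
  obtain ⟨C, hC, h⟩ := hφ M
  obtain ⟨C', hC', h'⟩ := hψ M
  refine ⟨C + C', by positivity, fun a => ?_⟩
  have hw0 : 0 ≤ w a ^ M := pow_nonneg (zero_le_one.trans (hw a)) _
  calc w a ^ M * ‖φ a + ψ a‖ ≤ w a ^ M * (‖φ a‖ + ‖ψ a‖) :=
        mul_le_mul_of_nonneg_left (norm_add_le _ _) hw0
    _ ≤ _ := by linarith [h a, h' a]

lemma zero (hδ : ∀ a, 0 ≤ δ a) : RapidDecay w δ fun _ => 0 := fun _ =>
  ⟨1, zero_le_one, fun a => by simpa using hδ a⟩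

lemma sum (hw : ∀ a, 1 ≤ w a) (hδ : ∀ a, 0 ≤ δ a) {ι : Type*} (t : Finset ι) {φ : ι → α → ℂ}
    (h : ∀ i ∈ t, RapidDecay w δ (φ i)) : RapidDecay w δ fun a => ∑ i ∈ t, φ i a := by
  classical
  induction t using Finset.induction_on with
  | empty => simpa using zero hδ
  | insert i t hi ih =>
    simp only [Finset.sum_insert hi]
    exact (h i (Finset.mem_insert_self _ _)).add hw
      (ih fun j hj => h j (Finset.mem_insert_of_mem hj))

/-- Decay in `t` implies decay in any weight which is at most linear in `t`. -/
lemma of_pow_mul_le {t : α → ℝ} (ht : ∀ a, 0 ≤ t a) (hw : ∀ a, 0 ≤ w a)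
    (hwt : ∀ a, w a ≤ 1 + t a) {φ : α → ℂ}
    (h : ∀ M : ℕ, ∃ C : ℝ, 0 ≤ C ∧ ∀ a, t a ^ M * ‖φ a‖ ≤ C * δ a) : RapidDecay w δ φ := by
  intro M
  obtain ⟨C₀, hC₀, h₀⟩ := h 0
  obtain ⟨C, hC, hM⟩ := h M
  refine ⟨2 ^ (M - 1) * (C₀ + C), by positivity, fun a => ?_⟩
  have h1 : w a ^ M ≤ 2 ^ (M - 1) * (1 ^ M + t a ^ M) :=
    (pow_le_pow_left₀ (hw a) (hwt a) M).trans (add_pow_le zero_le_one (ht a) M)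
  calc w a ^ M * ‖φ a‖ ≤ 2 ^ (M - 1) * (1 ^ M + t a ^ M) * ‖φ a‖ :=
        mul_le_mul_of_nonneg_right h1 (norm_nonneg _)
    _ = 2 ^ (M - 1) * (t a ^ 0 * ‖φ a‖ + t a ^ M * ‖φ a‖) := by ring
    _ ≤ 2 ^ (M - 1) * (C₀ * δ a + C * δ a) :=
        mul_le_mul_of_nonneg_left (add_le_add (h₀ a) (hM a)) (by positivity)
    _ = _ := by ring

lemma norm_le (hw : ∀ a, 1 ≤ w a) {φ : α → ℂ} (h : RapidDecay w δ φ) (M : ℕ) :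
    ∃ C : ℝ, 0 ≤ C ∧ ∀ a, ‖φ a‖ ≤ C * δ a * (w a ^ M)⁻¹ := by
  obtain ⟨C, hC, hb⟩ := h M
  refine ⟨C, hC, fun a => ?_⟩
  have : 0 < w a ^ M := pow_pos (zero_lt_one.trans_le (hw a)) _
  rw [← div_eq_mul_inv, le_div_iff₀ this, mul_comm]
  exact hb a

end RapidDecay

/-! ## The mass shell -/

lemma norm_le_energy (m : ℝ) (p : Fin 3 → ℝ) : ‖p‖ ≤ energy m p := by
  refine (pi_norm_le_iff_of_nonneg (Real.sqrt_nonneg _)).2 fun i => ?_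
  rw [Real.norm_eq_abs]
  refine Real.abs_le_sqrt ?_
  have := Finset.single_le_sum (f := fun i => p i ^ 2) (fun _ _ => sq_nonneg _) (Finset.mem_univ i)
  nlinarith [sq_nonneg m]

lemma energy_nonneg (m : ℝ) (p : Fin 3 → ℝ) : 0 ≤ energy m p := Real.sqrt_nonneg _

lemma energy_le (m : ℝ) (p : Fin 3 → ℝ) : energy m p ≤ 2 * ‖p‖ + |m| := by
  refine Real.sqrt_le_iff.2 ⟨by positivity, ?_⟩
  have h : ∀ i, p i ^ 2 ≤ ‖p‖ ^ 2 := fun i => by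
    rw [← sq_abs]
    exact pow_le_pow_left₀ (abs_nonneg _) (norm_le_pi_norm p i) 2
  rw [Fin.sum_univ_three]
  have := mul_nonneg (norm_nonneg p) (abs_nonneg m)
  nlinarith [h 0, h 1, h 2, sq_abs m, sq_nonneg ‖p‖]

lemma continuous_energy (m : ℝ) : Continuous (energy m) := by
  unfold energy; fun_prop

lemma continuous_shellMomentum (m : ℝ) : Continuous (shellMomentum m) := by
  refine continuous_pi fun μ => ?_
  refine Fin.cases ?_ (fun l => ?_) μ
  · exact (continuous_energy m).neg
  · exact continuous_apply l

lemma norm_shellMomentum_le (m : ℝ) (p : Fin 3 → ℝ) :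
    ‖shellMomentum m p‖ ≤ 2 * ‖p‖ + |m| := by
  refine (pi_norm_le_iff_of_nonneg (by positivity)).2 fun μ => ?_
  refine Fin.cases ?_ (fun l => ?_) μ
  · rw [shellMomentum, Fin.cons_zero, norm_neg, Real.norm_of_nonneg (energy_nonneg m p)]
    exact energy_le m p
  · rw [shellMomentum, Fin.cons_succ]
    have := norm_le_pi_norm p l
    have := abs_nonneg m
    linarith [norm_nonneg p]

/-- A family of momenta whose frequency controls the weight `w` and which grows at most
polynomially. -/
structure ShellFamily {α : Type*} (w : α → ℝ) (κ : α → Spacetime) : Prop where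
  one_le : ∀ a, 1 ≤ w a
  le_frequency : ∀ a, w a ≤ 1 + |κ a 0|
  polyBound : ∀ μ, PolyBound w fun a => ((κ a μ : ℝ) : ℂ)

lemma ShellFamily.neg {α : Type*} {w : α → ℝ} {κ : α → Spacetime} (h : ShellFamily w κ) :
    ShellFamily w fun a => -κ a :=
  ⟨h.one_le, fun a => by simpa using h.le_frequency a,
    fun μ => (h.polyBound μ).mono fun a => by simp⟩

lemma shellFamily_shellMomentum (m : ℝ) :
    ShellFamily (fun p : Fin 3 → ℝ => 1 + ‖p‖) (shellMomentum m) := by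
  refine ⟨one_le_one_add_norm, fun p => ?_, fun μ => ⟨2 + |m|, 1, by positivity, fun p => ?_⟩⟩
  · have : shellMomentum m p 0 = -energy m p := rfl
    rw [this, abs_neg, abs_of_nonneg (energy_nonneg m p)]
    linarith [norm_le_energy m p]
  · rw [Complex.norm_real]
    refine ((norm_le_pi_norm _ μ).trans (norm_shellMomentum_le m p)).trans ?_
    have := mul_nonneg (norm_nonneg p) (abs_nonneg m)
    rw [pow_one]
    nlinarith

lemma ShellFamily.comp {α β : Type*} {w : α → ℝ} {κ : α → Spacetime} (h : ShellFamily w κ)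
    (g : β → α) : ShellFamily (fun b => w (g b)) fun b => κ (g b) := by
  refine ⟨fun b => h.one_le _, fun b => h.le_frequency _, fun μ => ?_⟩
  obtain ⟨C, M, hC, hb⟩ := h.polyBound μ
  exact ⟨C, M, hC, fun b => hb _⟩

lemma ShellFamily.polyBound_eval {α : Type*} {w : α → ℝ} {κ : α → Spacetime} (h : ShellFamily w κ)
    (P : DiffPoly) : PolyBound w fun a => MvPolynomial.eval (symbolAt (κ a)) P :=
  PolyBound.eval h.one_le (fun μ => (PolyBound.const Complex.I).mul (h.polyBound μ)) P

lemma ShellFamily.polyBound_prod {α : Type*} {w : α → ℝ} {κ : α → Spacetime} (h : ShellFamily w κ)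
    (c : ℂ) (n : Fin 4 → ℕ) :
    PolyBound w fun a => c * ∏ μ, (Complex.I * (κ a μ : ℂ)) ^ n μ :=
  (PolyBound.const c).mul
    (PolyBound.prod _ fun μ _ => ((PolyBound.const Complex.I).mul (h.polyBound μ)).pow _)

/-- The integrable function dominating the integrands over the mass shells. -/
def shellBound (p : Fin 3 → ℝ) : ℝ := ‖p‖⁻¹ * ((1 + ‖p‖) ^ 4)⁻¹

/-- In polar coordinates the radial density is r² · r⁻¹(1 + r)⁻⁴ = r/(1 + r)⁴ ≤ (1 + r)⁻². The
factor r⁻¹ is the infrared singularity of 1/ω for massless fields. -/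
lemma integrable_shellBound : Integrable shellBound := by
  have h := (integrable_fun_norm_addHaar (E := Fin 3 → ℝ) volume
    (f := fun r : ℝ => r⁻¹ * ((1 + r) ^ 4)⁻¹)).2
  refine h ?_
  have h1 : IntegrableOn (fun x : ℝ => (x + 1) ^ (-2 : ℝ)) (Set.Ioi 0) :=
    integrableOn_add_rpow_Ioi_of_lt (by norm_num) (by norm_num)
  refine Integrable.mono' h1 (Measurable.aestronglyMeasurable (by fun_prop)) ?_
  filter_upwards [ae_restrict_mem measurableSet_Ioi] with x hx
  have hx : 0 < x := hx
  have hx1 : (0 : ℝ) < x + 1 := by linarith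
  rw [Real.rpow_neg hx1.le, Module.finrank_fin_fun, smul_eq_mul,
    Real.norm_of_nonneg (by positivity)]
  have : (x + 1) ^ (2 : ℝ) = (x + 1) ^ 2 := by norm_cast
  rw [this]
  have e : x ^ (3 - 1) * (x⁻¹ * ((1 + x) ^ 4)⁻¹) = x / (x + 1) ^ 4 := by
    field_simp; ring
  rw [e, ← one_div, div_le_div_iff₀ (by positivity) (by positivity)]
  nlinarith [pow_pos hx1 2, pow_pos hx1 3]

lemma integrable_shellBound_smul {ε : ℝ} (hε : 0 < ε) :
    Integrable fun p => shellBound (ε⁻¹ • p) :=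
  (integrable_comp_smul_iff volume shellBound (inv_ne_zero hε.ne')).2 integrable_shellBound

lemma integral_shellBound_smul {ε : ℝ} (hε : 0 < ε) :
    ∫ p, shellBound (ε⁻¹ • p) = ε ^ 3 * ∫ p, shellBound p := by
  rw [Measure.integral_comp_inv_smul, Module.finrank_fin_fun, abs_of_pos (by positivity),
    smul_eq_mul]

/-! ## Symbols on the mass shell -/

/-- The symbol of `P(∂) Δ₊^{(m)}` on the mass shell. -/
def shellSymbol (P : DiffPoly) (m : ℝ) (p : Fin 3 → ℝ) : ℂ :=
  MvPolynomial.eval (symbolAt (shellMomentum m p)) P /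
    (((2 * Real.pi) ^ 3 * (2 * energy m p) : ℝ) : ℂ)

lemma measurable_shellSymbol (P : DiffPoly) (m : ℝ) : Measurable (shellSymbol P m) := by
  refine Measurable.div (Continuous.measurable ?_) (Continuous.measurable ?_)
  · refine (MvPolynomial.continuous_eval P).comp (continuous_pi fun μ => ?_)
    exact continuous_const.mul (Complex.continuous_ofReal.comp
      ((continuous_apply μ).comp (continuous_shellMomentum m)))
  · exact Complex.continuous_ofReal.comp
      (continuous_const.mul (continuous_const.mul (continuous_energy m)))

/-- From ω ≥ ‖p‖, valid for every mass. The origin is excluded because ‖0‖⁻¹ is zero by convention;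
it is a null set. -/
lemma norm_shellSymbol_le (P : DiffPoly) (m : ℝ) {p : Fin 3 → ℝ} (hp : p ≠ 0) :
    ‖shellSymbol P m p‖ ≤ ‖p‖⁻¹ * ‖MvPolynomial.eval (symbolAt (shellMomentum m p)) P‖ := by
  have hp0 : 0 < ‖p‖ := norm_pos_iff.2 hp
  have he := norm_le_energy m p
  have hpi : (1 : ℝ) ≤ (2 * Real.pi) ^ 3 := one_le_pow₀ (by linarith [Real.pi_gt_three])
  rw [shellSymbol, norm_div, Complex.norm_real, div_eq_inv_mul]
  refine mul_le_mul_of_nonneg_right (inv_anti₀ hp0 ?_) (norm_nonneg _)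
  rw [Real.norm_of_nonneg
    (mul_nonneg (by positivity) (mul_nonneg zero_le_two (energy_nonneg m p)))]
  nlinarith

lemma shellSymbol_zero (m : ℝ) (p : Fin 3 → ℝ) : shellSymbol 0 m p = 0 := by simp [shellSymbol]

lemma ae_ne_zero : ∀ᵐ p : Fin 3 → ℝ, p ≠ 0 := by
  rw [ae_iff]
  simp

/-- Integrals over the mass shell of rapidly decaying functions. -/
lemma exists_bound_shellSymbol_mul {α : Type*} (q : α → Fin 3 → ℝ) {δ : α → ℝ} (P : DiffPoly)
    (m : ℝ) {φ : α → ℂ}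
    (hφ : RapidDecay (fun a => 1 + ‖q a‖) δ φ) :
    ∃ C : ℝ, 0 ≤ C ∧ ∀ a, q a ≠ 0 → ‖shellSymbol P m (q a) * φ a‖ ≤ C * δ a * shellBound (q a) := by
  have hw : ∀ a, 1 ≤ 1 + ‖q a‖ := fun a => one_le_one_add_norm (q a)
  have h1 := hφ.polyBound_mul hw (((shellFamily_shellMomentum m).comp q).polyBound_eval P)
  obtain ⟨C, hC, hb⟩ := h1.norm_le hw 4
  refine ⟨C, hC, fun a ha => ?_⟩
  rw [norm_mul]
  calc ‖shellSymbol P m (q a)‖ * ‖φ a‖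
      ≤ ‖q a‖⁻¹ * ‖MvPolynomial.eval (symbolAt (shellMomentum m (q a))) P‖ * ‖φ a‖ :=
        mul_le_mul_of_nonneg_right (norm_shellSymbol_le P m ha) (norm_nonneg _)
    _ = ‖q a‖⁻¹ * ‖MvPolynomial.eval (symbolAt (shellMomentum m (q a))) P * φ a‖ := by
        rw [norm_mul, mul_assoc]
    _ ≤ ‖q a‖⁻¹ * (C * δ a * ((1 + ‖q a‖) ^ 4)⁻¹) :=
        mul_le_mul_of_nonneg_left (hb a) (by positivity)
    _ = _ := by unfold shellBound; ring

lemma integrable_shellSymbol_mul (P : DiffPoly) (m : ℝ) {φ : (Fin 3 → ℝ) → ℂ}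
    (hc : Continuous φ) (hφ : RapidDecay (fun p => 1 + ‖p‖) (fun _ => 1) φ) :
    Integrable fun p => shellSymbol P m p * φ p := by
  obtain ⟨C, hC, hb⟩ := exists_bound_shellSymbol_mul id P m hφ
  refine Integrable.mono' (integrable_shellBound.const_mul C)
    ((measurable_shellSymbol P m).mul hc.measurable).aestronglyMeasurable ?_
  filter_upwards [ae_ne_zero] with p hp
  simpa using hb p hp

/-! ## The smeared BRS current -/

lemma smeared_eq_zero_of_length {I : Type*} (kind : I → FieldKind) (g : Spacetime → ℝ) (B : Quad I)
    {legs : List (Leg I)} (h : legs.length ≠ 2) : smeared kind g B legs = 0 := by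
  match legs with
  | [] => rfl
  | [_] => rfl
  | [_, _] => exact absurd rfl h
  | _ :: _ :: _ :: _ => rfl

section Charge

variable {I : Type*} [Fintype I] [DecidableEq I] {T : FreeTheory I} (s : FreeBRS T)

/-- The bilinear form `∫ g j⁰` on a pair of legs. -/
def chargeForm (g : Fun) (i j : I) (f f' : Fun) : ℂ :=
  ∫ x, g x * biDiffOp (Quad.symm T.kind (s.current 0) i j) f f' x

lemma smeared_pair (g : Spacetime → ℝ) (x y : Leg I) :
    smeared T.kind g (s.current 0) [x, y] = chargeForm s (fun z => (g z : ℂ)) x.1 y.1 x.2 y.2 := by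
  obtain ⟨i, f⟩ := x
  obtain ⟨j, f'⟩ := y
  simp only [smeared, chargeForm, Quad.symm, biDiffOp_add_poly, biDiffOp_C_mul, biDiffOp_swap,
    Pi.add_apply, Pi.smul_apply, smul_eq_mul]

lemma chargeForm_eq_zero (g : Fun) {i j : I} (h : ¬ (T.kind i).Opposite (T.kind j)) (f f' : Fun) :
    chargeForm s g i j f f' = 0 := by
  simp [chargeForm, symm_current_eq_zero s h, biDiffOp]

lemma chargeForm_zero_left (g : Fun) (i j : I) (f' : Fun) : chargeForm s g i j 0 f' = 0 := by
  simp [chargeForm, biDiffOp_zero_left]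

/-- The current couples bosons to ghosts only, and these commute, so its symmetrized form is
symmetric without a sign. -/
lemma chargeForm_swap (g : Fun) (i j : I) (f f' : Fun) :
    chargeForm s g i j f f' = chargeForm s g j i f' f := by
  by_cases h : (T.kind i).Opposite (T.kind j)
  · have h1 : biDiffOp (Quad.symm T.kind (s.current 0) i j) f f' =
        biDiffOp (Quad.symm T.kind (s.current 0) j i) f' f := by
      simp only [Quad.symm, biDiffOp_add_poly, biDiffOp_C_mul, biDiffOp_swap, h.exch_eq_one,
        h.symm.exch_eq_one, one_smul]
      exact add_comm _ _
    simp only [chargeForm, h1]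
  · rw [chargeForm_eq_zero s g h, chargeForm_eq_zero s g fun h' => h h'.symm]

lemma integrable_mul_biDiffOp {g : Fun} (hg : ContDiff ℝ ∞ g) (hgc : TimeCompact g) {f : Fun}
    (hf : SpatiallyCompact f) (B : BiDiffPoly) {u : Fun} (hu : ContDiff ℝ ∞ u) :
    Integrable fun x => g x * biDiffOp B f u x := by
  obtain ⟨hf1, R, hR⟩ := spatiallyCompact_iff.1 hf
  exact (hg.continuous.mul (contDiff_biDiffOp B hf1 hu).continuous).integrable_of_hasCompactSupport
    (hasCompactSupport_mul_of_timeCompact hgc (hR.biDiffOp u B))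

lemma integrable_mul_expWave {ψ : Fun} (hψ : ContDiff ℝ ∞ ψ) (hc : HasCompactSupport ψ)
    (k : Spacetime) : Integrable fun x => ψ x * expWave k x :=
  (hψ.continuous.mul (contDiff_expWave k).continuous).integrable_of_hasCompactSupport hc.mul_right

/-- Splits the form into polynomials in the momentum and Fourier transforms of compactly supported
functions, the latter carrying all the decay. -/
lemma chargeForm_expWave {g : Fun} (hg : ContDiff ℝ ∞ g) (hgc : TimeCompact g) {f : Fun}
    (hf : SpatiallyCompact f) (i c : I) (k : Spacetime) :
    chargeForm s g i c f (expWave k) =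
      ∑ a ∈ (Quad.symm T.kind (s.current 0) i c).support,
        ((Quad.symm T.kind (s.current 0) i c).coeff a *
          ∏ μ, (Complex.I * (k μ : ℂ)) ^ a (Sum.inr μ)) *
        ∫ x, (g * pdIter (fun μ => a (Sum.inl μ)) f) x * expWave k x := by
  obtain ⟨hf1, R, hR⟩ := spatiallyCompact_iff.1 hf
  simp only [chargeForm, biDiffOp_expWave, Finset.mul_sum]
  rw [integral_finsetSum]
  · refine Finset.sum_congr rfl fun a _ => ?_
    rw [← integral_const_mul]
    exact integral_congr_ae (Eventually.of_forall fun x => by simp only [Pi.mul_apply]; ring)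
  · intro a _
    refine ((integrable_mul_expWave (hg.mul (contDiff_pdIter hf1 fun μ => a (Sum.inl μ)))
      (hasCompactSupport_mul_of_timeCompact hgc (hR.pdIter _)) k).const_mul
      ((Quad.symm T.kind (s.current 0) i c).coeff a *
        ∏ μ, (Complex.I * (k μ : ℂ)) ^ a (Sum.inr μ))).congr
      (Eventually.of_forall fun x => by simp only; ring)

lemma rapidDecay_fourier {α : Type*} {w : α → ℝ} {κ : α → Spacetime} (hκ : ShellFamily w κ)
    {ψ : Fun} (hψ : ContDiff ℝ ∞ ψ) (hc : HasCompactSupport ψ) :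
    RapidDecay w (fun _ => 1) fun a => ∫ x, ψ x * expWave (κ a) x := by
  refine RapidDecay.of_pow_mul_le (t := fun a => |κ a 0|) (fun a => abs_nonneg _)
    (fun a => zero_le_one.trans (hκ.one_le a)) hκ.le_frequency fun M => ?_
  obtain ⟨C, hC, h⟩ := exists_fourier_decay hψ hc M
  exact ⟨C, hC, fun a => by simpa using h (κ a)⟩

lemma rapidDecay_chargeForm {g : Fun} (hg : ContDiff ℝ ∞ g) (hgc : TimeCompact g) {f : Fun}
    (hf : SpatiallyCompact f) (i c : I) {α : Type*} {w : α → ℝ} {κ : α → Spacetime}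
    (hκ : ShellFamily w κ) :
    RapidDecay w (fun _ => 1) fun a => chargeForm s g i c f (expWave (κ a)) := by
  obtain ⟨hf1, R, hR⟩ := spatiallyCompact_iff.1 hf
  simp only [chargeForm_expWave s hg hgc hf]
  refine RapidDecay.sum hκ.one_le (fun _ => zero_le_one) _ fun a _ => ?_
  exact (rapidDecay_fourier hκ (hg.mul (contDiff_pdIter hf1 _))
    (hasCompactSupport_mul_of_timeCompact hgc (hR.pdIter _))).polyBound_mul hκ.one_le
    (hκ.polyBound_prod _ _)

lemma continuous_chargeForm {g : Fun} (hg : ContDiff ℝ ∞ g) (hgc : TimeCompact g) {f : Fun}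
    (hf : SpatiallyCompact f) (i c : I) :
    Continuous fun k => chargeForm s g i c f (expWave k) := by
  obtain ⟨hf1, R, hR⟩ := spatiallyCompact_iff.1 hf
  simp only [chargeForm_expWave s hg hgc hf]
  refine continuous_finsetSum _ fun a _ => Continuous.mul ?_
    (continuous_fourier (hg.mul (contDiff_pdIter hf1 _))
      (hasCompactSupport_mul_of_timeCompact hgc (hR.pdIter _)))
  exact continuous_const.mul (continuous_finsetProd _ fun μ _ => Continuous.pow
    (continuous_const.mul (Complex.continuous_ofReal.comp (continuous_apply μ))) _)

/-- Collects the coefficients `n` into the polarization of one wave, so that conservation of the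
current can be applied to the sum; the single summands are not conserved. -/
lemma sum_mul_chargeForm {g : Fun} (hg : ContDiff ℝ ∞ g) (hgc : TimeCompact g) {h : I → Fun}
    (hh : ∀ i, SpatiallyCompact (h i)) (n : I → ℂ) {u : Fun} (hu : ContDiff ℝ ∞ u) :
    ∑ i, ∑ c, n c * chargeForm s g i c (h i) u =
      ∫ x, g x * currentForm s 0 h (fun c => n c • u) x := by
  have hn : ∀ c, ContDiff ℝ ∞ (n c • u) := fun c => contDiff_const.smul hu
  simp only [currentForm, Finset.sum_apply, Finset.mul_sum]
  rw [integral_finsetSum _ fun i _ => integrable_finsetSum _ fun c _ =>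
    integrable_mul_biDiffOp hg hgc (hh i) _ (hn c)]
  refine Finset.sum_congr rfl fun i _ => ?_
  rw [integral_finsetSum _ fun c _ => integrable_mul_biDiffOp hg hgc (hh i) _ (hn c)]
  refine Finset.sum_congr rfl fun c _ => ?_
  rw [chargeForm, ← integral_const_mul]
  refine integral_congr_ae (Eventually.of_forall fun x => ?_)
  simp only [biDiffOp_smul_right hu, Pi.smul_apply, smul_eq_mul]
  ring

lemma chargeForm_add_left {g g' : Fun} (hg : ContDiff ℝ ∞ g) (hgc : TimeCompact g)
    (hg' : ContDiff ℝ ∞ g') (hgc' : TimeCompact g') {f : Fun}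
    (hf : SpatiallyCompact f) (i c : I) {u : Fun} (hu : ContDiff ℝ ∞ u) :
    chargeForm s (g + g') i c f u = chargeForm s g i c f u + chargeForm s g' i c f u := by
  simp only [chargeForm]
  rw [← integral_add (integrable_mul_biDiffOp hg hgc hf _ hu)
    (integrable_mul_biDiffOp hg' hgc' hf _ hu)]
  exact integral_congr_ae (Eventually.of_forall fun x => by simp only [Pi.add_apply]; ring)

end Charge

/-! ## The regularization of the charge -/

section Regulator

variable (ρ : Regulator)

/-- The time smearing `k(x⁰)` without a cutoff in space. -/
def Regulator.unbounded (x : Spacetime) : ℝ := ρ.k (x 0)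

/-- For R ≤ 0 the support condition forces k = 0, contradicting that its integral is one. -/
lemma Regulator.R_pos : 0 < ρ.R := by
  by_contra hR
  have : ρ.k = 0 := by
    ext t
    by_contra hk
    exact hR ((abs_nonneg t).trans_lt (ρ.k_support t hk))
  have h := ρ.k_integral
  simp [this] at h

lemma Regulator.k_eq_zero (t : ℝ) (ht : ρ.R ≤ |t|) : ρ.k t = 0 := by
  by_contra h
  exact absurd (ρ.k_support t h) (not_lt.2 ht)

lemma Regulator.exists_cutoff_bound : ∃ A : ℝ, ∀ y, |ρ.h y - 1| ≤ A := by
  obtain ⟨C, hC⟩ := ρ.h_compact.exists_bound_of_continuous ρ.h_smooth.continuous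
  refine ⟨C + 1, fun y => (abs_sub _ _).trans ?_⟩
  have := hC y
  rw [Real.norm_eq_abs] at this
  simpa using this

/-- The scaled time smearing `k_ε(t) = ε k(ε t)`. -/
def Regulator.timeScaled (ε t : ℝ) : ℝ := ε * ρ.k (ε * t)

/-- The cutoff error `k_ε(x⁰) (h_ε(x) - 1)`. -/
def Regulator.error (ε : ℝ) : Fun :=
  (ε : ℂ) • (timeFun (fun t => ρ.k (ε * t)) * spaceCutoff ρ.h ε)

/-- Writing h = 1 + (h - 1) separates the charge without spatial cutoff from an error supported at
distance of order 1/ε. -/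
lemma Regulator.scaled_eq (ε : ℝ) : (fun x => ((ρ.scaled ε x : ℝ) : ℂ)) =
    timeFun (ρ.timeScaled ε) + ρ.error ε := by
  ext x
  simp only [Regulator.scaled, Regulator.timeScaled, Regulator.error, timeFun, spaceCutoff,
    Pi.add_apply, Pi.smul_apply, Pi.mul_apply, smul_eq_mul]
  push_cast
  ring

lemma Regulator.contDiff_timeScaled (ε : ℝ) : ContDiff ℝ ∞ (ρ.timeScaled ε) :=
  contDiff_const.mul (ρ.k_smooth.comp (contDiff_const.mul contDiff_id))

lemma Regulator.hasCompactSupport_timeScaled {ε : ℝ} (hε : 0 < ε) :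
    HasCompactSupport (ρ.timeScaled ε) := by
  refine HasCompactSupport.intro (isCompact_closedBall (0 : ℝ) (ρ.R / ε)) fun t ht => ?_
  rw [Metric.mem_closedBall, dist_zero_right, Real.norm_eq_abs, not_le, div_lt_iff₀ hε] at ht
  rw [Regulator.timeScaled, ρ.k_eq_zero, mul_zero]
  rw [abs_mul, abs_of_pos hε]
  linarith

lemma Regulator.integral_timeScaled {ε : ℝ} (hε : 0 < ε) : ∫ t, ρ.timeScaled ε t = 1 := by
  simp only [Regulator.timeScaled]
  rw [integral_const_mul, Measure.integral_comp_mul_left, ρ.k_integral, abs_of_pos (by positivity)]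
  simp [hε.ne']

lemma Regulator.contDiff_error (ε : ℝ) : ContDiff ℝ ∞ (ρ.error ε) :=
  contDiff_const.smul ((contDiff_timeFun (ρ.k_smooth.comp (contDiff_const.mul contDiff_id))).mul
    (contDiff_spaceCutoff ρ.h_smooth ε))

lemma Regulator.timeCompact_error {ε : ℝ} (hε : 0 < ε) : TimeCompact (ρ.error ε) := by
  refine ⟨ρ.R / ε, fun x hx => ?_⟩
  rw [div_lt_iff₀ hε] at hx
  have : ρ.k (ε * x 0) = 0 := ρ.k_eq_zero _ (by rw [abs_mul, abs_of_pos hε]; linarith)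
  simp [Regulator.error, timeFun, this]

lemma Regulator.contDiff_scaled (ε : ℝ) : ContDiff ℝ ∞ fun x => ((ρ.scaled ε x : ℝ) : ℂ) := by
  rw [ρ.scaled_eq]
  exact (contDiff_timeFun (ρ.contDiff_timeScaled ε)).add (ρ.contDiff_error ε)

lemma Regulator.hasCompactSupport_scaled_one :
    HasCompactSupport fun x => ((ρ.scaled 1 x : ℝ) : ℂ) := by
  obtain ⟨r, hr⟩ := ρ.h_compact.isBounded.subset_closedBall (0 : Fin 3 → ℝ)
  refine HasCompactSupport.intro (isCompact_closedBall (0 : Spacetime) (max ρ.R r)) fun x hx => ?_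
  by_contra hne
  have hne' : ρ.k (x 0) ≠ 0 ∧ ρ.h (fun i => x i.succ) ≠ 0 := by
    simpa [Regulator.scaled] using hne
  refine hx ?_
  rw [Metric.mem_closedBall, dist_zero_right]
  have hR := ρ.R_pos
  refine (pi_norm_le_iff_of_nonneg (hR.le.trans (le_max_left _ _))).2 fun μ => ?_
  refine Fin.cases ?_ (fun l => ?_) μ
  · exact (ρ.k_support _ hne'.1).le.trans (le_max_left _ _)
  · have h1 := hr (subset_tsupport _ (Function.mem_support.2 hne'.2))
    rw [Metric.mem_closedBall, dist_zero_right] at h1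
    exact ((norm_le_pi_norm (fun i => x (Fin.succ i)) l).trans h1).trans (le_max_right _ _)

/-- The Fourier transform of the scaled regulator. -/
lemma Regulator.fourier_scaled {ε : ℝ} (hε : 0 < ε) (k : Spacetime) :
    ∫ x, ((ρ.scaled ε x : ℝ) : ℂ) * expWave k x =
      ((ε ^ 3)⁻¹ : ℝ) * ∫ x, ((ρ.scaled 1 x : ℝ) : ℂ) * expWave (ε⁻¹ • k) x := by
  have h := Measure.integral_comp_smul (volume : Measure Spacetime)
    (fun x => ((ρ.scaled 1 x : ℝ) : ℂ) * expWave (ε⁻¹ • k) x) ε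
  have h1 : ∀ x, ((ρ.scaled ε x : ℝ) : ℂ) * expWave k x =
      (ε : ℂ) * (((ρ.scaled 1 (ε • x) : ℝ) : ℂ) * expWave (ε⁻¹ • k) (ε • x)) := fun x => by
    have h2 : expWave (ε⁻¹ • k) (ε • x) = expWave k x := by
      simp only [expWave, Pi.smul_apply, smul_eq_mul]
      congr 4
      ext μ
      field_simp
    rw [h2]
    simp [Regulator.scaled]
    ring
  simp only [h1]
  rw [integral_const_mul, h, Module.finrank_fin_fun, abs_of_pos (by positivity),
    Complex.real_smul, ← mul_assoc]
  congr 1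
  push_cast
  field_simp

end Regulator

/-! ### Limits of charge integrals over the mass shells. -/

section Limits

variable {I : Type*} [Fintype I] [DecidableEq I] {T : FreeTheory I} (s : FreeBRS T)
  (ρ : Regulator)

lemma iterate_pd_kleinGordon {m : ℝ} {f : Fun} (hf : ContDiff ℝ ∞ f)
    (hkg : diffOp (kleinGordon m) f = 0) (μ : Fin 4) (n : ℕ) :
    diffOp (kleinGordon m) ((pd μ)^[n] f) = 0 := by
  induction n with
  | zero => exact hkg
  | succ n ih =>
    rw [Function.iterate_succ_apply']
    exact pd_kleinGordon (contDiff_iterate_pd hf μ n) ih μ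

lemma pdIter_kleinGordon {m : ℝ} {f : Fun} (hf : ContDiff ℝ ∞ f)
    (hkg : diffOp (kleinGordon m) f = 0) (a : Fin 4 → ℕ) :
    diffOp (kleinGordon m) (pdIter a f) = 0 := by
  have h3 := contDiff_iterate_pd hf 3 (a 3)
  have h2 := contDiff_iterate_pd h3 2 (a 2)
  have h1 := contDiff_iterate_pd h2 1 (a 1)
  exact iterate_pd_kleinGordon h1 (iterate_pd_kleinGordon h2 (iterate_pd_kleinGordon h3
    (iterate_pd_kleinGordon hf hkg 3 _) 2 _) 1 _) 0 _

/-! ## The limit of the terms with one contraction -/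

lemma Solution.coneSupported (h : Solution T) : ∃ R, ∀ i, ConeSupported R (h.val i) := by
  obtain ⟨R, hR⟩ := h.compactData
  refine ⟨R, fun i x hx => ?_⟩
  by_contra hne
  exact absurd (hR i x hne) (not_le.2 hx)

lemma rapidDecay_chargeForm_error (h : Solution T) (i c : I) {α : Type*} {w ε : α → ℝ}
    {κ : α → Spacetime} (hκ : ShellFamily w κ) (hε : ∀ a, 0 < ε a) (hε1 : ∀ a, ε a ≤ 1) :
    RapidDecay w ε fun a => chargeForm s (ρ.error (ε a)) i c (h.val i) (expWave (κ a)) := by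
  obtain ⟨R, hR⟩ := h.coneSupported
  obtain ⟨A, hA⟩ := ρ.exists_cutoff_bound
  have hform : ∀ a, chargeForm s (ρ.error (ε a)) i c (h.val i) (expWave (κ a)) = _ := fun a =>
    chargeForm_expWave s (ρ.contDiff_error _) (ρ.timeCompact_error (hε a))
      (h.spatiallyCompact i) i c (κ a)
  simp only [hform]
  refine RapidDecay.sum hκ.one_le (fun a => (hε a).le) _ fun b _ => ?_
  refine RapidDecay.polyBound_mul hκ.one_le (hκ.polyBound_prod _ _) ?_
  refine RapidDecay.of_pow_mul_le (t := fun a => |κ a 0|) (fun a => abs_nonneg _)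
    (fun a => zero_le_one.trans (hκ.one_le a)) hκ.le_frequency fun M => ?_
  -- Order N = 0 suffices: the factor ε of the claim already comes from the normalization k_ε(t) = ε
  -- k(ε t).
  obtain ⟨C, hC, hb⟩ := exists_cutoffError_decay ρ.R_pos ρ.h_smooth hA ρ.h_eq_one M 0 ρ.k_smooth
    ρ.k_eq_zero (contDiff_pdIter (h.smooth i) fun μ => b (Sum.inl μ)) ((hR i).pdIter _)
    (pdIter_kleinGordon (h.smooth i) (h.kleinGordon i) _)
  refine ⟨C, hC, fun a => ?_⟩
  have heq : ∫ x, (ρ.error (ε a) * pdIter (fun μ => b (Sum.inl μ)) (h.val i)) x *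
      expWave (κ a) x = (ε a : ℂ) * ∫ x, cutoffError ρ.k ρ.h (ε a)
        (pdIter (fun μ => b (Sum.inl μ)) (h.val i)) x * expWave (κ a) x := by
    rw [← integral_const_mul]
    refine integral_congr_ae (Eventually.of_forall fun x => ?_)
    simp only [Regulator.error, cutoffError, Pi.mul_apply, Pi.smul_apply, smul_eq_mul]
    ring
  have h1 := hb (ε a) (hε a) (hε1 a) (κ a)
  rw [heq, norm_mul, Complex.norm_real, Real.norm_of_nonneg (hε a).le]
  rw [pow_zero, mul_one] at h1
  calc _ = (|κ a 0| ^ M * ‖∫ x, cutoffError ρ.k ρ.h (ε a)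
        (pdIter (fun μ => b (Sum.inl μ)) (h.val i)) x * expWave (κ a) x‖) * ε a := by ring
    _ ≤ _ := mul_le_mul_of_nonneg_right h1 (hε a).le

/-- Charge conservation: the charge of two solutions does not depend on the smearing in time. -/
lemma sum_chargeForm_timeScaled (h : Solution T) {ε : ℝ} (hε : 0 < ε) (n : I → ℂ) (k : Spacetime)
    (hn : ∀ e, ∑ c, MvPolynomial.eval (symbolAt k) (eulerLagrange T.kind T.L e c) * n c = 0) :
    ∑ i, ∑ c, n c * chargeForm s (timeFun (ρ.timeScaled ε)) i c (h.val i) (expWave k) =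
      ∑ i, ∑ c, n c * chargeForm s (timeFun ρ.k) i c (h.val i) (expWave k) := by
  obtain ⟨R, hR⟩ := h.coneSupported
  have hu : ∀ c, ContDiff ℝ ∞ (n c • expWave k) := fun c => contDiff_const.smul (contDiff_expWave k)
  rw [sum_mul_chargeForm s (contDiff_timeFun (ρ.contDiff_timeScaled ε))
      (timeCompact_timeFun (ρ.hasCompactSupport_timeScaled hε)) h.spatiallyCompact n
      (contDiff_expWave k),
    sum_mul_chargeForm s (contDiff_timeFun ρ.k_smooth) (timeCompact_timeFun ρ.k_compact)
      h.spatiallyCompact n (contDiff_expWave k)]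
  -- The plane wave is not spatially compact, but the current inherits the causal support of the
  -- solution `h`, and that is enough for conservation.
  have hcons := integral_timeFun_mul_current
    (j := fun μ => currentForm s μ h.val fun c => n c • expWave k)
    (fun μ => contDiff_currentForm s μ h.smooth hu)
    (fun μ => coneSupported_currentForm s μ hR _)
    (div_currentForm s h.smooth hu (fun i => by ext x; simpa using h.fieldEq i x) fun e => ?_)
    (ρ.contDiff_timeScaled ε) (ρ.hasCompactSupport_timeScaled hε) ρ.k_smooth ρ.k_compact
    ρ.k_integral
  · rw [ρ.integral_timeScaled hε, Complex.ofReal_one, one_mul] at hcons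
    exact hcons
  · have : ∀ c, diffOp (eulerLagrange T.kind T.L e c) (n c • expWave k) =
        (MvPolynomial.eval (symbolAt k) (eulerLagrange T.kind T.L e c) * n c) • expWave k := by
      intro c
      rw [diffOp_smul (contDiff_expWave k), diffOp_expWave, smul_smul, mul_comm]
      rfl
    simp only [this]
    rw [← Finset.sum_smul, hn e, zero_smul]

lemma integrable_shellSymbol_mul_chargeForm {g : Fun} (hg : ContDiff ℝ ∞ g) (hgc : TimeCompact g)
    {f : Fun} (hf : SpatiallyCompact f) (i c : I) {κ : (Fin 3 → ℝ) → Spacetime}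
    (hκc : Continuous κ) (hκ : ShellFamily (fun p => 1 + ‖p‖) κ) (P : DiffPoly) (m : ℝ)
    {G : (Fin 3 → ℝ) → ℂ} (hGc : Continuous G) (hG : PolyBound (fun p => 1 + ‖p‖) G) :
    Integrable fun p => shellSymbol P m p * (G p * chargeForm s g i c f (expWave (κ p))) :=
  integrable_shellSymbol_mul P m (hGc.mul ((continuous_chargeForm s hg hgc hf i c).comp hκc))
    ((rapidDecay_chargeForm s hg hgc hf i c hκ).polyBound_mul hκ.one_le hG)

/-- Treating ε in (0, 1] as an additional parameter of the family gives a bound by ε times one fixed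
integrable function, so the integral is of order ε. -/
lemma tendsto_integral_error (h : Solution T) (i c : I) {κ : (Fin 3 → ℝ) → Spacetime}
    (hκ : ShellFamily (fun p => 1 + ‖p‖) κ) (P : DiffPoly) (m : ℝ)
    {G : (Fin 3 → ℝ) → ℂ} (hG : PolyBound (fun p => 1 + ‖p‖) G) :
    Tendsto (fun ε => ∫ p, shellSymbol P m p *
      (G p * chargeForm s (ρ.error ε) i c (h.val i) (expWave (κ p)))) (𝓝[>] (0 : ℝ)) (𝓝 0) := by
  have hκ' := hκ.comp (Prod.snd : Set.Ioc (0 : ℝ) 1 × (Fin 3 → ℝ) → _)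
  have hG' : PolyBound (fun a : Set.Ioc (0 : ℝ) 1 × (Fin 3 → ℝ) => 1 + ‖a.2‖) fun a => G a.2 := by
    obtain ⟨C, M, hC, hb⟩ := hG
    exact ⟨C, M, hC, fun a => hb a.2⟩
  obtain ⟨C, hC, hb⟩ := exists_bound_shellSymbol_mul Prod.snd P m
    ((rapidDecay_chargeForm_error s ρ h i c hκ' (ε := fun a => (a.1 : ℝ)) (fun a => a.1.2.1)
      (fun a => a.1.2.2)).polyBound_mul hκ'.one_le hG')
  have hlim : Tendsto (fun ε : ℝ => C * ε * ∫ p, shellBound p) (𝓝[>] (0 : ℝ)) (𝓝 0) := by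
    have : Tendsto (fun ε : ℝ => C * ε * ∫ p, shellBound p) (𝓝 0)
        (𝓝 (C * 0 * ∫ p, shellBound p)) :=
      ((continuous_const.mul continuous_id).mul continuous_const).tendsto 0
    simpa using this.mono_left nhdsWithin_le_nhds
  refine squeeze_zero_norm' ?_ hlim
  filter_upwards [Ioc_mem_nhdsGT (zero_lt_one : (0 : ℝ) < 1)] with ε hε
  rw [← integral_const_mul]
  refine norm_integral_le_of_norm_le (integrable_shellBound.const_mul _) ?_
  filter_upwards [ae_ne_zero] with p hp
  exact hb (⟨ε, hε⟩, p) hp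

/-- In the limit, the cutoff in space can be removed from the contraction of the charge with a
solution and a plane wave solution. -/
lemma tendsto_sum_integral_chargeForm (h : Solution T) {κ : (Fin 3 → ℝ) → Spacetime}
    (hκc : Continuous κ) (hκ : ShellFamily (fun p => 1 + ‖p‖) κ) (n : I → DiffPoly) (m : ℝ)
    (hn : ∀ e p, ∑ c, MvPolynomial.eval (symbolAt (κ p)) (eulerLagrange T.kind T.L e c) *
      MvPolynomial.eval (symbolAt (shellMomentum m p)) (n c) = 0)
    {G : (Fin 3 → ℝ) → ℂ} (hGc : Continuous G) (hG : PolyBound (fun p => 1 + ‖p‖) G) :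
    Tendsto (fun ε => ∑ i, ∑ c, ∫ p, shellSymbol (n c) m p *
      (G p * chargeForm s (fun x => (ρ.scaled ε x : ℂ)) i c (h.val i) (expWave (κ p))))
      (𝓝[>] (0 : ℝ)) (𝓝 (∑ i, ∑ c, ∫ p, shellSymbol (n c) m p *
        (G p * chargeForm s (timeFun ρ.k) i c (h.val i) (expWave (κ p))))) := by
  have herr := tendsto_finsetSum Finset.univ fun i _ => tendsto_finsetSum Finset.univ fun c _ =>
    tendsto_integral_error s ρ h i c hκ (n c) m hG
  simp only [Finset.sum_const_zero] at herr
  have hmain := herr.const_add (∑ i, ∑ c, ∫ p, shellSymbol (n c) m p *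
        (G p * chargeForm s (timeFun ρ.k) i c (h.val i) (expWave (κ p))))
  rw [add_zero] at hmain
  refine hmain.congr' ?_
  filter_upwards [self_mem_nhdsWithin] with ε (hε : 0 < ε)
  have hint : ∀ {g : Fun}, ContDiff ℝ ∞ g → TimeCompact g → ∀ i c, Integrable fun p =>
      shellSymbol (n c) m p * (G p * chargeForm s g i c (h.val i) (expWave (κ p))) :=
    fun hg hgc i c => integrable_shellSymbol_mul_chargeForm s hg hgc (h.spatiallyCompact i) i c
      hκc hκ (n c) m hGc hG
  have hts := contDiff_timeFun (ρ.contDiff_timeScaled ε)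
  have htc := timeCompact_timeFun (ρ.hasCompactSupport_timeScaled hε)
  -- Conservation holds pointwise in `p` for the sum over all indices, so the sums are moved under
  -- the integral and the common factor 1/ω is split off.
  have hswap : ∀ {g : Fun}, ContDiff ℝ ∞ g → TimeCompact g →
      ∑ i, ∑ c, ∫ p, shellSymbol (n c) m p * (G p * chargeForm s g i c (h.val i) (expWave (κ p))) =
      ∫ p, (G p / (((2 * Real.pi) ^ 3 * (2 * energy m p) : ℝ) : ℂ)) *
        ∑ i, ∑ c, MvPolynomial.eval (symbolAt (shellMomentum m p)) (n c) *
          chargeForm s g i c (h.val i) (expWave (κ p)) := by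
    intro g hg hgc
    simp only [← integral_finsetSum _ fun c _ => hint hg hgc _ c]
    rw [← integral_finsetSum _ fun i _ => integrable_finsetSum _ fun c _ => hint hg hgc i c]
    refine integral_congr_ae (Eventually.of_forall fun p => ?_)
    simp only [Finset.mul_sum, shellSymbol]
    exact Finset.sum_congr rfl fun i _ => Finset.sum_congr rfl fun c _ => by ring
  have hcons : ∑ i, ∑ c, ∫ p, shellSymbol (n c) m p *
        (G p * chargeForm s (timeFun ρ.k) i c (h.val i) (expWave (κ p))) =
      ∑ i, ∑ c, ∫ p, shellSymbol (n c) m p *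
        (G p * chargeForm s (timeFun (ρ.timeScaled ε)) i c (h.val i) (expWave (κ p))) := by
    rw [hswap hts htc,
      hswap (contDiff_timeFun ρ.k_smooth) (timeCompact_timeFun ρ.k_compact)]
    refine integral_congr_ae (Eventually.of_forall fun p => ?_)
    simp only
    rw [sum_chargeForm_timeScaled s ρ h hε _ (κ p) fun e => hn e p]
  rw [hcons, ← Finset.sum_add_distrib]
  refine Finset.sum_congr rfl fun i _ => ?_
  rw [← Finset.sum_add_distrib]
  refine Finset.sum_congr rfl fun c _ => ?_
  rw [← integral_add (hint hts htc i c) (hint (ρ.contDiff_error ε) (ρ.timeCompact_error hε) i c)]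
  refine integral_congr_ae (Eventually.of_forall fun p => ?_)
  simp only
  rw [ρ.scaled_eq, chargeForm_add_left s hts htc (ρ.contDiff_error ε) (ρ.timeCompact_error hε)
    (h.spatiallyCompact i) i c (contDiff_expWave _)]
  ring

/-! ## The limit of the terms with two contractions -/

lemma biDiffOp_expWave_expWave (B : BiDiffPoly) (k k' x : Spacetime) :
    biDiffOp B (expWave k) (expWave k') x = (∑ a ∈ B.support,
      (B.coeff a * ∏ μ, (Complex.I * (k' μ : ℂ)) ^ a (Sum.inr μ)) *
        ∏ μ, (Complex.I * (k μ : ℂ)) ^ a (Sum.inl μ)) * expWave (k + k') x := by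
  rw [biDiffOp_expWave, Finset.sum_mul]
  refine Finset.sum_congr rfl fun a _ => ?_
  rw [pdIter_expWave, expWave_add, Pi.smul_apply, smul_eq_mul]
  ring

/-- Rapid decay of the regulator's Fourier transform at (κ₀ + κ₁)/ε controls both momenta at once,
because `hfreq` excludes cancellation of the frequencies. Powers of ε: -3 from the regulator, -2
from the two factors 1/‖p‖, and +6 from rescaling the two integrals. -/
lemma tendsto_integral_two_waves (i j : I) (P : Fin 2 → DiffPoly) (m : Fin 2 → ℝ)
    {κ : Fin 2 → (Fin 3 → ℝ) → Spacetime} (hκ : ∀ k, ShellFamily (fun p => 1 + ‖p‖) (κ k))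
    (hfreq : ∀ p : Fin 2 → Fin 3 → ℝ, ‖p 0‖ + ‖p 1‖ ≤ |κ 0 (p 0) 0 + κ 1 (p 1) 0|)
    {G : (Fin 2 → Fin 3 → ℝ) → ℂ} (hG : PolyBound (fun p => 1 + ‖p‖) G) :
    Tendsto (fun ε => ∫ p : Fin 2 → Fin 3 → ℝ, (∏ k, shellSymbol (P k) (m k) (p k)) *
      (G p * chargeForm s (fun x => (ρ.scaled ε x : ℂ)) i j (expWave (κ 0 (p 0)))
        (expWave (κ 1 (p 1))))) (𝓝[>] (0 : ℝ)) (𝓝 0) := by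
  set α := Set.Ioc (0 : ℝ) 1 × (Fin 2 → Fin 3 → ℝ) with hα
  -- The weight grows with p/ε, the scale on which the regulator decays. Since ε ≤ 1 it also
  -- dominates 1 + ‖p‖, so polynomial factors in `p` are harmless.
  set w : α → ℝ := fun a => 1 + (a.1 : ℝ)⁻¹ * (‖a.2 0‖ + ‖a.2 1‖) with hw
  have hε0 : ∀ a : α, 0 < (a.1 : ℝ) := fun a => a.1.2.1
  have hinv : ∀ a : α, 1 ≤ (a.1 : ℝ)⁻¹ := fun a => (one_le_inv₀ (hε0 a)).2 a.1.2.2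
  have hw1 : ∀ a, 1 ≤ w a := fun a => by
    have : 0 ≤ (a.1 : ℝ)⁻¹ * (‖a.2 0‖ + ‖a.2 1‖) := mul_nonneg (inv_nonneg.2 (hε0 a).le)
      (by positivity)
    simp only [hw]; linarith
  have hwk' : ∀ (a : α) k, 1 + (a.1 : ℝ)⁻¹ * ‖a.2 k‖ ≤ w a := fun a k => by
    have h0 := mul_nonneg (inv_nonneg.2 (hε0 a).le) (norm_nonneg (a.2 0))
    have h1 := mul_nonneg (inv_nonneg.2 (hε0 a).le) (norm_nonneg (a.2 1))
    simp only [hw, mul_add]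
    fin_cases k
    · simp only [Fin.zero_eta]; linarith
    · simp only [Fin.mk_one]; linarith
  have hwk : ∀ (a : α) k, 1 + ‖a.2 k‖ ≤ 1 * w a := fun a k => by
    have := le_mul_of_one_le_left (norm_nonneg (a.2 k)) (hinv a)
    linarith [hwk' a k]
  have hcomp : ∀ (k : Fin 2) {φ : (Fin 3 → ℝ) → ℂ}, PolyBound (fun p => 1 + ‖p‖) φ →
      PolyBound w fun a => φ (a.2 k) := fun k φ hφ =>
    hφ.comp (fun b => by positivity) zero_le_one (fun a => hwk a k)
  have hGw : PolyBound w fun a => G a.2 := by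
    refine hG.comp (fun b => by positivity) zero_le_one fun a => ?_
    have : ‖a.2‖ ≤ w a - 1 := (pi_norm_le_iff_of_nonneg (by linarith [hw1 a])).2 fun k => by
      linarith [hwk a k]
    linarith
  set K : α → Spacetime := fun a => (a.1 : ℝ)⁻¹ • (κ 0 (a.2 0) + κ 1 (a.2 1)) with hK
  have hdecay : RapidDecay w (fun _ => 1) fun a =>
      ∫ x, ((ρ.scaled 1 x : ℝ) : ℂ) * expWave (K a) x := by
    refine RapidDecay.of_pow_mul_le (t := fun a => |K a 0|) (fun a => abs_nonneg _)
      (fun a => zero_le_one.trans (hw1 a)) (fun a => ?_) fun M => ?_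
    · simp only [hw, hK, Pi.smul_apply, Pi.add_apply, smul_eq_mul, abs_mul,
        abs_of_pos (inv_pos.2 (hε0 a))]
      have := mul_le_mul_of_nonneg_left (hfreq a.2) (inv_nonneg.2 (hε0 a).le)
      linarith
    · obtain ⟨C, hC, h⟩ := exists_fourier_decay (ρ.contDiff_scaled 1)
        ρ.hasCompactSupport_scaled_one M
      exact ⟨C, hC, fun a => by simpa using h (K a)⟩
  have hpoly : PolyBound w fun a => (∏ k, MvPolynomial.eval
      (symbolAt (shellMomentum (m k) (a.2 k))) (P k)) * (G a.2 *
      ∑ b ∈ (Quad.symm T.kind (s.current 0) i j).support,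
      ((Quad.symm T.kind (s.current 0) i j).coeff b *
        ∏ μ, (Complex.I * (κ 1 (a.2 1) μ : ℂ)) ^ b (Sum.inr μ)) *
        ∏ μ, (Complex.I * (κ 0 (a.2 0) μ : ℂ)) ^ b (Sum.inl μ)) := by
    refine PolyBound.mul (PolyBound.prod _ fun k _ => hcomp k
      ((shellFamily_shellMomentum (m k)).polyBound_eval (P k))) (hGw.mul ?_)
    refine PolyBound.sum hw1 _ fun b _ => PolyBound.mul (hcomp 1 ((hκ 1).polyBound_prod _ _))
      ?_
    simpa only [one_mul] using hcomp 0 ((hκ 0).polyBound_prod 1 fun μ => b (Sum.inl μ))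
  -- Eight powers of the joint weight, four for each of the two momenta, as `shellBound` requires.
  obtain ⟨C, hC, hb⟩ := (hdecay.polyBound_mul hw1 hpoly).norm_le hw1 8
  set J := ∫ p, shellBound p with hJ
  have hlim : Tendsto (fun ε : ℝ => C * J ^ 2 * ε) (𝓝[>] (0 : ℝ)) (𝓝 0) := by
    have : Tendsto (fun ε : ℝ => C * J ^ 2 * ε) (𝓝 0) (𝓝 (C * J ^ 2 * 0)) :=
      (continuous_const.mul continuous_id).tendsto 0
    simpa using this.mono_left nhdsWithin_le_nhds
  refine squeeze_zero_norm' ?_ hlim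
  filter_upwards [Ioc_mem_nhdsGT (zero_lt_one : (0 : ℝ) < 1)] with ε hε
  have hεpos : 0 < ε := hε.1
  have hform : ∀ p : Fin 2 → Fin 3 → ℝ, chargeForm s (fun x => (ρ.scaled ε x : ℂ)) i j
      (expWave (κ 0 (p 0))) (expWave (κ 1 (p 1))) = ((ε ^ 3)⁻¹ : ℝ) *
      ((∑ b ∈ (Quad.symm T.kind (s.current 0) i j).support,
      ((Quad.symm T.kind (s.current 0) i j).coeff b *
        ∏ μ, (Complex.I * (κ 1 (p 1) μ : ℂ)) ^ b (Sum.inr μ)) *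
        ∏ μ, (Complex.I * (κ 0 (p 0) μ : ℂ)) ^ b (Sum.inl μ)) *
        ∫ x, ((ρ.scaled 1 x : ℝ) : ℂ) * expWave (K (⟨ε, hε⟩, p)) x) := by
    intro p
    have := ρ.fourier_scaled hεpos (κ 0 (p 0) + κ 1 (p 1))
    simp only [chargeForm, biDiffOp_expWave_expWave]
    rw [mul_left_comm, ← this, ← integral_const_mul]
    exact integral_congr_ae (Eventually.of_forall fun x => by simp only; ring)
  have hbound : ∀ p : Fin 2 → Fin 3 → ℝ, (∀ k, p k ≠ 0) →
      ‖(∏ k, shellSymbol (P k) (m k) (p k)) *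
      (G p * chargeForm s (fun x => (ρ.scaled ε x : ℂ)) i j (expWave (κ 0 (p 0)))
        (expWave (κ 1 (p 1))))‖ ≤ (ε ^ 3)⁻¹ * (C * (ε⁻¹ ^ 2 * ∏ k, shellBound (ε⁻¹ • p k))) := by
    intro p hp
    have h1 : ‖∏ k, shellSymbol (P k) (m k) (p k)‖ ≤ (∏ k, ‖p k‖⁻¹) * ‖∏ k, MvPolynomial.eval
      (symbolAt (shellMomentum (m k) (p k))) (P k)‖ := by
      rw [norm_prod, norm_prod, ← Finset.prod_mul_distrib]
      exact Finset.prod_le_prod (fun _ _ => norm_nonneg _)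
        fun k _ => norm_shellSymbol_le (P k) (m k) (hp k)
    have h2 := hb (⟨ε, hε⟩, p)
    have h3 : (w (⟨ε, hε⟩, p) ^ 8)⁻¹ ≤ ∏ k, ((1 + ε⁻¹ * ‖p k‖) ^ 4)⁻¹ := by
      rw [Finset.prod_inv_distrib]
      have hpos : ∀ k, 0 < 1 + ε⁻¹ * ‖p k‖ := fun k => by positivity
      refine inv_anti₀ (Finset.prod_pos fun k _ => pow_pos (hpos k) 4) ?_
      calc ∏ k, (1 + ε⁻¹ * ‖p k‖) ^ 4 ≤ ∏ _k : Fin 2, w (⟨ε, hε⟩, p) ^ 4 :=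
            Finset.prod_le_prod (fun k _ => pow_nonneg (hpos k).le _) fun k _ =>
              pow_le_pow_left₀ (hpos k).le (hwk' (⟨ε, hε⟩, p) k) 4
        _ = _ := by simp; ring
    have h4 : (∏ k, ‖p k‖⁻¹) * ∏ k, ((1 + ε⁻¹ * ‖p k‖) ^ 4)⁻¹ =
        ε⁻¹ ^ 2 * ∏ k, shellBound (ε⁻¹ • p k) := by
      have : ∀ k, ‖p k‖⁻¹ * ((1 + ε⁻¹ * ‖p k‖) ^ 4)⁻¹ = ε⁻¹ * shellBound (ε⁻¹ • p k) := fun k => by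
        rw [shellBound, norm_smul, Real.norm_of_nonneg (inv_nonneg.2 hεpos.le), mul_inv, inv_inv,
          ← mul_assoc, ← mul_assoc, inv_mul_cancel₀ hεpos.ne', one_mul]
      rw [← Finset.prod_mul_distrib, Finset.prod_congr rfl fun k _ => this k,
        Finset.prod_mul_distrib]
      simp
    rw [← h4, hform p]
    have hε3 : ‖(((ε ^ 3)⁻¹ : ℝ) : ℂ)‖ = (ε ^ 3)⁻¹ := by
      rw [Complex.norm_real, Real.norm_of_nonneg (by positivity)]
    simp only [norm_mul] at h2 ⊢
    rw [hε3]
    set S := ‖∑ b ∈ (Quad.symm T.kind (s.current 0) i j).support,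
      ((Quad.symm T.kind (s.current 0) i j).coeff b *
        ∏ μ, (Complex.I * (κ 1 (p 1) μ : ℂ)) ^ b (Sum.inr μ)) *
        ∏ μ, (Complex.I * (κ 0 (p 0) μ : ℂ)) ^ b (Sum.inl μ)‖
    set Z := ‖∫ x, ((ρ.scaled 1 x : ℝ) : ℂ) * expWave (K (⟨ε, hε⟩, p)) x‖
    set E := ‖∏ k, MvPolynomial.eval (symbolAt (shellMomentum (m k) (p k))) (P k)‖
    have hprod : 0 ≤ ∏ k, ‖p k‖⁻¹ := Finset.prod_nonneg fun k _ => by positivity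
    calc ‖∏ k, shellSymbol (P k) (m k) (p k)‖ * (‖G p‖ * ((ε ^ 3)⁻¹ * (S * Z)))
        ≤ ((∏ k, ‖p k‖⁻¹) * E) * (‖G p‖ * ((ε ^ 3)⁻¹ * (S * Z))) :=
          mul_le_mul_of_nonneg_right h1 (by positivity)
      _ = (ε ^ 3)⁻¹ * ((∏ k, ‖p k‖⁻¹) * (E * (‖G p‖ * S) * Z)) := by ring
      _ ≤ (ε ^ 3)⁻¹ * ((∏ k, ‖p k‖⁻¹) * (C * 1 * ∏ k, ((1 + ε⁻¹ * ‖p k‖) ^ 4)⁻¹)) := by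
          refine mul_le_mul_of_nonneg_left (mul_le_mul_of_nonneg_left (h2.trans ?_) hprod)
            (by positivity)
          exact mul_le_mul_of_nonneg_left h3 (by positivity)
      _ = _ := by ring
  have hint : Integrable fun p : Fin 2 → Fin 3 → ℝ =>
      (ε ^ 3)⁻¹ * (C * (ε⁻¹ ^ 2 * ∏ k, shellBound (ε⁻¹ • p k))) :=
    (((Integrable.fintype_prod fun _ : Fin 2 => integrable_shellBound_smul hεpos).const_mul
      _).const_mul _).const_mul _
  refine (norm_integral_le_of_norm_le hint ?_).trans_eq ?_
  · have hae : ∀ k, ∀ᵐ p : Fin 2 → Fin 3 → ℝ, p k ≠ 0 := fun k =>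
      (Measure.quasiMeasurePreserving_eval (fun _ : Fin 2 => (volume : Measure (Fin 3 → ℝ)))
        k).ae ae_ne_zero
    filter_upwards [ae_all_iff.2 hae] with p hp using hbound p hp
  · rw [integral_const_mul, integral_const_mul, integral_const_mul,
      integral_fintype_prod_volume_eq_prod fun (_ : Fin 2) (q : Fin 3 → ℝ) =>
        shellBound (ε⁻¹ • q)]
    simp only [integral_shellBound_smul hεpos, Finset.prod_const, Finset.card_univ,
      Fintype.card_fin]
    rw [hJ]
    field_simp

end Limits

/-! ## Sums over decompositions and restrictions of families -/

section Families

lemma tendsto_splitSum {X β : Type*} (kX : X → FieldKind) {f : Filter β}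
    {Φ : β → List X → List X → ℂ} {Ψ : List X → List X → ℂ} {l : List X}
    (h : ∀ A B, (A ++ B).Perm l → Tendsto (fun b => Φ b A B) f (𝓝 (Ψ A B))) :
    Tendsto (fun b => splitSum kX (Φ b) l) f (𝓝 (splitSum kX Ψ l)) := by
  induction l generalizing Φ Ψ with
  | nil => simpa using h [] [] (List.Perm.refl _)
  | cons x l ih =>
    simp only [splitSum_cons]
    refine (ih fun A B hAB => h _ _ (hAB.cons x)).add (ih fun A B hAB => ?_)
    exact (h _ _ (List.perm_middle.trans (hAB.cons x))).const_mul _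

lemma integral_splitSum {X P : Type*} [MeasurableSpace P] {μ : Measure P} (kX : X → FieldKind)
    {Φ : P → List X → List X → ℂ} {l : List X}
    (h : ∀ A B, (A ++ B).Perm l → Integrable (fun p => Φ p A B) μ) :
    Integrable (fun p => splitSum kX (Φ p) l) μ ∧
      ∫ p, splitSum kX (Φ p) l ∂μ = splitSum kX (fun A B => ∫ p, Φ p A B ∂μ) l := by
  induction l generalizing Φ with
  | nil => simpa using h [] [] (List.Perm.refl _)
  | cons x l ih =>
    simp only [splitSum_cons]
    have h1 := ih (Φ := fun p A B => Φ p (x :: A) B) fun A B hAB => h _ _ (hAB.cons x)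
    have h2 := ih (Φ := fun p A B => exchList kX x A * Φ p A (x :: B)) fun A B hAB =>
      (h _ _ (List.perm_middle.trans (hAB.cons x))).const_mul _
    refine ⟨h1.1.add h2.1, ?_⟩
    rw [integral_add h1.1 h2.1, h1.2, h2.2]
    simp only [integral_const_mul]

variable {I : Type*} [Fintype I] [DecidableEq I] {T : FreeTheory I}

lemma tendsto_clRestrict {β : Type*} {f : Filter β} {F : β → ClFunctional I} {G : ClFunctional I}
    (h : ∀ legs, CompactLegs legs → Tendsto (fun b => F b legs) f (𝓝 (G legs)))
    (hs : List (Solution T)) :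
    Tendsto (fun b => clRestrict T (F b) hs) f (𝓝 (clRestrict T G hs)) := by
  induction hs generalizing F G with
  | nil => exact h [] fun x hx => by simp at hx
  | cons x hs ih =>
    simp only [clRestrict]
    exact tendsto_finsetSum _ fun i _ => ih fun legs hl => h _ (hl.cons (x.spatiallyCompact i))

end Families

/-! ## Ghost parity -/

section Parity

variable {I : Type*}

/-- The part of a functional with ghost parity `b`. -/
def clPart (kind : I → FieldKind) (b : ZMod 2) (F : ClFunctional I) : ClFunctional I :=
  fun legs => if ghostParity kind legs = b then F legs else 0

lemma sum_clPart {E : Type*} [AddCommMonoid E] (kind : I → FieldKind) (F : ClFunctional I)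
    (legs : List (Leg I)) (Ψ : ZMod 2 → ℂ → E) (h0 : ∀ b, Ψ b 0 = 0) :
    ∑ b, Ψ b (clPart kind b F legs) = Ψ (ghostParity kind legs) (F legs) := by
  rw [Finset.sum_eq_single (ghostParity kind legs)]
  · simp [clPart]
  · intro b _ hb
    simp [clPart, Ne.symm hb, h0]
  · simp

lemma ghostParity_append (kind : I → FieldKind) (A B : List (Leg I)) :
    ghostParity kind (A ++ B) = ghostParity kind A + ghostParity kind B := by
  simp [ghostParity]

lemma ghostParity_cons (kind : I → FieldKind) (x : Leg I) (B : List (Leg I)) :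
    ghostParity kind (x :: B) = (kind x.1).ghostParity + ghostParity kind B := by
  simp [ghostParity]

end Parity

/-! ## Contractions -/

section Contraction

variable {I : Type*} [Fintype I] [DecidableEq I] (T : FreeTheory I)

lemma contraction_eq_splitSum (r : ℕ) (F G : ClFunctional I) (legs : List (Leg I)) :
    contraction T r F G legs = splitSum (fun x : Leg I => T.kind x.1) (fun A B =>
      (r.factorial : ℂ)⁻¹ * ∑ c : Fin r → I, ∑ d : Fin r → I, ∫ p : Fin r → Fin 3 → ℝ,
        (∏ k, twoPoint T (c k) (d k) (p k)) *
        F (A ++ List.ofFn fun k => (c k, planeWave (-1) (T.mass (c k)) (p k))) *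
        G ((List.ofFn fun k => (d k, planeWave 1 (T.mass (c k)) (p k))).reverse ++ B)) legs :=
  rfl

lemma contraction_zero (F G : ClFunctional I) (legs : List (Leg I)) :
    contraction T 0 F G legs =
      splitSum (fun x : Leg I => T.kind x.1) (fun A B => F A * G B) legs := by
  rw [contraction_eq_splitSum]
  refine splitSum_congr _ fun A B _ => ?_
  -- With no contraction the integral runs over a one-point space of mass one.
  have hv : (volume : Measure (Fin 0 → Fin 3 → ℝ)) = Measure.dirac default := by
    rw [volume_pi, Measure.pi_of_empty _ default]
  simp [hv]

/-- The integrand of the contraction of the leg `φ_c` of `F` with the leg `φ_d` of `G`. -/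
def pairIntegral (F G : ClFunctional I) (c d : I) (A B : List (Leg I)) : ℂ :=
  ∫ p : Fin 3 → ℝ, twoPoint T c d p * F (A ++ [(c, planeWave (-1) (T.mass c) p)]) *
    G ((d, planeWave 1 (T.mass c) p) :: B)

lemma contraction_one (F G : ClFunctional I) (legs : List (Leg I)) :
    contraction T 1 F G legs = splitSum (fun x : Leg I => T.kind x.1) (fun A B =>
      ∑ c, ∑ d, pairIntegral T F G c d A B) legs := by
  rw [contraction_eq_splitSum]
  refine splitSum_congr _ fun A B _ => ?_
  simp only [Nat.factorial_one, Nat.cast_one, inv_one, one_mul]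
  rw [← (Equiv.funUnique (Fin 1) I).sum_comp]
  refine Finset.sum_congr rfl fun c _ => ?_
  rw [← (Equiv.funUnique (Fin 1) I).sum_comp]
  refine Finset.sum_congr rfl fun d _ => ?_
  rw [pairIntegral, ← (volume_preserving_funUnique (Fin 1) (Fin 3 → ℝ)).integral_comp'
    (fun p : Fin 3 → ℝ => twoPoint T (Equiv.funUnique (Fin 1) I c) (Equiv.funUnique (Fin 1) I d) p *
      F (A ++ [(Equiv.funUnique (Fin 1) I c,
        planeWave (-1) (T.mass (Equiv.funUnique (Fin 1) I c)) p)]) *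
      G ((Equiv.funUnique (Fin 1) I d,
        planeWave 1 (T.mass (Equiv.funUnique (Fin 1) I c)) p) :: B))]
  refine integral_congr_ae (Eventually.of_forall fun p => ?_)
  simp [List.ofFn_succ]

lemma contraction_eq_zero_of_left {r : ℕ} {F : ClFunctional I}
    (hF : ∀ legs : List (Leg I), r ≤ legs.length → F legs = 0) (G : ClFunctional I) :
    contraction T r F G = 0 := by
  ext legs
  rw [contraction_eq_splitSum, splitSum_congr _ (Ψ := fun _ _ => 0), splitSum_zero]
  · rfl
  · intro A B _
    have h : ∀ L : Fin r → Leg I, F (A ++ List.ofFn L) = 0 := fun L => hF _ (by simp)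
    simp [h]

lemma contraction_eq_zero_of_right {r : ℕ} {G : ClFunctional I}
    (hG : ∀ legs : List (Leg I), r ≤ legs.length → G legs = 0) (F : ClFunctional I) :
    contraction T r F G = 0 := by
  ext legs
  rw [contraction_eq_splitSum, splitSum_congr _ (Ψ := fun _ _ => 0), splitSum_zero]
  · rfl
  · intro A B _
    have h : ∀ L : Fin r → Leg I, G ((List.ofFn L).reverse ++ B) = 0 := fun L => hG _ (by simp)
    simp [h]

/-- The term with `r` contractions of the graded commutator of the odd functional `Q` with `F`. -/
def oddComm (r : ℕ) (Q F : ClFunctional I) : ClFunctional I := fun legs =>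
  ∑ b : ZMod 2, (contraction T r Q (clPart T.kind b F) legs
    - paritySign b * contraction T r (clPart T.kind b F) Q legs)

/-- `Q` is odd with respect to the ghost parity. -/
def OddFunctional (Q : ClFunctional I) : Prop :=
  ∀ legs, ghostParity T.kind legs ≠ 1 → Q legs = 0

lemma contraction_zero_left (r : ℕ) (G : ClFunctional I) : contraction T r 0 G = 0 :=
  contraction_eq_zero_of_left T (fun _ _ => rfl) G

lemma contraction_zero_right (r : ℕ) (F : ClFunctional I) : contraction T r F 0 = 0 :=
  contraction_eq_zero_of_right T (fun _ _ => rfl) F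

lemma star_ofClassical_left (Q : ClFunctional I) (F : Functional I) (l : ℕ) :
    star T (ofClassical Q) F l =
      ∑ q ∈ Finset.HasAntidiagonal.antidiagonal l, contraction T q.1 Q (F q.2) := by
  refine Finset.sum_congr rfl fun q _ => ?_
  rw [Finset.sum_eq_single (0, q.2)]
  · simp [ofClassical]
  · rintro ⟨a, b⟩ hab hne
    have ha : a ≠ 0 := fun h => hne (by subst h; simpa using hab)
    simp [ofClassical, ha, contraction_zero_left]
  · intro h
    exact absurd (by simp) h

lemma star_ofClassical_right (Q : ClFunctional I) (F : Functional I) (l : ℕ) :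
    star T F (ofClassical Q) l =
      ∑ q ∈ Finset.HasAntidiagonal.antidiagonal l, contraction T q.1 (F q.2) Q := by
  refine Finset.sum_congr rfl fun q _ => ?_
  rw [Finset.sum_eq_single (q.2, 0)]
  · simp [ofClassical]
  · rintro ⟨a, b⟩ hab hne
    have hb : b ≠ 0 := fun h => hne (by subst h; simpa using hab)
    simp [ofClassical, hb, contraction_zero_right]
  · intro h
    exact absurd (by simp) h

variable {T}

lemma OddFunctional.parityPart_one {Q : ClFunctional I} (hQ : OddFunctional T Q) :
    parityPart T.kind 1 (ofClassical Q) = ofClassical Q := by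
  ext l legs
  simp only [parityPart, ofClassical]
  split_ifs with h1 h2 <;> first | rfl | (rw [hQ _ h1])

lemma OddFunctional.parityPart_zero {Q : ClFunctional I} (hQ : OddFunctional T Q) :
    parityPart T.kind 0 (ofClassical Q) = ofClassical 0 := by
  ext l legs
  simp only [parityPart, ofClassical]
  split_ifs with h1 h2
  · exact hQ _ (by rw [h1]; decide)
  all_goals rfl

/-- An odd charge contributes only its parity component 1, so the sign of the commutator depends on
the parity of `F` alone. The ħ-order is the number of contractions plus the order of the coefficient
of `F`. -/
lemma gradedComm_ofClassical {Q : ClFunctional I} (hQ : OddFunctional T Q) (F : Functional I)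
    (l : ℕ) (legs : List (Leg I)) : gradedComm T (ofClassical Q) F l legs =
      ∑ q ∈ Finset.HasAntidiagonal.antidiagonal l, oddComm T q.1 Q (F q.2) legs := by
  rw [gradedComm, Finset.sum_eq_single (1 : ZMod 2)]
  · simp only [hQ.parityPart_one, star_ofClassical_left, star_ofClassical_right, Finset.sum_apply,
      one_mul, oddComm]
    rw [Finset.sum_comm]
    refine Finset.sum_congr rfl fun b _ => ?_
    rw [Finset.mul_sum, ← Finset.sum_sub_distrib]
    rfl
  · intro a _ ha
    have ha : a = 0 := (zmod_two_cases a).resolve_right ha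
    subst ha
    simp [hQ.parityPart_zero, star_ofClassical_left, star_ofClassical_right,
      contraction_zero_left, contraction_zero_right]
  · simp

/-- The coefficient of ħ comes from zero or one contraction; the former vanishes, so the bracket is
i times the single contraction in each order. -/
lemma poisson_ofClassical {Q : ClFunctional I} (hQ : OddFunctional T Q)
    (h0 : ∀ F legs, oddComm T 0 Q F legs = 0) (F : Functional I)
    (l : ℕ) (legs : List (Leg I)) : poisson T (ofClassical Q) F l legs =
      Complex.I * oddComm T 1 Q (F l) legs := by
  rw [poisson, Finset.sum_eq_single (0, l)]
  · have h1 : ofClassical Q 0 = Q := rfl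
    simp only [clPoisson, h1, gradedComm_ofClassical hQ]
    rw [Finset.Nat.antidiagonal_succ]
    simp [h0, ofClassical]
  · rintro ⟨a, b⟩ hab hne
    have ha : a ≠ 0 := fun h => hne (by subst h; simpa using hab)
    have hz : OddFunctional T (0 : ClFunctional I) := fun _ _ => rfl
    have h1 : ofClassical Q a = 0 := by simp [ofClassical, ha]
    simp only [clPoisson, h1, gradedComm_ofClassical hz]
    simp [oddComm, contraction_zero_left, contraction_zero_right]
  · intro h
    exact absurd (by simp) h

lemma oddComm_zero_apply (Q F : ClFunctional I) (legs : List (Leg I)) :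
    oddComm T 0 Q F legs = splitSum (fun x : Leg I => T.kind x.1) (fun A B =>
      Q A * F B - paritySign (ghostParity T.kind A) * F A * Q B) legs := by
  simp only [oddComm, contraction_zero, ← splitSum_mul_left, ← splitSum_sub]
  rw [← splitSum_finset_sum]
  refine splitSum_congr _ fun A B _ => ?_
  rw [Finset.sum_sub_distrib, sum_clPart T.kind F B (fun _ z => Q A * z) (by simp),
    sum_clPart T.kind F A (fun b z => paritySign b * (z * Q B)) (by simp), mul_assoc]

/-- The legs handed to `F`, including the contracted one, determine which parity component survives.
On the right-hand product these are `A` and `c`, whence the sign. -/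
lemma oddComm_one_apply (Q F : ClFunctional I) (legs : List (Leg I)) :
    oddComm T 1 Q F legs = splitSum (fun x : Leg I => T.kind x.1) (fun A B =>
      ∑ c, ∑ d, (pairIntegral T Q F c d A B -
        paritySign (ghostParity T.kind A + (T.kind c).ghostParity) * pairIntegral T F Q c d A B))
      legs := by
  simp only [oddComm, contraction_one, ← splitSum_mul_left, ← splitSum_sub]
  rw [← splitSum_finset_sum]
  refine splitSum_congr _ fun A B _ => ?_
  simp only [Finset.mul_sum, ← Finset.sum_sub_distrib]
  rw [Finset.sum_comm]
  refine Finset.sum_congr rfl fun c _ => ?_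
  rw [Finset.sum_comm]
  refine Finset.sum_congr rfl fun d _ => ?_
  rw [Finset.sum_sub_distrib]
  have h1 : ∀ p, ghostParity T.kind ((d, planeWave 1 (T.mass c) p) :: B) =
      (T.kind d).ghostParity + ghostParity T.kind B := fun p => ghostParity_cons _ _ _
  have h2 : ∀ p, ghostParity T.kind (A ++ [(c, planeWave (-1) (T.mass c) p)]) =
      ghostParity T.kind A + (T.kind c).ghostParity := fun p => by
    rw [ghostParity_append]; simp [ghostParity]
  congr 1
  · rw [Finset.sum_eq_single ((T.kind d).ghostParity + ghostParity T.kind B)]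
    · simp [pairIntegral, clPart, h1]
    · intro b _ hb
      simp [pairIntegral, clPart, h1, Ne.symm hb]
    · simp
  · rw [Finset.sum_eq_single (ghostParity T.kind A + (T.kind c).ghostParity)]
    · simp [pairIntegral, clPart, h2]
    · intro b _ hb
      simp [pairIntegral, clPart, h2, Ne.symm hb]
    · simp

end Contraction

/-! ## Tame functionals on the mass shell -/

section TameShell

variable {I : Type*}

lemma Tame.clPart {F : ClFunctional I} (hF : Tame F) (kind : I → FieldKind) (b : ZMod 2) :
    Tame (clPart kind b F) := by
  have hpar : ∀ {r : ℕ} (legs : List (I × ((Fin r → Spacetime) → Fun))) (k : Fin r → Spacetime),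
      ghostParity kind (legs.map fun x => (x.1, x.2 k)) =
        (legs.map fun x => (kind x.1).ghostParity).sum := fun legs k => by
    simp [ghostParity, Function.comp_def]
  refine ⟨fun r legs h => ?_, fun r legs h => ?_, fun legs hs hz => ?_⟩
  · simp only [BRS.clPart, hpar]
    split_ifs
    exacts [hF.continuous r legs h, continuous_const]
  · simp only [BRS.clPart, hpar]
    split_ifs
    exacts [hF.polyBound r legs h, PolyBound.const 0]
  · simp [BRS.clPart, hF.zero legs hs hz]

/-- The constant wave families belonging to a list of legs. -/
def constLegs (r : ℕ) (A : List (Leg I)) : List (I × ((Fin r → Spacetime) → Fun)) :=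
  A.map fun x => (x.1, fun _ => x.2)

lemma isWaveFamily_constLegs {r : ℕ} {A : List (Leg I)} (hA : SmoothLegs A) :
    ∀ x ∈ constLegs r A, IsWaveFamily x.2 := by
  intro x hx
  obtain ⟨y, hy, rfl⟩ := List.mem_map.1 hx
  exact Or.inl ⟨y.2, hA y hy, rfl⟩

lemma map_constLegs {r : ℕ} (A : List (Leg I)) (k : Fin r → Spacetime) :
    (constLegs r A).map (fun x => (x.1, x.2 k)) = A := by
  simp [constLegs, Function.comp_def]

lemma one_add_norm_shellMomentum_le {r : ℕ} (m : Fin r → ℝ) (p : Fin r → Fin 3 → ℝ) :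
    1 + ‖fun k => shellMomentum (m k) (p k)‖ ≤ (2 + ∑ k, |m k|) * (1 + ‖p‖) := by
  have hM : 0 ≤ ∑ k, |m k| := Finset.sum_nonneg fun _ _ => abs_nonneg _
  have h1 : ‖fun k => shellMomentum (m k) (p k)‖ ≤ 2 * ‖p‖ + ∑ k, |m k| := by
    refine (pi_norm_le_iff_of_nonneg (by positivity)).2 fun k => ?_
    refine (norm_shellMomentum_le (m k) (p k)).trans (add_le_add ?_ ?_)
    · linarith [norm_le_pi_norm p k]
    · exact Finset.single_le_sum (f := fun k => |m k|) (fun _ _ => abs_nonneg _)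
        (Finset.mem_univ k)
  nlinarith [norm_nonneg p, mul_nonneg hM (norm_nonneg p)]

lemma Tame.polyBound_shell {F : ClFunctional I} (hF : Tame F) {r : ℕ} (m : Fin r → ℝ)
    {legs : List (I × ((Fin r → Spacetime) → Fun))} (hl : ∀ x ∈ legs, IsWaveFamily x.2) :
    PolyBound (fun p : Fin r → Fin 3 → ℝ => 1 + ‖p‖)
      (fun p => F (legs.map fun x => (x.1, x.2 fun k => shellMomentum (m k) (p k)))) ∧
    PolyBound (fun p : Fin r → Fin 3 → ℝ => 1 + ‖p‖)
      (fun p => F (legs.map fun x => (x.1, x.2 fun k => -shellMomentum (m k) (p k)))) := by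
  have hM : 0 ≤ 2 + ∑ k, |m k| := add_nonneg zero_le_two (Finset.sum_nonneg fun _ _ => abs_nonneg _)
  have h := hF.polyBound r legs hl
  refine ⟨h.comp (fun b => by positivity) hM (one_add_norm_shellMomentum_le m),
    h.comp (fun b => by positivity) hM fun p => ?_⟩
  have : (fun k => -shellMomentum (m k) (p k)) = -fun k => shellMomentum (m k) (p k) := rfl
  rw [this, norm_neg]
  exact one_add_norm_shellMomentum_le m p

lemma Tame.append_wave {F : ClFunctional I} (hF : Tame F) {A : List (Leg I)} (hA : SmoothLegs A)
    (c : I) (m : ℝ) :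
    Continuous (fun p => F (A ++ [(c, expWave (shellMomentum m p))])) ∧
    PolyBound (fun p => 1 + ‖p‖) fun p => F (A ++ [(c, expWave (shellMomentum m p))]) := by
  have hl : ∀ x ∈ constLegs 1 A ++ [(c, fun K : Fin 1 → Spacetime => expWave (K 0))],
      IsWaveFamily x.2 := by
    intro x hx
    rcases List.mem_append.1 hx with hx | hx
    · exact isWaveFamily_constLegs hA x hx
    · rw [List.mem_singleton] at hx; subst hx; exact Or.inr ⟨0, rfl⟩
  have h1 := hF.continuous 1 _ hl
  have h2 := (hF.polyBound_shell (fun _ => m) hl).1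
  simp only [List.map_append, map_constLegs, List.map_cons, List.map_nil] at h1 h2
  refine ⟨h1.comp (g := fun K : Fin 1 → Spacetime => F (A ++ [(c, expWave (K 0))]))
    (f := fun p => fun _ => shellMomentum m p)
    (continuous_pi fun _ => continuous_shellMomentum m), ?_⟩
  refine h2.comp (g := fun (p : Fin 3 → ℝ) (_ : Fin 1) => p) (fun b => by positivity) zero_le_one
    fun p => ?_
  rw [one_mul, pi_norm_const]

lemma Tame.cons_wave {F : ClFunctional I} (hF : Tame F) {B : List (Leg I)} (hB : SmoothLegs B)
    (d : I) (m : ℝ) :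
    Continuous (fun p => F ((d, expWave (-shellMomentum m p)) :: B)) ∧
    PolyBound (fun p => 1 + ‖p‖) fun p => F ((d, expWave (-shellMomentum m p)) :: B) := by
  have hl : ∀ x ∈ (d, fun K : Fin 1 → Spacetime => expWave (K 0)) :: constLegs 1 B,
      IsWaveFamily x.2 := by
    intro x hx
    rcases List.mem_cons.1 hx with hx | hx
    · subst hx; exact Or.inr ⟨0, rfl⟩
    · exact isWaveFamily_constLegs hB x hx
  have h1 := hF.continuous 1 _ hl
  have h2 := (hF.polyBound_shell (fun _ => m) hl).2
  simp only [map_constLegs, List.map_cons] at h1 h2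
  refine ⟨h1.comp (g := fun K : Fin 1 → Spacetime => F ((d, expWave (K 0)) :: B))
    (f := fun p => fun _ => -shellMomentum m p)
    (continuous_pi fun _ => (continuous_shellMomentum m).neg), ?_⟩
  refine h2.comp (g := fun (p : Fin 3 → ℝ) (_ : Fin 1) => p) (fun b => by positivity) zero_le_one
    fun p => ?_
  rw [one_mul, pi_norm_const]

lemma Tame.append_two_waves {F : ClFunctional I} (hF : Tame F) {A : List (Leg I)}
    (hA : SmoothLegs A) (c c' : I) (m : Fin 2 → ℝ) :
    PolyBound (fun p : Fin 2 → Fin 3 → ℝ => 1 + ‖p‖) fun p =>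
      F (A ++ [(c, expWave (shellMomentum (m 0) (p 0))),
        (c', expWave (shellMomentum (m 1) (p 1)))]) := by
  have hl : ∀ x ∈ constLegs 2 A ++ [(c, fun K : Fin 2 → Spacetime => expWave (K 0)),
      (c', fun K : Fin 2 → Spacetime => expWave (K 1))], IsWaveFamily x.2 := by
    intro x hx
    simp only [List.mem_append, List.mem_cons, List.not_mem_nil, or_false] at hx
    rcases hx with hx | hx | hx
    · exact isWaveFamily_constLegs hA x hx
    · subst hx; exact Or.inr ⟨0, rfl⟩
    · subst hx; exact Or.inr ⟨1, rfl⟩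
  have h := (hF.polyBound_shell m hl).1
  simpa only [List.map_append, map_constLegs, List.map_cons, List.map_nil] using h

lemma Tame.cons_two_waves {F : ClFunctional I} (hF : Tame F) {B : List (Leg I)}
    (hB : SmoothLegs B) (d d' : I) (m : Fin 2 → ℝ) :
    PolyBound (fun p : Fin 2 → Fin 3 → ℝ => 1 + ‖p‖) fun p =>
      F ((d, expWave (-shellMomentum (m 1) (p 1))) ::
        (d', expWave (-shellMomentum (m 0) (p 0))) :: B) := by
  have hl : ∀ x ∈ (d, fun K : Fin 2 → Spacetime => expWave (K 1)) ::
      (d', fun K : Fin 2 → Spacetime => expWave (K 0)) :: constLegs 2 B, IsWaveFamily x.2 := by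
    intro x hx
    simp only [List.mem_cons] at hx
    rcases hx with hx | hx | hx
    · subst hx; exact Or.inr ⟨1, rfl⟩
    · subst hx; exact Or.inr ⟨0, rfl⟩
    · exact isWaveFamily_constLegs hB x hx
  have h := (hF.polyBound_shell m hl).2
  simpa only [map_constLegs, List.map_cons] using h

end TameShell

/-! ## The commutator with the charge -/

section ChargeCommutator

variable {I : Type*} [Fintype I] [DecidableEq I] {T : FreeTheory I} (s : FreeBRS T)

/-- The charge `∫ g j⁰`. -/
def smearedCharge (g : Spacetime → ℝ) : ClFunctional I := smeared T.kind g (s.current 0)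

lemma smearedCharge_pair (g : Spacetime → ℝ) (x y : Leg I) :
    smearedCharge s g [x, y] = chargeForm s (fun z => (g z : ℂ)) x.1 y.1 x.2 y.2 :=
  smeared_pair s g x y

lemma smearedCharge_eq_zero_of_length (g : Spacetime → ℝ) {legs : List (Leg I)}
    (h : legs.length ≠ 2) : smearedCharge s g legs = 0 :=
  smeared_eq_zero_of_length _ _ _ h

lemma smearedCharge_ne_zero {g : Spacetime → ℝ} {legs : List (Leg I)}
    (h : smearedCharge s g legs ≠ 0) :
    ∃ x y, legs = [x, y] ∧ (T.kind x.1).Opposite (T.kind y.1) := by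
  have hlen : legs.length = 2 := by
    by_contra hl
    exact h (smearedCharge_eq_zero_of_length s g hl)
  obtain ⟨x, y, rfl⟩ := List.length_eq_two.1 hlen
  refine ⟨x, y, rfl, ?_⟩
  by_contra ho
  exact h (by rw [smearedCharge_pair, chargeForm_eq_zero s _ ho])

lemma oddFunctional_smearedCharge (g : Spacetime → ℝ) : OddFunctional T (smearedCharge s g) := by
  intro legs hl
  by_contra h
  obtain ⟨x, y, rfl, ho⟩ := smearedCharge_ne_zero s h
  exact hl (by simp [ghostParity, ho.ghostParity_add])

/-- The sign of exchanging a pair of opposite kinds with a list. -/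
lemma exchList_mul_exchList_of_opposite {x y : Leg I} (h : (T.kind x.1).Opposite (T.kind y.1))
    (A : List (Leg I)) :
    exchList (fun z : Leg I => T.kind z.1) x A * exchList (fun z : Leg I => T.kind z.1) y A =
      paritySign (ghostParity T.kind A) := by
  induction A with
  | nil => simp [ghostParity, paritySign]
  | cons a A ih =>
    rw [exchList_cons, exchList_cons, ghostParity_cons, paritySign_add, ← ih,
      ← h.exch_mul_exch (T.kind a.1)]
    ring

lemma exchLists_pair_right (A : List (Leg I)) (x y : Leg I) :
    exchLists (fun z : Leg I => T.kind z.1) A [x, y] =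
      exchList (fun z : Leg I => T.kind z.1) x A * exchList (fun z : Leg I => T.kind z.1) y A := by
  have h0 : exchLists (fun z : Leg I => T.kind z.1) A [] = 1 := by simp [exchLists]
  rw [exchLists_cons_right, exchLists_cons_right, h0, mul_one]

/-- Moving `A` across the two legs of the charge costs the ghost parity of `A`, since they form a
boson-ghost pair; this is precisely the sign in the graded commutator. -/
lemma oddComm_zero_smearedCharge (g : Spacetime → ℝ) (F : ClFunctional I) (legs : List (Leg I)) :
    oddComm T 0 (smearedCharge s g) F legs = 0 := by
  rw [oddComm_zero_apply, splitSum_sub, splitSum_comm, sub_eq_zero]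
  refine splitSum_congr _ fun A B _ => ?_
  by_cases h : smearedCharge s g B = 0
  · simp [h]
  · obtain ⟨x, y, rfl, ho⟩ := smearedCharge_ne_zero s h
    rw [exchLists_pair_right, exchList_mul_exchList_of_opposite ho]
    ring

lemma oddComm_smearedCharge_eq_zero (g : Spacetime → ℝ) {r : ℕ} (hr : 3 ≤ r) (F : ClFunctional I)
    (legs : List (Leg I)) : oddComm T r (smearedCharge s g) F legs = 0 := by
  have h : ∀ legs : List (Leg I), r ≤ legs.length → smearedCharge s g legs = 0 := fun legs hl =>
    smearedCharge_eq_zero_of_length s g (by omega)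
  simp [oddComm, contraction_eq_zero_of_left T h, contraction_eq_zero_of_right T h]

lemma twoPoint_eq_shellSymbol (c d : I) (p : Fin 3 → ℝ) :
    twoPoint T c d p = shellSymbol (T.N c d) (T.mass c) p := twoPoint_eq T c d p

variable (ρ : Regulator)

/-- Both legs of the charge are contracted, so it absorbs no external leg. Its two waves have
frequencies -ω and -ω', which cannot cancel. -/
lemma tendsto_contraction_two_left {F : ClFunctional I} (hF : Tame F) {legs : List (Leg I)}
    (hl : CompactLegs legs) :
    Tendsto (fun ε => contraction T 2 (smearedCharge s (ρ.scaled ε)) F legs)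
      (𝓝[>] (0 : ℝ)) (𝓝 0) := by
  simp only [contraction_eq_splitSum]
  rw [← splitSum_zero (fun x : Leg I => T.kind x.1) legs]
  refine tendsto_splitSum _ fun A B hp => ?_
  have hB : SmoothLegs B := (CompactLegs.right (hl.perm hp)).smooth
  rw [← mul_zero (((Nat.factorial 2 : ℕ) : ℂ)⁻¹)]
  refine Tendsto.const_mul _ ?_
  rw [← (Finset.sum_const_zero : ∑ _c : Fin 2 → I, (0 : ℂ) = 0)]
  refine tendsto_finsetSum _ fun c _ => ?_
  rw [← (Finset.sum_const_zero : ∑ _c : Fin 2 → I, (0 : ℂ) = 0)]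
  refine tendsto_finsetSum _ fun d _ => ?_
  by_cases hA : A = []
  · subst hA
    have h := tendsto_integral_two_waves s ρ (c 0) (c 1) (fun k => T.N (c k) (d k))
      (fun k => T.mass (c k)) (κ := fun k => shellMomentum (T.mass (c k)))
      (fun k => shellFamily_shellMomentum _) (fun p => ?_)
      (hF.cons_two_waves hB (d 1) (d 0) fun k => T.mass (c k))
    · refine h.congr fun ε => integral_congr_ae (Eventually.of_forall fun p => ?_)
      simp only [List.ofFn_succ, List.ofFn_zero, List.nil_append, Fin.succ_zero_eq_one,
        smearedCharge_pair, planeWave_neg_one, planeWave_one, twoPoint_eq_shellSymbol,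
        List.reverse_cons, List.reverse_nil, List.cons_append]
      ring
    · have h0 : ∀ m q, shellMomentum m q 0 = -energy m q := fun _ _ => rfl
      rw [h0, h0, ← neg_add, abs_neg]
      exact (add_le_add (norm_le_energy _ _) (norm_le_energy _ _)).trans (le_abs_self _)
  · have hz : ∀ ε (L : Fin 2 → Leg I), smearedCharge s (ρ.scaled ε) (A ++ List.ofFn L) = 0 :=
      fun ε L => smearedCharge_eq_zero_of_length s _ (by
        have := List.length_pos_iff.2 hA
        simp; omega)
    simp only [hz, mul_zero, zero_mul, integral_zero]
    exact tendsto_const_nhds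

/-- As for the left product, now with frequencies +ω and +ω'. -/
lemma tendsto_contraction_two_right {F : ClFunctional I} (hF : Tame F) {legs : List (Leg I)}
    (hl : CompactLegs legs) :
    Tendsto (fun ε => contraction T 2 F (smearedCharge s (ρ.scaled ε)) legs)
      (𝓝[>] (0 : ℝ)) (𝓝 0) := by
  simp only [contraction_eq_splitSum]
  rw [← splitSum_zero (fun x : Leg I => T.kind x.1) legs]
  refine tendsto_splitSum _ fun A B hp => ?_
  have hA : SmoothLegs A := (CompactLegs.left (hl.perm hp)).smooth
  rw [← mul_zero (((Nat.factorial 2 : ℕ) : ℂ)⁻¹)]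
  refine Tendsto.const_mul _ ?_
  rw [← (Finset.sum_const_zero : ∑ _c : Fin 2 → I, (0 : ℂ) = 0)]
  refine tendsto_finsetSum _ fun c _ => ?_
  rw [← (Finset.sum_const_zero : ∑ _c : Fin 2 → I, (0 : ℂ) = 0)]
  refine tendsto_finsetSum _ fun d _ => ?_
  by_cases hB : B = []
  · subst hB
    have h := tendsto_integral_two_waves s ρ (d 0) (d 1) (fun k => T.N (c k) (d k))
      (fun k => T.mass (c k)) (κ := fun k p => -shellMomentum (T.mass (c k)) p)
      (fun k => (shellFamily_shellMomentum _).neg) (fun p => ?_)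
      (hF.append_two_waves hA (c 0) (c 1) fun k => T.mass (c k))
    · refine h.congr fun ε => integral_congr_ae (Eventually.of_forall fun p => ?_)
      simp only [List.ofFn_succ, List.ofFn_zero, Fin.succ_zero_eq_one,
        smearedCharge_pair, planeWave_neg_one, planeWave_one, twoPoint_eq_shellSymbol,
        List.reverse_cons, List.reverse_nil, List.cons_append, List.nil_append, List.append_nil]
      -- Contracted legs enter the right factor in reversed order; symmetry of the charge form
      -- restores the order in which the two-wave limit was proved.
      rw [chargeForm_swap s _ (d 1) (d 0)]
      ring
    · have h0 : ∀ m q, (-shellMomentum m q) 0 = energy m q := fun _ _ => neg_neg _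
      rw [h0, h0]
      exact (add_le_add (norm_le_energy _ _) (norm_le_energy _ _)).trans (le_abs_self _)
  · have hz : ∀ ε (L : Fin 2 → Leg I),
        smearedCharge s (ρ.scaled ε) ((List.ofFn L).reverse ++ B) = 0 :=
      fun ε L => smearedCharge_eq_zero_of_length s _ (by
        have := List.length_pos_iff.2 hB
        simp; omega)
    simp only [hz, mul_zero, integral_zero]
    exact tendsto_const_nhds

lemma tendsto_oddComm_two {F : ClFunctional I} (hF : Tame F) {legs : List (Leg I)}
    (hl : CompactLegs legs) :
    Tendsto (fun ε => oddComm T 2 (smearedCharge s (ρ.scaled ε)) F legs)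
      (𝓝[>] (0 : ℝ)) (𝓝 0) := by
  have h := tendsto_finsetSum (Finset.univ : Finset (ZMod 2)) fun b _ =>
    (tendsto_contraction_two_left s ρ (hF.clPart T.kind b) hl).sub
      ((tendsto_contraction_two_right s ρ (hF.clPart T.kind b) hl).const_mul (paritySign b))
  simpa [oddComm] using h

end ChargeCommutator

lemma smooth_cons_planeWave {I : Type*} {B : List (Leg I)} (hB : SmoothLegs B) (d : I)
    (m : ℝ) (p : Fin 3 → ℝ) : SmoothLegs ((d, planeWave 1 m p) :: B) := by
  intro x hx
  rcases List.mem_cons.1 hx with rfl | hx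
  · simp only [planeWave_one]; exact contDiff_expWave _
  · exact hB x hx

lemma smooth_append_planeWave {I : Type*} {A : List (Leg I)} (hA : SmoothLegs A) (c : I)
    (m : ℝ) (p : Fin 3 → ℝ) : SmoothLegs (A ++ [(c, planeWave (-1) m p)]) := by
  intro x hx
  rcases List.mem_append.1 hx with hx | hx
  · exact hA x hx
  · rw [List.mem_singleton] at hx
    subst hx
    simp only [planeWave_neg_one]; exact contDiff_expWave _

section OneContraction

variable {I : Type*} [Fintype I] [DecidableEq I] {T : FreeTheory I} (s : FreeBRS T)

/-! ## One contraction with the charge -/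

variable (T) in
/-- The integrand of the contraction of the leg `φ_c` of `F` with the leg `φ_d` of `G`. -/
def pairIntegrand (F G : ClFunctional I) (c d : I) (A B : List (Leg I)) (p : Fin 3 → ℝ) : ℂ :=
  twoPoint T c d p * F (A ++ [(c, planeWave (-1) (T.mass c) p)]) *
    G ((d, planeWave 1 (T.mass c) p) :: B)

lemma pairIntegral_eq (F G : ClFunctional I) (c d : I) (A B : List (Leg I)) :
    pairIntegral T F G c d A B = ∫ p, pairIntegrand T F G c d A B p := rfl

lemma pairIntegrand_left_eq_zero (g : Spacetime → ℝ) (F : ClFunctional I) (c d : I)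
    {A : List (Leg I)} (hA : A.length ≠ 1) (B : List (Leg I)) :
    pairIntegrand T (smearedCharge s g) F c d A B = 0 := by
  ext p
  rw [pairIntegrand, smearedCharge_eq_zero_of_length s g (by simpa using hA)]
  simp

lemma pairIntegrand_right_eq_zero (g : Spacetime → ℝ) (F : ClFunctional I) (c d : I)
    (A : List (Leg I)) {B : List (Leg I)} (hB : B.length ≠ 1) :
    pairIntegrand T F (smearedCharge s g) c d A B = 0 := by
  ext p
  rw [pairIntegrand, smearedCharge_eq_zero_of_length s g (by simpa using hB)]
  simp

/-- The mass of `c` is replaced by that of `d`, equal whenever N_{cd} ≠ 0. For fixed `d` the sum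
over `c` then runs over one mass shell and forms a column of N, hence the polarization of a
solution. -/
lemma pairIntegrand_left_singleton (g : Spacetime → ℝ) (F : ClFunctional I) (c d : I) (a : Leg I)
    (B : List (Leg I)) (p : Fin 3 → ℝ) :
    pairIntegrand T (smearedCharge s g) F c d [a] B p = shellSymbol (T.N c d) (T.mass d) p *
      (F ((d, expWave (-shellMomentum (T.mass d) p)) :: B) *
        chargeForm s (fun x => (g x : ℂ)) a.1 c a.2 (expWave (shellMomentum (T.mass d) p))) := by
  rw [pairIntegrand, twoPoint_eq_shellSymbol]
  by_cases hN : T.N c d = 0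
  · simp [hN, shellSymbol_zero]
  · rw [← mass_eq_of_N_ne_zero T hN, planeWave_neg_one, planeWave_one, List.singleton_append,
      smearedCharge_pair]
    ring

lemma pairIntegrand_right_singleton (g : Spacetime → ℝ) (F : ClFunctional I) (c d : I)
    (A : List (Leg I)) (b : Leg I) (p : Fin 3 → ℝ) :
    pairIntegrand T F (smearedCharge s g) c d A [b] p = shellSymbol (T.N c d) (T.mass c) p *
      (F (A ++ [(c, expWave (shellMomentum (T.mass c) p))]) *
        chargeForm s (fun x => (g x : ℂ)) b.1 d b.2 (expWave (-shellMomentum (T.mass c) p))) := by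
  rw [pairIntegrand, twoPoint_eq_shellSymbol, planeWave_neg_one, planeWave_one,
    smearedCharge_pair, chargeForm_swap]
  ring

variable {g : Spacetime → ℝ}

lemma integrable_pairIntegrand_left (hg : ContDiff ℝ ∞ fun x => (g x : ℂ))
    (hgc : TimeCompact fun x => (g x : ℂ)) {F : ClFunctional I} (hF : Tame F) (c d : I)
    {A B : List (Leg I)} (hA : CompactLegs A) (hB : CompactLegs B) :
    Integrable (pairIntegrand T (smearedCharge s g) F c d A B) := by
  by_cases hlen : A.length = 1
  · obtain ⟨a, rfl⟩ := List.length_eq_one_iff.1 hlen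
    have hw := hF.cons_wave hB.smooth d (T.mass d)
    refine (integrable_shellSymbol_mul_chargeForm s hg hgc (hA a (by simp)) a.1 c
      (continuous_shellMomentum (T.mass d)) (shellFamily_shellMomentum (T.mass d)) (T.N c d)
      (T.mass d) hw.1 hw.2).congr (Eventually.of_forall fun p => ?_)
    exact (pairIntegrand_left_singleton s g F c d a B p).symm
  · rw [pairIntegrand_left_eq_zero s g F c d hlen]
    exact integrable_zero _ _ _

lemma integrable_pairIntegrand_right (hg : ContDiff ℝ ∞ fun x => (g x : ℂ))
    (hgc : TimeCompact fun x => (g x : ℂ)) {F : ClFunctional I} (hF : Tame F) (c d : I)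
    {A B : List (Leg I)} (hA : CompactLegs A) (hB : CompactLegs B) :
    Integrable (pairIntegrand T F (smearedCharge s g) c d A B) := by
  by_cases hlen : B.length = 1
  · obtain ⟨b, rfl⟩ := List.length_eq_one_iff.1 hlen
    have hw := hF.append_wave hA.smooth c (T.mass c)
    refine (integrable_shellSymbol_mul_chargeForm s hg hgc (hB b (by simp)) b.1 d
      (continuous_shellMomentum (T.mass c)).neg (shellFamily_shellMomentum (T.mass c)).neg (T.N c d)
      (T.mass c) hw.1 hw.2).congr (Eventually.of_forall fun p => ?_)
    exact (pairIntegrand_right_singleton s g F c d A b p).symm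
  · rw [pairIntegrand_right_eq_zero s g F c d A hlen]
    exact integrable_zero _ _ _

lemma pairIntegrand_left_eq_zero_of_zero (g : Spacetime → ℝ) {F : ClFunctional I} (hF : Tame F)
    (c d : I) {A B : List (Leg I)} (hB : CompactLegs B) (hz : ∃ x ∈ A ++ B, x.2 = 0) :
    pairIntegrand T (smearedCharge s g) F c d A B = 0 := by
  ext p
  obtain ⟨x, hx, hx0⟩ := hz
  rcases List.mem_append.1 hx with hx | hx
  · by_cases hlen : A.length = 1
    · obtain ⟨a, rfl⟩ := List.length_eq_one_iff.1 hlen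
      rw [List.mem_singleton] at hx
      subst hx
      rw [pairIntegrand_left_singleton, hx0, chargeForm_zero_left]
      simp
    · rw [pairIntegrand_left_eq_zero s g F c d hlen]
  · rw [pairIntegrand, hF.zero _ (smooth_cons_planeWave hB.smooth _ _ _)
      ⟨x, List.mem_cons_of_mem _ hx, hx0⟩]
    simp

lemma pairIntegrand_right_eq_zero_of_zero (g : Spacetime → ℝ) {F : ClFunctional I} (hF : Tame F)
    (c d : I) {A B : List (Leg I)} (hA : CompactLegs A) (hz : ∃ x ∈ A ++ B, x.2 = 0) :
    pairIntegrand T F (smearedCharge s g) c d A B = 0 := by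
  ext p
  obtain ⟨x, hx, hx0⟩ := hz
  rcases List.mem_append.1 hx with hx | hx
  · rw [pairIntegrand, hF.zero _ (smooth_append_planeWave hA.smooth _ _ _)
      ⟨x, List.mem_append_left _ hx, hx0⟩]
    simp
  · by_cases hlen : B.length = 1
    · obtain ⟨b, rfl⟩ := List.length_eq_one_iff.1 hlen
      rw [List.mem_singleton] at hx
      subst hx
      rw [pairIntegrand_right_singleton, hx0, chargeForm_zero_left]
      simp
    · rw [pairIntegrand_right_eq_zero s g F c d A hlen]

variable (T) in
/-- The sum over the fields of the terms of the commutator in which `Q` stands on the left. -/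
def leftPair (Q F : ClFunctional I) (A B : List (Leg I)) : ℂ :=
  ∑ c, ∑ d, pairIntegral T Q F c d A B

variable (T) in
/-- The sum over the fields of the terms of the commutator in which `Q` stands on the right. -/
def rightPair (Q F : ClFunctional I) (A B : List (Leg I)) : ℂ :=
  ∑ c, ∑ d, paritySign (ghostParity T.kind A + (T.kind c).ghostParity) * pairIntegral T F Q c d A B

lemma oddComm_one_eq (Q F : ClFunctional I) (legs : List (Leg I)) :
    oddComm T 1 Q F legs = splitSum (fun x : Leg I => T.kind x.1) (leftPair T Q F) legs -
      splitSum (fun x : Leg I => T.kind x.1) (rightPair T Q F) legs := by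
  rw [oddComm_one_apply, ← splitSum_sub]
  simp only [leftPair, rightPair, Finset.sum_sub_distrib]

lemma leftPair_eq_zero (g : Spacetime → ℝ) (F : ClFunctional I)
    {A : List (Leg I)} (hA : A.length ≠ 1) (B : List (Leg I)) :
    leftPair T (smearedCharge s g) F A B = 0 := by
  simp [leftPair, pairIntegral_eq, pairIntegrand_left_eq_zero s g F _ _ hA]

lemma rightPair_eq_zero (g : Spacetime → ℝ) (F : ClFunctional I)
    (A : List (Leg I)) {B : List (Leg I)} (hB : B.length ≠ 1) :
    rightPair T (smearedCharge s g) F A B = 0 := by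
  simp [rightPair, pairIntegral_eq, pairIntegrand_right_eq_zero s g F _ _ _ hB]

lemma leftPair_eq_zero_of_zero (g : Spacetime → ℝ) {F : ClFunctional I} (hF : Tame F)
    {A B : List (Leg I)} (hB : CompactLegs B) (hz : ∃ x ∈ A ++ B, x.2 = 0) :
    leftPair T (smearedCharge s g) F A B = 0 := by
  simp [leftPair, pairIntegral_eq, pairIntegrand_left_eq_zero_of_zero s g hF _ _ hB hz]

lemma rightPair_eq_zero_of_zero (g : Spacetime → ℝ) {F : ClFunctional I} (hF : Tame F)
    {A B : List (Leg I)} (hA : CompactLegs A) (hz : ∃ x ∈ A ++ B, x.2 = 0) :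
    rightPair T (smearedCharge s g) F A B = 0 := by
  simp [rightPair, pairIntegral_eq, pairIntegrand_right_eq_zero_of_zero s g hF _ _ hA hz]

lemma vanishesAtZero_oddComm_one (g : Spacetime → ℝ) {F : ClFunctional I} (hF : Tame F) :
    VanishesAtZero (oddComm T 1 (smearedCharge s g) F) := by
  rintro legs hl ⟨x, hx, hx0⟩
  rw [oddComm_one_eq, splitSum_congr _ (Ψ := fun _ _ => 0), splitSum_zero,
    splitSum_congr _ (Ψ := fun _ _ => 0), splitSum_zero, sub_zero]
  · exact fun A B hp => rightPair_eq_zero_of_zero s g hF (CompactLegs.left (hl.perm hp))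
      ⟨x, hp.mem_iff.2 hx, hx0⟩
  · exact fun A B hp => leftPair_eq_zero_of_zero s g hF (CompactLegs.right (hl.perm hp))
      ⟨x, hp.mem_iff.2 hx, hx0⟩

lemma clRestrict_oddComm_one (g : Spacetime → ℝ) {F : ClFunctional I} (hF : Tame F)
    (hs : List (Solution T)) :
    clRestrict T (oddComm T 1 (smearedCharge s g) F) hs =
      splitSum (fun h : Solution T => h.kind) (fun A B =>
        clRestrict T (fun a => clRestrict T (leftPair T (smearedCharge s g) F a) B) A) hs -
      splitSum (fun h : Solution T => h.kind) (fun A B =>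
        clRestrict T (fun a => clRestrict T (rightPair T (smearedCharge s g) F a) B) A) hs := by
  rw [clRestrict_congr fun legs _ => oddComm_one_eq (T := T) (smearedCharge s g) F legs,
    clRestrict_sub,
    clRestrict_splitSum _ fun A B _ hB hz => leftPair_eq_zero_of_zero s g hF hB hz,
    clRestrict_splitSum _ fun A B hA _ hz => rightPair_eq_zero_of_zero s g hF hA hz]

variable (ρ : Regulator)

/-- One of the two legs of the charge is contracted, so it takes exactly one solution; other lengths
of `A` give zero for every ε. Summing over the components of that solution and over `c` assembles
the conserved current. -/
lemma tendsto_clRestrict_leftPair {F : ClFunctional I} (hF : Tame F) (A B : List (Solution T)) :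
    Tendsto (fun ε => clRestrict T (fun a => clRestrict T
      (leftPair T (smearedCharge s (ρ.scaled ε)) F a) B) A) (𝓝[>] (0 : ℝ))
      (𝓝 (clRestrict T (fun a => clRestrict T
        (leftPair T (smearedCharge s ρ.unbounded) F a) B) A)) := by
  match A with
  | [] =>
    refine tendsto_clRestrict (fun legs _ => ?_) B
    simp only [leftPair_eq_zero s _ F (A := []) (by simp)]
    exact tendsto_const_nhds
  | h :: h' :: A =>
    refine tendsto_finsetSum _ fun i _ => tendsto_finsetSum _ fun j _ =>
      tendsto_clRestrict (fun a _ => tendsto_clRestrict (fun b _ => ?_) B) A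
    have hz : ∀ g, leftPair T (smearedCharge s g) F ((i, h.val i) :: (j, h'.val j) :: a) b = 0 :=
      fun g => leftPair_eq_zero s _ F (by simp) _
    simp only [hz]
    exact tendsto_const_nhds
  | [h] =>
    have hsum : ∀ g, clRestrict T (fun a => clRestrict T
        (leftPair T (smearedCharge s g) F a) B) [h] = clRestrict T (fun b => ∑ d, ∑ i, ∑ c,
          ∫ p, shellSymbol (T.N c d) (T.mass d) p *
          (F ((d, expWave (-shellMomentum (T.mass d) p)) :: b) * chargeForm s (fun x => (g x : ℂ))
            i c (h.val i) (expWave (shellMomentum (T.mass d) p)))) B := fun g => by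
      simp only [clRestrict]
      rw [← clRestrict_finset_sum]
      refine clRestrict_congr (fun b _ => ?_) B
      rw [Finset.sum_comm]
      refine Finset.sum_congr rfl fun i _ => ?_
      rw [leftPair, Finset.sum_comm]
      refine Finset.sum_congr rfl fun d _ => Finset.sum_congr rfl fun c _ => ?_
      rw [pairIntegral_eq]
      exact integral_congr_ae (Eventually.of_forall fun p =>
        pairIntegrand_left_singleton s g F c d (i, h.val i) b p)
    simp only [hsum]
    refine tendsto_clRestrict (fun b hb => tendsto_finsetSum _ fun d _ => ?_) B
    have hw := hF.cons_wave hb.smooth d (T.mass d)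
    exact tendsto_sum_integral_chargeForm s ρ h (continuous_shellMomentum (T.mass d))
      (shellFamily_shellMomentum (T.mass d)) (fun c => T.N c d) (T.mass d)
      (fun e p => sum_eval_D_mul_N T d e p) hw.1 hw.2

/-- Here the row index `c` is held fixed and the waves reaching the charge have momentum -k, with N
still evaluated at +k; the row version of the polarization identity applies. -/
lemma tendsto_clRestrict_rightPair {F : ClFunctional I} (hF : Tame F) (A B : List (Solution T)) :
    Tendsto (fun ε => clRestrict T (fun a => clRestrict T
      (rightPair T (smearedCharge s (ρ.scaled ε)) F a) B) A) (𝓝[>] (0 : ℝ))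
      (𝓝 (clRestrict T (fun a => clRestrict T
        (rightPair T (smearedCharge s ρ.unbounded) F a) B) A)) := by
  refine tendsto_clRestrict (fun a ha => ?_) A
  match B with
  | [] =>
    simp only [clRestrict, rightPair_eq_zero s _ F a (B := []) (by simp)]
    exact tendsto_const_nhds
  | h :: h' :: B =>
    refine tendsto_finsetSum _ fun i _ => tendsto_finsetSum _ fun j _ =>
      tendsto_clRestrict (fun b _ => ?_) B
    have hz : ∀ g, rightPair T (smearedCharge s g) F a ((i, h.val i) :: (j, h'.val j) :: b) = 0 :=
      fun g => rightPair_eq_zero s _ F _ (by simp)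
    simp only [hz]
    exact tendsto_const_nhds
  | [h] =>
    have hsum : ∀ g, clRestrict T (rightPair T (smearedCharge s g) F a) [h] =
        ∑ c, paritySign (ghostParity T.kind a + (T.kind c).ghostParity) * ∑ i, ∑ d,
          ∫ p, shellSymbol (T.N c d) (T.mass c) p *
          (F (a ++ [(c, expWave (shellMomentum (T.mass c) p))]) * chargeForm s
            (fun x => (g x : ℂ)) i d (h.val i) (expWave (-shellMomentum (T.mass c) p))) :=
        fun g => by
      simp only [clRestrict, rightPair, Finset.mul_sum]
      rw [Finset.sum_comm]
      refine Finset.sum_congr rfl fun c _ => Finset.sum_congr rfl fun i _ =>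
        Finset.sum_congr rfl fun d _ => ?_
      rw [pairIntegral_eq]
      congr 1
      exact integral_congr_ae (Eventually.of_forall fun p =>
        pairIntegrand_right_singleton s g F c d a (i, h.val i) p)
    simp only [hsum]
    refine tendsto_finsetSum _ fun c _ => Tendsto.const_mul _ ?_
    have hw := hF.append_wave ha.smooth c (T.mass c)
    exact tendsto_sum_integral_chargeForm s ρ h (continuous_shellMomentum (T.mass c)).neg
      (shellFamily_shellMomentum (T.mass c)).neg (fun d => T.N c d) (T.mass c)
      (fun e p => sum_eval_neg_D_mul_N T c e p) hw.1 hw.2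

lemma tendsto_clRestrict_oddComm_one {F : ClFunctional I} (hF : Tame F) (hs : List (Solution T)) :
    Tendsto (fun ε => clRestrict T (oddComm T 1 (smearedCharge s (ρ.scaled ε)) F) hs)
      (𝓝[>] (0 : ℝ)) (𝓝 (clRestrict T (oddComm T 1 (smearedCharge s ρ.unbounded) F) hs)) := by
  simp only [clRestrict_oddComm_one s _ hF]
  exact (tendsto_splitSum _ fun A B _ => tendsto_clRestrict_leftPair s ρ hF A B).sub
    (tendsto_splitSum _ fun A B _ => tendsto_clRestrict_rightPair s ρ hF A B)

end OneContraction

/-! ## The graded Leibniz rule -/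

lemma ghostParity_perm {I : Type*} (kind : I → FieldKind) {A B : List (Leg I)} (h : A.Perm B) :
    ghostParity kind A = ghostParity kind B :=
  (h.map _).sum_eq

section Leibniz

variable {I : Type*} [Fintype I] [DecidableEq I] {T : FreeTheory I} (s : FreeBRS T)

lemma exchLists_singleton_right (A : List (Leg I)) (x : Leg I) :
    exchLists (fun z : Leg I => T.kind z.1) A [x] = exchList (fun z : Leg I => T.kind z.1) x A := by
  rw [exchLists_cons_right]
  simp [exchLists]

lemma exchLists_singleton_left (x : Leg I) (A : List (Leg I)) :
    exchLists (fun z : Leg I => T.kind z.1) [x] A = exchList (fun z : Leg I => T.kind z.1) x A := by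
  rw [exchLists_cons]
  simp [exchLists]

lemma exchList_congr {x y : Leg I} (h : T.kind x.1 = T.kind y.1) (A : List (Leg I)) :
    exchList (fun z : Leg I => T.kind z.1) x A = exchList (fun z : Leg I => T.kind z.1) y A := by
  simp only [exchList, h]

/-- A nonzero value forces `B` to be a single leg opposite in kind to `c`. As `d` has the kind of
`c`, `B` and `d` together cross `A` like one boson-ghost pair. -/
lemma sign_append_charge {g : Spacetime → ℝ} {B : List (Leg I)} {c d : Leg I}
    (hcd : T.kind c.1 = T.kind d.1) (hQ : smearedCharge s g (B ++ [c]) ≠ 0) (A : List (Leg I)) :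
    exchLists (fun z : Leg I => T.kind z.1) A B * exchList (fun z : Leg I => T.kind z.1) d A =
      paritySign (ghostParity T.kind A) := by
  obtain ⟨x, y, h, ho⟩ := smearedCharge_ne_zero s hQ
  have hB : B = [x] ∧ c = y := by
    have h' : B ++ [c] = [x] ++ [y] := h
    have := List.append_inj' h' rfl
    exact ⟨this.1, by simpa using this.2⟩
  obtain ⟨rfl, rfl⟩ := hB
  rw [exchLists_singleton_right, ← exchList_congr hcd, exchList_mul_exchList_of_opposite ho]

lemma sign_cons_charge {g : Spacetime → ℝ} {B : List (Leg I)} {c d : Leg I}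
    (hcd : T.kind c.1 = T.kind d.1) (hQ : smearedCharge s g (d :: B) ≠ 0) (A : List (Leg I)) :
    exchLists (fun z : Leg I => T.kind z.1) B A * exchList (fun z : Leg I => T.kind z.1) c A =
      paritySign (ghostParity T.kind A) := by
  obtain ⟨x, y, h, ho⟩ := smearedCharge_ne_zero s hQ
  simp only [List.cons.injEq] at h
  obtain ⟨rfl, rfl⟩ := h
  rw [exchLists_singleton_left, exchList_congr hcd, exchList_mul_exchList_of_opposite ho.symm]

/-- The contracted leg `d` stands in front of the product and joins `F` or `G`. To reach `G` it must
cross the legs of `F`, as must the external leg of the charge to let `F` come first; the two signs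
combine to (-1)^a. -/
lemma splitSum_charge_mul_left {g : Spacetime → ℝ} {F G : ClFunctional I} {a : ZMod 2}
    {c d : Leg I} (hcd : T.kind c.1 = T.kind d.1) {l : List (Leg I)}
    (hF : ∀ A B : List (Leg I), (A ++ B).Perm l → ghostParity T.kind A ≠ a → F A = 0) :
    splitSum (fun x : Leg I => T.kind x.1) (fun A B => smearedCharge s g (A ++ [c]) *
      splitSum (fun x : Leg I => T.kind x.1) (fun A B => F A * G B) (d :: B)) l =
    splitSum (fun x : Leg I => T.kind x.1) (fun R B => splitSum (fun x : Leg I => T.kind x.1)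
      (fun A B => smearedCharge s g (A ++ [c]) * F (d :: B)) R * G B) l +
    paritySign a * splitSum (fun x : Leg I => T.kind x.1) (fun A R => F A *
      splitSum (fun x : Leg I => T.kind x.1)
      (fun A B => smearedCharge s g (A ++ [c]) * G (d :: B)) R) l := by
  set κ : Leg I → FieldKind := fun x => T.kind x.1 with hκ
  set Q := smearedCharge s g with hQ
  simp only [splitSum_cons, mul_add, splitSum_add]
  congr 1
  · simp only [← splitSum_mul_left, ← splitSum_mul_right]
    rw [← splitSum_assoc κ fun A B C => Q (A ++ [c]) * F (d :: B) * G C]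
    simp only [mul_assoc]
  · simp only [← splitSum_mul_left]
    rw [splitSum_assoc κ fun A B C => Q (A ++ [c]) * (exchList κ d B * (F B * G (d :: C)))]
    have h1 : ∀ R C, splitSum κ (fun A B => Q (A ++ [c]) * (exchList κ d B * (F B * G (d :: C)))) R
        = splitSum κ (fun A B => exchLists κ A B *
          (Q (B ++ [c]) * (exchList κ d A * (F A * G (d :: C))))) R := fun R C =>
      splitSum_comm κ _ R
    simp only [h1]
    rw [← splitSum_assoc κ fun A B C => exchLists κ A B *
          (Q (B ++ [c]) * (exchList κ d A * (F A * G (d :: C))))]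
    refine splitSum_congr κ fun A R hp => ?_
    refine splitSum_congr κ fun B C _ => ?_
    by_cases hz : Q (B ++ [c]) = 0
    · simp [hz]
    by_cases ha : ghostParity T.kind A = a
    · have := sign_append_charge s hcd hz A
      rw [ha] at this
      linear_combination (Q (B ++ [c]) * F A * G (d :: C)) * this
    · simp [hF A R hp ha]

/-- The contracted leg `c` stands behind the product. If it joins `F`, it crosses the legs of `G`,
and so does the external leg of the charge; their joint sign cancels the parity of those legs in the
commutator sign. If it joins `G`, the parity of `F` remains as the factor (-1)^a. -/
lemma splitSum_charge_mul_right {g : Spacetime → ℝ} {F G : ClFunctional I} {a : ZMod 2}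
    {c d : Leg I} (hcd : T.kind c.1 = T.kind d.1) (b : ZMod 2) {l : List (Leg I)}
    (hF : ∀ A B : List (Leg I), (A ++ B).Perm l → ghostParity T.kind A ≠ a → F A = 0) :
    splitSum (fun x : Leg I => T.kind x.1) (fun A B => paritySign (ghostParity T.kind A + b) *
      (splitSum (fun x : Leg I => T.kind x.1) (fun A B => F A * G B) (A ++ [c]) *
        smearedCharge s g (d :: B))) l =
    splitSum (fun x : Leg I => T.kind x.1) (fun R B => splitSum (fun x : Leg I => T.kind x.1)
      (fun A B => paritySign (ghostParity T.kind A + b) *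
        (F (A ++ [c]) * smearedCharge s g (d :: B))) R * G B) l +
    paritySign a * splitSum (fun x : Leg I => T.kind x.1) (fun A R => F A *
      splitSum (fun x : Leg I => T.kind x.1)
      (fun A B => paritySign (ghostParity T.kind A + b) *
        (G (A ++ [c]) * smearedCharge s g (d :: B))) R) l := by
  set κ : Leg I → FieldKind := fun x => T.kind x.1 with hκ
  set Q := smearedCharge s g with hQ
  set γ : List (Leg I) → ZMod 2 := ghostParity T.kind with hγ
  have h0 : ∀ A B, paritySign (γ A + b) * (splitSum κ (fun A B => F A * G B) (A ++ [c]) *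
      Q (d :: B)) = splitSum κ (fun A₁ A₂ => exchList κ c A₂ * (paritySign (γ A₁ + γ A₂ + b) *
        (F (A₁ ++ [c]) * G A₂ * Q (d :: B)))) A + splitSum κ (fun A₁ A₂ =>
        paritySign (γ A₁ + γ A₂ + b) * (F A₁ * G (A₂ ++ [c]) * Q (d :: B))) A := by
    intro A B
    rw [splitSum_append_singleton, ← splitSum_mul_right, ← splitSum_mul_left, ← splitSum_add]
    refine splitSum_congr κ fun A₁ A₂ hp => ?_
    have e : γ A = γ A₁ + γ A₂ := by
      simp only [hγ]
      rw [← ghostParity_perm T.kind hp, ghostParity_append]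
    rw [e]
    ring
  simp only [h0, splitSum_add]
  congr 1
  · rw [← splitSum_assoc κ fun A₁ A₂ B => exchList κ c A₂ * (paritySign (γ A₁ + γ A₂ + b) *
        (F (A₁ ++ [c]) * G A₂ * Q (d :: B)))]
    have h1 : ∀ A₁ R, splitSum κ (fun A₂ B => exchList κ c A₂ * (paritySign (γ A₁ + γ A₂ + b) *
        (F (A₁ ++ [c]) * G A₂ * Q (d :: B)))) R = splitSum κ (fun B A₂ => exchLists κ B A₂ *
        (exchList κ c A₂ * (paritySign (γ A₁ + γ A₂ + b) *
        (F (A₁ ++ [c]) * G A₂ * Q (d :: B))))) R := fun A₁ R => splitSum_comm κ _ R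
    simp only [h1, ← splitSum_mul_right]
    rw [splitSum_assoc κ fun A₁ B A₂ => exchLists κ B A₂ *
        (exchList κ c A₂ * (paritySign (γ A₁ + γ A₂ + b) *
        (F (A₁ ++ [c]) * G A₂ * Q (d :: B))))]
    refine splitSum_congr κ fun R A₂ _ => splitSum_congr κ fun A₁ B _ => ?_
    by_cases hz : Q (d :: B) = 0
    · simp [hz]
    have h2 := sign_cons_charge s hcd hz A₂
    have h3 : paritySign (γ A₁ + γ A₂ + b) = paritySign (γ A₁ + b) * paritySign (γ A₂) := by
      rw [← paritySign_add]; congr 1; ring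
    have h4 := paritySign_mul_self (γ A₂)
    rw [h3]
    linear_combination (paritySign (γ A₁ + b) * paritySign (γ A₂) * F (A₁ ++ [c]) * G A₂ *
      Q (d :: B)) * h2 + (paritySign (γ A₁ + b) * F (A₁ ++ [c]) * G A₂ * Q (d :: B)) * h4
  · simp only [← splitSum_mul_left]
    rw [← splitSum_assoc κ fun A₁ A₂ B => paritySign (γ A₁ + γ A₂ + b) *
      (F A₁ * G (A₂ ++ [c]) * Q (d :: B))]
    refine splitSum_congr κ fun A R hp => splitSum_congr κ fun B C _ => ?_
    by_cases ha : γ A = a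
    · rw [ha, add_assoc, paritySign_add]
      ring
    · simp [hF A R hp ha]

/-- The integrand of the commutator with the charge. -/
def commIntegrand (g : Spacetime → ℝ) (F : ClFunctional I) (c d : I) (p : Fin 3 → ℝ)
    (legs : List (Leg I)) : ℂ :=
  splitSum (fun x : Leg I => T.kind x.1) (fun A B =>
    pairIntegrand T (smearedCharge s g) F c d A B p -
      paritySign (ghostParity T.kind A + (T.kind c).ghostParity) *
        pairIntegrand T F (smearedCharge s g) c d A B p) legs

/-- The Leibniz rule already holds for fixed momentum and fixed contracted indices. When N_{cd} = 0
both sides vanish; otherwise `c` and `d` have equal kind, which the sign rules require. -/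
lemma commIntegrand_mul (g : Spacetime → ℝ) {F G : ClFunctional I} {a : ZMod 2} (c d : I)
    (p : Fin 3 → ℝ) {l : List (Leg I)}
    (hF : ∀ A B : List (Leg I), (A ++ B).Perm l → ghostParity T.kind A ≠ a → F A = 0) :
    commIntegrand s g (splitSum (fun x : Leg I => T.kind x.1) fun A B => F A * G B) c d p l =
      splitSum (fun x : Leg I => T.kind x.1) (fun A B => commIntegrand s g F c d p A * G B) l +
      paritySign a * splitSum (fun x : Leg I => T.kind x.1)
        (fun A B => F A * commIntegrand s g G c d p B) l := by
  have hform : ∀ (H : ClFunctional I) (l : List (Leg I)), commIntegrand s g H c d p l =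
      twoPoint T c d p * (splitSum (fun x : Leg I => T.kind x.1) (fun A B =>
        smearedCharge s g (A ++ [(c, planeWave (-1) (T.mass c) p)]) *
          H ((d, planeWave 1 (T.mass c) p) :: B)) l -
        splitSum (fun x : Leg I => T.kind x.1) (fun A B =>
          paritySign (ghostParity T.kind A + (T.kind c).ghostParity) *
          (H (A ++ [(c, planeWave (-1) (T.mass c) p)]) *
            smearedCharge s g ((d, planeWave 1 (T.mass c) p) :: B))) l) := by
    intro H l
    rw [← splitSum_sub, ← splitSum_mul_left]
    refine splitSum_congr _ fun A B _ => ?_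
    simp only [pairIntegrand]
    ring
  by_cases hN : T.N c d = 0
  · have h0 : twoPoint T c d p = 0 := by rw [twoPoint_eq_shellSymbol, hN, shellSymbol_zero]
    simp [hform, h0, splitSum_zero]
  · have hcd : T.kind (c, planeWave (-1) (T.mass c) p).1 = T.kind (d, planeWave 1 (T.mass c) p).1 :=
      kind_eq_of_N_ne_zero T hN
    simp only [hform]
    rw [splitSum_charge_mul_left s hcd hF, splitSum_charge_mul_right s hcd _ hF]
    simp only [mul_sub, sub_mul, splitSum_sub, mul_assoc, splitSum_mul_left]
    have h5 : ∀ Ψ : List (Leg I) → ℂ, splitSum (fun x : Leg I => T.kind x.1)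
        (fun A B => F A * (twoPoint T c d p * Ψ B)) l = twoPoint T c d p *
        splitSum (fun x : Leg I => T.kind x.1) (fun A B => F A * Ψ B) l := fun Ψ => by
      rw [← splitSum_mul_left]
      exact splitSum_congr _ fun A B _ => by ring
    simp only [h5]
    ring

variable {g : Spacetime → ℝ}

lemma integrable_commIntegrand (hg : ContDiff ℝ ∞ fun x => (g x : ℂ))
    (hgc : TimeCompact fun x => (g x : ℂ)) {F : ClFunctional I} (hF : Tame F) (c d : I)
    {legs : List (Leg I)} (hl : CompactLegs legs) :
    Integrable (fun p => commIntegrand s g F c d p legs) ∧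
    ∫ p, commIntegrand s g F c d p legs = splitSum (fun x : Leg I => T.kind x.1) (fun A B =>
      pairIntegral T (smearedCharge s g) F c d A B -
        paritySign (ghostParity T.kind A + (T.kind c).ghostParity) *
          pairIntegral T F (smearedCharge s g) c d A B) legs := by
  have hint : ∀ A B : List (Leg I), (A ++ B).Perm legs →
      Integrable (pairIntegrand T (smearedCharge s g) F c d A B) ∧
      Integrable (pairIntegrand T F (smearedCharge s g) c d A B) := fun A B hp =>
    ⟨integrable_pairIntegrand_left s hg hgc hF c d (CompactLegs.left (hl.perm hp))
      (CompactLegs.right (hl.perm hp)),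
    integrable_pairIntegrand_right s hg hgc hF c d (CompactLegs.left (hl.perm hp))
      (CompactLegs.right (hl.perm hp))⟩
  have h := integral_splitSum (μ := volume) (fun x : Leg I => T.kind x.1)
    (Φ := fun p A B => pairIntegrand T (smearedCharge s g) F c d A B p -
      paritySign (ghostParity T.kind A + (T.kind c).ghostParity) *
        pairIntegrand T F (smearedCharge s g) c d A B p) (l := legs)
    fun A B hp => (hint A B hp).1.sub ((hint A B hp).2.const_mul _)
  refine ⟨h.1, h.2.trans (splitSum_congr _ fun A B hp => ?_)⟩
  rw [integral_sub (hint A B hp).1 ((hint A B hp).2.const_mul _), integral_const_mul]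
  rfl

lemma oddComm_one_eq_integral (hg : ContDiff ℝ ∞ fun x => (g x : ℂ))
    (hgc : TimeCompact fun x => (g x : ℂ)) {F : ClFunctional I} (hF : Tame F) {legs : List (Leg I)}
    (hl : CompactLegs legs) : oddComm T 1 (smearedCharge s g) F legs =
      ∑ c, ∑ d, ∫ p, commIntegrand s g F c d p legs := by
  rw [oddComm_one_apply]
  simp only [splitSum_finset_sum, (integrable_commIntegrand s hg hgc hF _ _ hl).2]

lemma oddComm_one_add (hg : ContDiff ℝ ∞ fun x => (g x : ℂ))
    (hgc : TimeCompact fun x => (g x : ℂ)) {F G : ClFunctional I} (hF : Tame F) (hG : Tame G)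
    {legs : List (Leg I)} (hl : CompactLegs legs) :
    oddComm T 1 (smearedCharge s g) (fun legs => F legs + G legs) legs =
      oddComm T 1 (smearedCharge s g) F legs + oddComm T 1 (smearedCharge s g) G legs := by
  rw [oddComm_one_eq_integral s hg hgc (hF.add hG) hl, oddComm_one_eq_integral s hg hgc hF hl,
    oddComm_one_eq_integral s hg hgc hG hl]
  simp only [← Finset.sum_add_distrib]
  refine Finset.sum_congr rfl fun c _ => Finset.sum_congr rfl fun d _ => ?_
  rw [← integral_add (integrable_commIntegrand s hg hgc hF c d hl).1
    (integrable_commIntegrand s hg hgc hG c d hl).1]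
  refine integral_congr_ae (Eventually.of_forall fun p => ?_)
  simp only [commIntegrand]
  rw [← splitSum_add]
  refine splitSum_congr _ fun A B _ => ?_
  simp only [pairIntegrand]
  ring

lemma oddComm_one_const_mul (hg : ContDiff ℝ ∞ fun x => (g x : ℂ))
    (hgc : TimeCompact fun x => (g x : ℂ)) {F : ClFunctional I} (hF : Tame F) (z : ℂ)
    {legs : List (Leg I)} (hl : CompactLegs legs) :
    oddComm T 1 (smearedCharge s g) (fun legs => z * F legs) legs =
      z * oddComm T 1 (smearedCharge s g) F legs := by
  rw [oddComm_one_eq_integral s hg hgc (hF.const_mul z) hl, oddComm_one_eq_integral s hg hgc hF hl]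
  simp only [Finset.mul_sum, ← integral_const_mul]
  refine Finset.sum_congr rfl fun c _ => Finset.sum_congr rfl fun d _ =>
    integral_congr_ae (Eventually.of_forall fun p => ?_)
  simp only [commIntegrand]
  rw [← splitSum_mul_left]
  refine splitSum_congr _ fun A B _ => ?_
  simp only [pairIntegrand]
  ring

lemma oddComm_one_sum (hg : ContDiff ℝ ∞ fun x => (g x : ℂ))
    (hgc : TimeCompact fun x => (g x : ℂ)) {ι : Type*} (t : Finset ι) {F : ι → ClFunctional I}
    (hF : ∀ i ∈ t, Tame (F i)) {legs : List (Leg I)} (hl : CompactLegs legs) :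
    oddComm T 1 (smearedCharge s g) (fun legs => ∑ i ∈ t, F i legs) legs =
      ∑ i ∈ t, oddComm T 1 (smearedCharge s g) (F i) legs := by
  classical
  induction t using Finset.induction_on with
  | empty =>
    have h := oddComm_one_const_mul s hg hgc tame_zero 0 hl
    simpa using h
  | insert i t hi ih =>
    simp only [Finset.sum_insert hi]
    have ht : ∀ j ∈ t, Tame (F j) := fun j hj => hF j (Finset.mem_insert_of_mem hj)
    rw [oddComm_one_add s hg hgc (hF i (Finset.mem_insert_self _ _)) (Tame.sum t ht) hl, ih ht]

/-- The commutator with the charge is a graded derivation of the classical product. -/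
lemma oddComm_one_mul (hg : ContDiff ℝ ∞ fun x => (g x : ℂ))
    (hgc : TimeCompact fun x => (g x : ℂ)) {F G : ClFunctional I} (hF : Tame F) (hG : Tame G)
    {a : ZMod 2} (ha : ∀ legs, SmoothLegs legs → ghostParity T.kind legs ≠ a → F legs = 0)
    {legs : List (Leg I)} (hl : CompactLegs legs) :
    oddComm T 1 (smearedCharge s g)
        (splitSum (fun x : Leg I => T.kind x.1) fun A B => F A * G B) legs =
      splitSum (fun x : Leg I => T.kind x.1)
        (fun A B => oddComm T 1 (smearedCharge s g) F A * G B) legs +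
      paritySign a * splitSum (fun x : Leg I => T.kind x.1)
        (fun A B => F A * oddComm T 1 (smearedCharge s g) G B) legs := by
  have hL : ∀ {A B : List (Leg I)}, (A ++ B).Perm legs → CompactLegs A := fun hp =>
    CompactLegs.left (hl.perm hp)
  have hR : ∀ {A B : List (Leg I)}, (A ++ B).Perm legs → CompactLegs B := fun hp =>
    CompactLegs.right (hl.perm hp)
  rw [oddComm_one_eq_integral s hg hgc (hF.splitSum T.kind hG) hl]
  have h1 : ∀ c d, ∫ p, commIntegrand s g
      (splitSum (fun x : Leg I => T.kind x.1) fun A B => F A * G B) c d p legs =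
      splitSum (fun x : Leg I => T.kind x.1)
        (fun A B => (∫ p, commIntegrand s g F c d p A) * G B) legs +
      paritySign a * splitSum (fun x : Leg I => T.kind x.1)
        (fun A B => F A * ∫ p, commIntegrand s g G c d p B) legs := by
    intro c d
    simp only [commIntegrand_mul s g c d _ fun A B hp => ha A (hL hp).smooth]
    have i1 := integral_splitSum (μ := volume) (fun x : Leg I => T.kind x.1)
      (Φ := fun p A B => commIntegrand s g F c d p A * G B) (l := legs)
      fun A B hp => (integrable_commIntegrand s hg hgc hF c d (hL hp)).1.mul_const _
    have i2 := integral_splitSum (μ := volume) (fun x : Leg I => T.kind x.1)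
      (Φ := fun p A B => F A * commIntegrand s g G c d p B) (l := legs)
      fun A B hp => (integrable_commIntegrand s hg hgc hG c d (hR hp)).1.const_mul _
    rw [integral_add i1.1 (i2.1.const_mul _), integral_const_mul, i1.2, i2.2]
    simp only [integral_mul_const, integral_const_mul]
  simp only [h1, Finset.sum_add_distrib, ← Finset.mul_sum, ← splitSum_finset_sum]
  congr 1
  · refine splitSum_congr _ fun A B hp => ?_
    rw [oddComm_one_eq_integral s hg hgc hF (hL hp)]
    simp only [Finset.sum_mul]
  · congr 1
    refine splitSum_congr _ fun A B hp => ?_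
    rw [oddComm_one_eq_integral s hg hgc hG (hR hp)]

end Leibniz

/-! ## The BRS differential -/

lemma tame_hsmul {I : Type*} {F : Functional I} (hF : ∀ l, Tame (F l)) (c : PowerSeries ℂ)
    (l : ℕ) : Tame (hsmul c F l) :=
  Tame.sum _ fun q _ => (hF q.2).const_mul _

section Differential

variable {I : Type*} [Fintype I] [DecidableEq I] {T : FreeTheory I} (s : FreeBRS T)
  (ρ : Regulator)

lemma Regulator.contDiff_unbounded : ContDiff ℝ ∞ fun x => ((ρ.unbounded x : ℝ) : ℂ) :=
  contDiff_timeFun ρ.k_smooth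

lemma Regulator.timeCompact_unbounded : TimeCompact fun x => ((ρ.unbounded x : ℝ) : ℂ) :=
  timeCompact_timeFun ρ.k_compact

/-- The classical BRS transformation of on-shell functionals, generated by the charge without a
cutoff in space. -/
def classicalBRS (F : ClFunctional I) (hs : List (Solution T)) : ℂ :=
  clRestrict T (oddComm T 1 (smearedCharge s ρ.unbounded) F) hs

/-- Four reasons: graded commutativity (r = 0), conservation of the current (r = 1), power counting
(r = 2), and the charge being quadratic (r ≥ 3). -/
lemma tendsto_clRestrict_oddComm (r : ℕ) {F : ClFunctional I} (hF : Tame F)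
    (hs : List (Solution T)) :
    Tendsto (fun ε => clRestrict T (oddComm T r (smearedCharge s (ρ.scaled ε)) F) hs)
      (𝓝[>] (0 : ℝ)) (𝓝 (if r = 1 then classicalBRS s ρ F hs else 0)) := by
  have hzero : clRestrict T (fun _ => (0 : ℂ)) hs = 0 := by
    simp
  match r with
  | 0 =>
    simp only [zero_ne_one, if_false]
    rw [← hzero]
    refine tendsto_clRestrict (fun legs _ => ?_) hs
    simp only [oddComm_zero_smearedCharge]
    exact tendsto_const_nhds
  | 1 =>
    simp only [if_true]
    exact tendsto_clRestrict_oddComm_one s ρ hF hs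
  | 2 =>
    simp only [OfNat.ofNat_ne_one, if_false]
    rw [← hzero]
    exact tendsto_clRestrict (fun legs hl => tendsto_oddComm_two s ρ hF hl) hs
  | r + 3 =>
    simp only [show r + 3 ≠ 1 by omega, if_false]
    rw [← hzero]
    refine tendsto_clRestrict (fun legs _ => ?_) hs
    simp only [oddComm_smearedCharge_eq_zero s _ (show 3 ≤ r + 3 by omega)]
    exact tendsto_const_nhds

/-- The limit of the commutator with the charge: `ħ` times the classical BRS transformation. -/
def brsLimit (F : Functional I) : OnShell T
  | 0, _ => 0
  | l + 1, hs => classicalBRS s ρ (F l) hs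

variable {F G : Functional I}

lemma tendsto_chargeComm (hF : ∀ l, Tame (F l)) (l : ℕ) (hs : List (Solution T)) :
    Tendsto (fun ε => chargeComm s ρ F ε l hs) (𝓝[>] (0 : ℝ)) (𝓝 (brsLimit s ρ F l hs)) := by
  have h1 : ∀ ε, chargeComm s ρ F ε l hs = ∑ q ∈ Finset.HasAntidiagonal.antidiagonal l,
      clRestrict T (oddComm T q.1 (smearedCharge s (ρ.scaled ε)) (F q.2)) hs := fun ε => by
    rw [← clRestrict_finset_sum]
    exact clRestrict_congr (fun legs _ => gradedComm_ofClassical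
      (oddFunctional_smearedCharge s (ρ.scaled ε)) F l legs) hs
  have h2 : brsLimit s ρ F l hs = ∑ q ∈ Finset.HasAntidiagonal.antidiagonal l,
      if q.1 = 1 then classicalBRS s ρ (F q.2) hs else 0 := by
    match l with
    | 0 => simp [brsLimit]
    | l + 1 =>
      -- Only one contraction survives, so order l + 1 in ħ receives exactly the coefficient of
      -- order l of `F`.
      rw [Finset.sum_eq_single (1, l)]
      · simp [brsLimit]
      · rintro ⟨a, b⟩ hab hne
        refine if_neg fun h : a = 1 => hne ?_
        subst h
        rw [Finset.HasAntidiagonal.mem_antidiagonal] at hab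
        simp only at hab
        rw [show b = l by omega]
      · intro h
        exact absurd (by simp [add_comm]) h
  simp only [h1, h2]
  exact tendsto_finsetSum _ fun q _ => tendsto_clRestrict_oddComm s ρ q.1 (hF q.2) hs

lemma tendsto_chargePoisson (hF : ∀ l, Tame (F l)) (l : ℕ) (hs : List (Solution T)) :
    Tendsto (fun ε => chargePoisson s ρ F ε l hs) (𝓝[>] (0 : ℝ))
      (𝓝 (Complex.I * classicalBRS s ρ (F l) hs)) := by
  have h1 : ∀ ε, chargePoisson s ρ F ε l hs = Complex.I *
      clRestrict T (oddComm T 1 (smearedCharge s (ρ.scaled ε)) (F l)) hs := fun ε => by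
    rw [← clRestrict_mul_left]
    exact clRestrict_congr (fun legs _ => poisson_ofClassical
      (oddFunctional_smearedCharge s (ρ.scaled ε)) (oddComm_zero_smearedCharge s _) F l legs) hs
  simp only [h1]
  exact (tendsto_clRestrict_oddComm_one s ρ (hF l) hs).const_mul _

lemma dQ_eq (hF : ∀ l, Tame (F l)) : dQ s ρ F = brsLimit s ρ F := by
  ext l hs
  exact (tendsto_chargeComm s ρ hF l hs).limUnder_eq

lemma poissonQ_eq (hF : ∀ l, Tame (F l)) :
    poissonQ s ρ F = fun l hs => Complex.I * classicalBRS s ρ (F l) hs := by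
  ext l hs
  exact (tendsto_chargePoisson s ρ hF l hs).limUnder_eq

lemma classicalBRS_add {F G : ClFunctional I} (hF : Tame F) (hG : Tame G)
    (hs : List (Solution T)) :
    classicalBRS s ρ (fun legs => F legs + G legs) hs =
      classicalBRS s ρ F hs + classicalBRS s ρ G hs := by
  simp only [classicalBRS]
  rw [← clRestrict_add]
  exact clRestrict_congr (fun legs hl => oddComm_one_add s ρ.contDiff_unbounded
    ρ.timeCompact_unbounded hF hG hl) hs

lemma classicalBRS_sum_mul {ι : Type*} (t : Finset ι) (z : ι → ℂ) {F : ι → ClFunctional I}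
    (hF : ∀ i, Tame (F i)) (hs : List (Solution T)) :
    classicalBRS s ρ (fun legs => ∑ i ∈ t, z i * F i legs) hs =
      ∑ i ∈ t, z i * classicalBRS s ρ (F i) hs := by
  simp only [classicalBRS, ← clRestrict_mul_left]
  rw [← clRestrict_finset_sum]
  refine clRestrict_congr (fun legs hl => ?_) hs
  rw [oddComm_one_sum s ρ.contDiff_unbounded ρ.timeCompact_unbounded t
    (fun i _ => (hF i).const_mul (z i)) hl]
  exact Finset.sum_congr rfl fun i _ => oddComm_one_const_mul s ρ.contDiff_unbounded
    ρ.timeCompact_unbounded (hF i) (z i) hl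

lemma clRestrict_mul_splitSum {F G : ClFunctional I} (hF : VanishesAtZero F)
    (hG : VanishesAtZero G) (hs : List (Solution T)) :
    clRestrict T (splitSum (fun x : Leg I => T.kind x.1) fun A B => F A * G B) hs =
      splitSum (fun h : Solution T => h.kind)
        (fun A B => clRestrict T F A * clRestrict T G B) hs := by
  rw [clRestrict_splitSum]
  · simp only [clRestrict_mul_left, clRestrict_mul_right]
  · rintro A B hA hB ⟨x, hx, hx0⟩
    rcases List.mem_append.1 hx with hx | hx
    · rw [hF A hA ⟨x, hx, hx0⟩, zero_mul]
    · rw [hG B hB ⟨x, hx, hx0⟩, mul_zero]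

lemma classicalBRS_mul {F G : ClFunctional I} (hF : Tame F) (hG : Tame G) {a : ZMod 2}
    (ha : ∀ legs, SmoothLegs legs → ghostParity T.kind legs ≠ a → F legs = 0)
    (hs : List (Solution T)) :
    classicalBRS s ρ (splitSum (fun x : Leg I => T.kind x.1) fun A B => F A * G B) hs =
      splitSum (fun h : Solution T => h.kind)
        (fun A B => classicalBRS s ρ F A * clRestrict T G B) hs +
      paritySign a * splitSum (fun h : Solution T => h.kind)
        (fun A B => clRestrict T F A * classicalBRS s ρ G B) hs := by
  have h := clRestrict_congr (T := T) (fun legs hl => oddComm_one_mul s ρ.contDiff_unbounded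
    ρ.timeCompact_unbounded hF hG ha hl) hs
  rw [classicalBRS, h, clRestrict_add, clRestrict_mul_left,
    clRestrict_mul_splitSum (vanishesAtZero_oddComm_one s _ hF) hG.vanishesAtZero,
    clRestrict_mul_splitSum hF.vanishesAtZero (vanishesAtZero_oddComm_one s _ hG)]
  rfl

lemma mul_eq (F G : Functional I) (l : ℕ) : mul T.kind F G l = fun legs =>
    ∑ q ∈ Finset.HasAntidiagonal.antidiagonal l,
      splitSum (fun x : Leg I => T.kind x.1) (fun A B => F q.1 A * G q.2 B) legs := by
  ext legs
  exact gmul_apply _ F G l legs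

lemma tame_mul (hF : ∀ l, Tame (F l)) (hG : ∀ l, Tame (G l)) (l : ℕ) :
    Tame (mul T.kind F G l) := by
  rw [mul_eq]
  exact Tame.sum _ fun q _ => (hF q.1).splitSum T.kind (hG q.2)

lemma hsmul_brsLimit_succ (c : PowerSeries ℂ) (F : Functional I) (l : ℕ) (hs : List (Solution T)) :
    hsmul c (brsLimit s ρ F) (l + 1) hs = ∑ q ∈ Finset.HasAntidiagonal.antidiagonal l,
      PowerSeries.coeff q.1 c * classicalBRS s ρ (F q.2) hs := by
  rw [hsmul, Finset.Nat.sum_antidiagonal_succ']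
  simp [brsLimit]

/-- Since -i · i = 1, and multiplication by `X` shifts the order in ħ by the one contraction. -/
lemma brsLimit_eq_hsmul_poisson (F : Functional I) :
    brsLimit s ρ F = hsmul (PowerSeries.C (-Complex.I) * PowerSeries.X)
      fun l hs => Complex.I * classicalBRS s ρ (F l) hs := by
  have hI : ∀ z : ℂ, -(Complex.I * (Complex.I * z)) = z := fun z => by
    rw [← mul_assoc, Complex.I_mul_I]; ring
  ext l hs
  match l with
  | 0 => simp [brsLimit, hsmul]
  | l + 1 =>
    rw [hsmul, Finset.Nat.sum_antidiagonal_succ, Finset.sum_eq_single (0, l)]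
    · simp [brsLimit, hI]
    · rintro ⟨a, b⟩ hab hne
      have ha : a ≠ 0 := fun h => hne (by subst h; simpa using hab)
      simp [PowerSeries.coeff_C, ha]
    · intro h
      exact absurd (by simp) h

lemma brsLimit_add_hsmul (hF : ∀ l, Tame (F l)) (hG : ∀ l, Tame (G l)) (a b : PowerSeries ℂ) :
    brsLimit s ρ (hsmul a F + hsmul b G) =
      hsmul a (brsLimit s ρ F) + hsmul b (brsLimit s ρ G) := by
  ext l hs
  match l with
  | 0 => simp [brsLimit, hsmul]
  | l + 1 =>
    rw [Pi.add_apply, Pi.add_apply, hsmul_brsLimit_succ, hsmul_brsLimit_succ,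
      ← classicalBRS_sum_mul s ρ _ (fun q : ℕ × ℕ => PowerSeries.coeff q.1 a)
        (fun q => hF q.2) hs,
      ← classicalBRS_sum_mul s ρ _ (fun q : ℕ × ℕ => PowerSeries.coeff q.1 b)
        (fun q => hG q.2) hs]
    exact classicalBRS_add s ρ (tame_hsmul hF a l) (tame_hsmul hG b l) hs

lemma brsLimit_mul (hF : ∀ l, Tame (F l)) (hG : ∀ l, Tame (G l)) {a : ZMod 2}
    (ha : HasParity T.kind a F) :
    brsLimit s ρ (mul T.kind F G) = OnShell.mul (brsLimit s ρ F) (restrict T G)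
      + paritySign a • OnShell.mul (restrict T F) (brsLimit s ρ G) := by
  ext l hs
  rw [Pi.add_apply, Pi.add_apply, Pi.smul_apply, Pi.smul_apply, smul_eq_mul, OnShell.mul,
    OnShell.mul, gmul_apply, gmul_apply]
  match l with
  | 0 => simp [brsLimit, splitSum_zero]
  | l + 1 =>
    -- The limit has no term of order ħ⁰; splitting off the end at which it would occur aligns both
    -- sums with the order l of the classical product.
    rw [Finset.Nat.sum_antidiagonal_succ, Finset.Nat.sum_antidiagonal_succ']
    simp only [brsLimit, zero_mul, mul_zero, splitSum_zero, zero_add, restrict]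
    rw [mul_eq, Finset.mul_sum, ← Finset.sum_add_distrib]
    have h := classicalBRS_sum_mul s ρ (Finset.HasAntidiagonal.antidiagonal l) (fun _ => 1)
      (F := fun q : ℕ × ℕ => splitSum (fun x : Leg I => T.kind x.1) fun A B =>
        F q.1 A * G q.2 B) (fun q => (hF q.1).splitSum T.kind (hG q.2)) hs
    simp only [one_mul] at h
    rw [h]
    exact Finset.sum_congr rfl fun q _ => classicalBRS_mul s ρ (hF q.1) (hG q.2)
      (fun legs => ha q.1 legs) hs

end Differential

end BRS

end

/-! ### The theorem. -/

open BRS in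
theorem lemma1 {I : Type*} [Fintype I] [DecidableEq I] (T : FreeTheory I) (s : FreeBRS T)
    (ρ : Regulator)
    (hvac : ∀ F : Functional I, IsField T.kind F → vacuum (dQ s ρ F) = 0) :
    -- the limits defining `d_Q F` and `{Q, F}` exist, and `d_Q F = -iħ {Q, F}`
    (∀ F : Functional I, IsField T.kind F →
      (∀ l hs, Tendsto (fun ε => chargeComm s ρ F ε l hs) (𝓝[>] (0 : ℝ)) (𝓝 (dQ s ρ F l hs))) ∧
      (∀ l hs, Tendsto (fun ε => chargePoisson s ρ F ε l hs) (𝓝[>] (0 : ℝ))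
        (𝓝 (poissonQ s ρ F l hs))) ∧
      dQ s ρ F = hsmul (PowerSeries.C (-Complex.I) * PowerSeries.X) (poissonQ s ρ F)) ∧
    -- `d_Q` is linear
    (∀ F G : Functional I, IsField T.kind F → IsField T.kind G → ∀ a b : PowerSeries ℂ,
      dQ s ρ (hsmul a F + hsmul b G) = hsmul a (dQ s ρ F) + hsmul b (dQ s ρ G)) ∧
    -- and satisfies the graded Leibniz rule with respect to the classical product
    (∀ F G : Functional I, IsField T.kind F → IsField T.kind G →
      ∀ a : ZMod 2, HasParity T.kind a F →
        dQ s ρ (mul T.kind F G) =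
          OnShell.mul (dQ s ρ F) (restrict T G)
            + paritySign a • OnShell.mul (restrict T F) (dQ s ρ G)) := by
  refine ⟨fun F hF => ?_, fun F G hF hG a b => ?_, fun F G hF hG a ha => ?_⟩
  · have ht : ∀ l, Tame (F l) := hF.tame
    rw [dQ_eq s ρ ht, poissonQ_eq s ρ ht]
    exact ⟨tendsto_chargeComm s ρ ht, tendsto_chargePoisson s ρ ht, brsLimit_eq_hsmul_poisson s ρ F⟩
  · rw [dQ_eq s ρ hF.tame, dQ_eq s ρ hG.tame, dQ_eq s ρ (F := hsmul a F + hsmul b G) fun l =>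
      (tame_hsmul hF.tame a l).add (tame_hsmul hG.tame b l)]
    exact brsLimit_add_hsmul s ρ hF.tame hG.tame a b
  · rw [dQ_eq s ρ hF.tame, dQ_eq s ρ hG.tame, dQ_eq s ρ (tame_mul hF.tame hG.tame)]
    exact brsLimit_mul s ρ hF.tame hG.tame ha
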